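/- All graphs are finite and simple. A proper interval graph is the intersection graph of closed real intervals none of which properly contains another. A proper interval (PIG-) completion of $G=(V,E)$ is a proper interval graph $H=(V,E\cup F)$ with $E\cap F=\emptyset$; it is minimum if the number $|F|$ of fill edges is the smallest possible. A caterpillar is a tree $G$ with a central path $v_0,\dots,v_k$, i.e. a path such that every vertex outside it is adjacent to a vertex of it. The set $V_i$ of sons of $v_i$ consists of the vertices outside the path that are adjacent to $v_i$. Let $G$ be a caterpillar and $v_0,\dots,v_k$ ($k\ge 0$) a central path of $G$. A normal model represents each $v_i$ by the interval $[i,i+1]$ and each son of $v_i$ by the point $i$ (a left son) or by the point $i+1$ (a right son). A graph $H$ on $V$ is in normal form if it is the intersection graph of a normal model. Define, for $0\le j\le |V_i|$, $$N_{k,j}=\binom{|V_k|-j}{2},\qquad N_{i,j}=\min_{0\le j'\le |V_{i+1}|}\left(\binom{|V_i|-j+j'+1}{2}+N_{i+1,j'}\right)\quad(0\le i<k).$$ Then: 1. Every graph in normal form is a proper interval completion of $G$, and some minimum proper interval completion of $G$ is in normal form. 2. Every minimum proper interval completion of $G$ has exactly $\min_{0\le j\le |V_0|}\left(\binom{j}{2}+N_{0,j}\right)$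 fill edges. 3. Let $\ell_0,\dots,\ell_k$, with $0\le \ell_i\le |V_i|$, be such that $j=\ell_0$ attains the minimum in 2 and, for every $i<k$, $j'=\ell_{i+1}$ attains the minimum that defines $N_{i,\ell_i}$. Such choices exist, for each of them there is a normal model in which every $v_i$ has exactly $\ell_i$ left sons, and the intersection graph of every such model is a minimum proper interval completion of $G$. 4. There is an algorithm (a program of a unit-cost random access machine with addition, truncated subtraction and comparison) and a constant $C$ such that, for every caterpillar $G$ on $\{0,\dots,n-1\}$ given by its adjacency matrix, it halts after at most $Cn^2$ steps and outputs the adjacency matrix of a minimum proper interval completion $H$ of $G$ and the number of fill edges of $H$, where, for some central path of $G$, $H$ is the intersection graph of a normal model whose numbers of left sons are choices as in 3. -/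

import Mathlib

namespace CaterpillarPIG

/-! ### Proper interval graphs and their completions -/

/-- `J` is an intersection model of `H` : two distinct vertices are adjacent exactly when the sets
that represent them meet. -/
def IsIntersectionModel {V : Type*} (H : SimpleGraph V) (J : V → Set ℝ) : Prop :=
  ∀ x y, x ≠ y → (H.Adj x y ↔ (J x ∩ J y).Nonempty)

/-- A proper interval graph: it has an intersection model by closed intervals of the real line,
none of which is properly contained in another one. -/
def IsProperIntervalGraph {V : Type*} (H : SimpleGraph V) : Prop :=
  ∃ J : V → Set ℝ, (∀ x, ∃ a b : ℝ, a ≤ b ∧ J x = Set.Icc a b) ∧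
    IsIntersectionModel H J ∧ ∀ x y, ¬ J x ⊂ J y

/-- `H` is a proper interval completion of `G`. -/
def IsPIGCompletion {V : Type*} (G H : SimpleGraph V) : Prop :=
  G ≤ H ∧ IsProperIntervalGraph H

/-- The number of fill edges of a completion `H` of `G`. -/
noncomputable def fillNumber {V : Type*} (G H : SimpleGraph V) : ℕ :=
  (H.edgeSet \ G.edgeSet).ncard

/-- `H` is a minimum proper interval completion of `G`. -/
def IsMinPIGCompletion {V : Type*} (G H : SimpleGraph V) : Prop :=
  IsPIGCompletion G H ∧ ∀ H', IsPIGCompletion G H' → fillNumber G H ≤ fillNumber G H'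

/-! ### Caterpillars -/

/-- `v 0, …, v k` is a central path of `G` : a path such that every vertex outside the path is
adjacent to a vertex of the path (in a tree with at least three vertices, the vertices of degree at
least two form such a path if there is any). -/
structure IsCentralPath {V : Type*} (G : SimpleGraph V) {k : ℕ} (v : Fin (k + 1) → V) : Prop where
  injective : Function.Injective v
  adj : ∀ i : Fin k, G.Adj (v i.castSucc) (v i.succ)
  dominating : ∀ x, x ∉ Set.range v → ∃ i, G.Adj (v i) x

/-- A caterpillar: a tree with a central path. -/
def IsCaterpillar {V : Type*} (G : SimpleGraph V) : Prop :=
  G.IsTree ∧ ∃ (k : ℕ) (v : Fin (k + 1) → V), IsCentralPath G v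

/-- The sons of the `i`-th vertex of the central path: the vertices outside of the path that are
adjacent to it. -/
def sons {V : Type*} (G : SimpleGraph V) {k : ℕ} (v : Fin (k + 1) → V) (i : Fin (k + 1)) : Set V :=
  {x | x ∉ Set.range v ∧ G.Adj (v i) x}

/-- The normal form of a model: `v i` is the interval `[i, i + 1]`, and every son of `v i` is the
point `i` or the point `i + 1`. -/
structure IsNormalModel {V : Type*} (G : SimpleGraph V) {k : ℕ} (v : Fin (k + 1) → V)
    (J : V → Set ℝ) : Prop where
  spine : ∀ i, J (v i) = Set.Icc ((i : ℕ) : ℝ) (((i : ℕ) : ℝ) + 1)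
  leaf : ∀ i, ∀ x ∈ sons G v i, J x = {((i : ℕ) : ℝ)} ∨ J x = {((i : ℕ) : ℝ) + 1}

/-- The number of left sons of `v i` in a normal model: those at the point `i`. -/
noncomputable def numLeftSons {V : Type*} (G : SimpleGraph V) {k : ℕ} (v : Fin (k + 1) → V)
    (J : V → Set ℝ) (i : Fin (k + 1)) : ℕ :=
  {x ∈ sons G v i | J x = {((i : ℕ) : ℝ)}}.ncard

/-! ### The dynamic program -/

/-- The numbers of sons, as a function of an unrestricted index (zero beyond `k`). -/
noncomputable def numSons {V : Type*} (G : SimpleGraph V) {k : ℕ} (v : Fin (k + 1) → V)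
    (i : ℕ) : ℕ :=
  if h : i < k + 1 then (sons G v ⟨i, h⟩).ncard else 0

/-- The table of the dynamic program, for a central path `v 0, …, v k` with `m i` sons at `v i`:
`N k j = (m k - j).choose 2`, and for `i < k`
`N i j = min_{0 ≤ j' ≤ m (i + 1)} ((m i - j + j' + 1).choose 2 + N (i + 1) j')`.
It is only used for `j ≤ m i`. -/
def dpTable (k : ℕ) (m : ℕ → ℕ) (i j : ℕ) : ℕ :=
  if i < k then
    (Finset.range (m (i + 1) + 1)).inf' Finset.nonempty_range_add_one
      fun j' => (m i - j + j' + 1).choose 2 + dpTable k m (i + 1) j'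
  else (m k - j).choose 2
termination_by k - i

/-- The value of the dynamic program: `min_{0 ≤ j ≤ m 0} (j.choose 2 + N 0 j)`. -/
def dpValue (k : ℕ) (m : ℕ → ℕ) : ℕ :=
  (Finset.range (m 0 + 1)).inf' Finset.nonempty_range_add_one
    fun j => j.choose 2 + dpTable k m 0 j

/-- `ℓ 0, …, ℓ k` are choices of `j` at which the successive minima of the dynamic program are
attained. -/
structure IsDPChoice (k : ℕ) (m : ℕ → ℕ) (ℓ : Fin (k + 1) → ℕ) : Prop where
  le : ∀ i, ℓ i ≤ m i
  first : (ℓ 0).choose 2 + dpTable k m 0 (ℓ 0) = dpValue k m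
  next : ∀ i : Fin k,
    (m (i : ℕ) - ℓ i.castSucc + ℓ i.succ + 1).choose 2 + dpTable k m ((i : ℕ) + 1) (ℓ i.succ) =
      dpTable k m (i : ℕ) (ℓ i.castSucc)

/-! ### A random access machine with unit costs

Programs work on registers `0, 1, 2, …` and on arrays `0, 1, 2, …`, all of which hold natural
numbers. Register numbers and array numbers are fixed in the program text; array positions are
computed. The arithmetic operations are addition, truncated subtraction and comparisons, and there
is no multiplication. Each operation has cost one. -/

structure Store where
  reg : ℕ → ℕ
  arr : ℕ → ℕ → ℕ

inductive RExpr where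
  | const (c : ℕ)
  | reg (x : ℕ)
  | read (a : ℕ) (pos : RExpr)
  | add (e f : RExpr)
  | sub (e f : RExpr)
  | eq (e f : RExpr)
  | lt (e f : RExpr)

namespace RExpr

def eval (s : Store) : RExpr → ℕ
  | const c => c
  | reg x => s.reg x
  | read a pos => s.arr a (pos.eval s)
  | add e f => e.eval s + f.eval s
  | sub e f => e.eval s - f.eval s
  | eq e f => if e.eval s = f.eval s then 1 else 0
  | lt e f => if e.eval s < f.eval s then 1 else 0

/-- The cost of evaluating an expression: the number of its constants, registers, array accesses
and operations. -/
def cost : RExpr → ℕ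
  | const _ => 1
  | reg _ => 1
  | read _ pos => pos.cost + 1
  | add e f => e.cost + f.cost + 1
  | sub e f => e.cost + f.cost + 1
  | eq e f => e.cost + f.cost + 1
  | lt e f => e.cost + f.cost + 1

end RExpr

inductive Program where
  | skip
  | assign (x : ℕ) (e : RExpr)
  | write (a : ℕ) (pos e : RExpr)
  | seq (p q : Program)
  | ite (e : RExpr) (p q : Program)
  | loop (e : RExpr) (p : Program)

def Store.setReg (s : Store) (x c : ℕ) : Store :=
  { s with reg := Function.update s.reg x c }

def Store.setArr (s : Store) (a pos c : ℕ) : Store :=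
  { s with arr := Function.update s.arr a (Function.update (s.arr a) pos c) }

/-- `Run p s t s'` : started in the store `s`, the program `p` halts after exactly `t` steps, in the
store `s'`. Nonzero values count as true; `loop e p` repeats `p` as long as `e` is true. -/
inductive Run : Program → Store → ℕ → Store → Prop where
  | skip (s : Store) : Run .skip s 1 s
  | assign (s : Store) (x : ℕ) (e : RExpr) :
      Run (.assign x e) s (e.cost + 1) (s.setReg x (e.eval s))
  | write (s : Store) (a : ℕ) (pos e : RExpr) :
      Run (.write a pos e) s (pos.cost + e.cost + 1) (s.setArr a (pos.eval s) (e.eval s))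
  | seq {p q : Program} {s s' s'' : Store} {t u : ℕ} :
      Run p s t s' → Run q s' u s'' → Run (.seq p q) s (t + u) s''
  | ite_true {e : RExpr} {p q : Program} {s s' : Store} {t : ℕ} :
      e.eval s ≠ 0 → Run p s t s' → Run (.ite e p q) s (e.cost + t + 1) s'
  | ite_false {e : RExpr} {p q : Program} {s s' : Store} {t : ℕ} :
      e.eval s = 0 → Run q s t s' → Run (.ite e p q) s (e.cost + t + 1) s'
  | loop_true {e : RExpr} {p : Program} {s s' s'' : Store} {t u : ℕ} :
      e.eval s ≠ 0 → Run p s t s' → Run (.loop e p) s' u s'' →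
        Run (.loop e p) s (e.cost + t + u + 1) s''
  | loop_false {e : RExpr} {p : Program} {s : Store} :
      e.eval s = 0 → Run (.loop e p) s (e.cost + 1) s

open scoped Classical in
/-- Row by row, the array `A` holds the adjacency matrix of the graph `G` on `0, …, n - 1`. -/
def HoldsAdjMatrix {n : ℕ} (G : SimpleGraph (Fin n)) (A : ℕ → ℕ) : Prop :=
  ∀ i j : Fin n, A (i * n + j) = if G.Adj i j then 1 else 0

open scoped Classical in
/-- The initial store on the input `G` : `n` is in register `0`, the adjacency matrix of `G` is in
array `0`, row by row, and everything else is zero. -/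
noncomputable def inputStore {n : ℕ} (G : SimpleGraph (Fin n)) : Store where
  reg x := if x = 0 then n else 0
  arr a q := if a = 0 ∧ ∃ i j : Fin n, q = i * n + j ∧ G.Adj i j then 1 else 0

/-- The adjacency matrix is encoded without collisions. -/
theorem inputStore_holdsAdjMatrix {n : ℕ} (G : SimpleGraph (Fin n)) :
    HoldsAdjMatrix G ((inputStore G).arr 0) := by
  classical
  intro i j
  have key : (∃ i' j' : Fin n, (i * n + j : ℕ) = i' * n + j' ∧ G.Adj i' j') ↔ G.Adj i j := by
    constructor
    · rintro ⟨i', j', h, hadj⟩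
      have hn : 0 < n := lt_of_le_of_lt (Nat.zero_le _) j.2
      have hj : (j : ℕ) = j' := by
        have := congrArg (· % n) h
        simpa [Nat.add_mod, Nat.mod_eq_of_lt j.2, Nat.mod_eq_of_lt j'.2] using this
      have hi : (i : ℕ) = i' := by
        rw [hj] at h
        exact Nat.eq_of_mul_eq_mul_right hn (Nat.add_right_cancel h)
      rw [Fin.ext hi, Fin.ext hj]
      exact hadj
    · intro h
      exact ⟨i, j, rfl, h⟩
  exact if_congr (by rw [key]; exact and_iff_right rfl) rfl rfl

end CaterpillarPIG

/-!
Fix a caterpillar with a central path `v 0, …, v k` and let `m i` be the number of sons of `v i`. A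
normal model with `ℓ i` left sons of `v i` has one clique at each of the points `0, …, k + 1`. The
size of the clique at `j`, less one, is the `load` of `j`. These cliques cover all edges of the
intersection graph, and the loads add up to the number of edges of the tree, so the number of fill
edges is at most `modelCost`, the sum of the numbers `(load j).choose 2`
(`IsNormalModel.fillNumber_le`). The dynamic program minimizes exactly this sum
(`dpValue_le_modelCost`, `IsDPChoice.modelCost_eq`).

That no proper interval completion `H` has fewer fill edges (`IsOptimal.modelCost_le_fillNumber`)
is seen by counting the edges of `H` by rank differences. Order the vertices by the left end points
of a proper interval model of `H`; then the vertices from `p` to `q` form a clique of `H` whenever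
`p` and `q` are adjacent (`IsProperIntervalGraph.exists_linearOrder`). Take an optimal choice `ℓ`.
For every `t`, the points of load greater than `t`, together with those to which load can be
shifted from them by exchanging left and right sons, form the level set of `t`. By optimality all
of its points have load at least `t` (`Level.le_load`), and at the ends of a maximal interval
`[a, e]` of the level set no son is free to leave the interval (`Level.left_eq_zero`,
`Level.right_eq_zero`). So the total load of `[a, e]` is less than the size of a set of vertices
that does not depend on `ℓ`, the `window` of `[a, e]` (`sum_load_lt_card_window`). Two vertices of
the window that are not adjacent in `H` are separated, in the order, by one of the `e - a` vertices
of the path in `core` (`exists_core_between`), and each of these separates at most `t` pairs whose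
ranks in the window differ by `t + 1`. Therefore at least `∑ j ∈ [a, e], (load j - t)` such pairs
are edges of `H`. Windows of different runs of a level set are disjoint, and those of a higher
level are contained in, or disjoint from, those of a lower one. As ranks in a smaller set differ by
less, no edge is counted twice (`sum_card_rankPairs_le`), and summing over `t` gives
`∑ j, (load j + 1).choose 2` edges of `H`, hence `∑ j, (load j).choose 2` fill edges.

The algorithm takes as the central path the vertices of degree at least two (a single vertex if
there are none), and finds one of its ends as such a vertex with at most one neighbour of degree at
least two (`exists_centralPath_start`). It walks along the path and numbers all vertices so that
each vertex of the path is followed by its sons. A vertex of the path has rank `0`, and its sons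
have ranks `1, 2, …`. The position of rank `j` among the vertices that belong to `v i` then serves
as the state `(i, j)` of the dynamic program. With a source and a sink there are `n + 2` states,
and comparing all pairs of states takes quadratic time without any multiplication, once the
multiples of `n` and the triangular numbers are tabulated.
-/

namespace CaterpillarPIG

/-! ### The structure of a caterpillar -/

section Structure

variable {V : Type*} {G : SimpleGraph V} {k : ℕ} {v : Fin (k + 1) → V}

theorem IsCentralPath.exists_index (hv : IsCentralPath G v) (x : V) :
    ∃ i, v i = x ∨ (x ∉ Set.range v ∧ G.Adj (v i) x) := by
  by_cases hx : x ∈ Set.range v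
  · obtain ⟨i, hi⟩ := hx
    exact ⟨i, Or.inl hi⟩
  · obtain ⟨i, hi⟩ := hv.dominating x hx
    exact ⟨i, Or.inr ⟨hx, hi⟩⟩

/-- The index of the vertex of the central path that is equal to `x` or has `x` as a son. -/
noncomputable def IsCentralPath.index (hv : IsCentralPath G v) (x : V) : Fin (k + 1) :=
  (hv.exists_index x).choose

theorem IsCentralPath.index_spine (hv : IsCentralPath G v) (i : Fin (k + 1)) :
    hv.index (v i) = i := by
  rcases (hv.exists_index (v i)).choose_spec with h | h
  · exact hv.injective h
  · exact absurd ⟨i, rfl⟩ h.1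

theorem IsCentralPath.adj_index (hv : IsCentralPath G v) {x : V} (hx : x ∉ Set.range v) :
    G.Adj (v (hv.index x)) x := by
  rcases (hv.exists_index x).choose_spec with h | h
  · exact absurd ⟨_, h⟩ hx
  · exact h.2

open scoped Classical in
/-- The neighbour of `x` on the way to `v 0`, with `v 0` itself as the value at `v 0`. -/
noncomputable def IsCentralPath.father (hv : IsCentralPath G v) (x : V) : V :=
  if x ∈ Set.range v then v ⟨(hv.index x : ℕ) - 1, by omega⟩ else v (hv.index x)

theorem IsCentralPath.father_spine (hv : IsCentralPath G v) (i : Fin (k + 1)) :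
    hv.father (v i) = v ⟨(i : ℕ) - 1, by omega⟩ := by
  have : v i ∈ Set.range v := ⟨i, rfl⟩
  simp only [IsCentralPath.father, if_pos this, hv.index_spine]

theorem IsCentralPath.father_son (hv : IsCentralPath G v) {x : V} (hx : x ∉ Set.range v) :
    hv.father x = v (hv.index x) := if_neg hx

theorem IsCentralPath.father_mem (hv : IsCentralPath G v) (x : V) :
    hv.father x ∈ Set.range v := by
  unfold IsCentralPath.father
  split_ifs <;> exact ⟨_, rfl⟩

theorem IsCentralPath.adj_succ (hv : IsCentralPath G v) {i j : Fin (k + 1)}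
    (h : (i : ℕ) + 1 = j) : G.Adj (v i) (v j) := by
  have := hv.adj ⟨i, by omega⟩
  have h1 : (⟨i, by omega⟩ : Fin k).castSucc = i := rfl
  have h2 : (⟨i, by omega⟩ : Fin k).succ = j := Fin.ext h
  rwa [h1, h2] at this

theorem IsCentralPath.adj_father (hv : IsCentralPath G v) {x : V} (hx : x ≠ v 0) :
    G.Adj x (hv.father x) := by
  by_cases h : x ∈ Set.range v
  · obtain ⟨i, rfl⟩ := h
    rw [hv.father_spine]
    have : i ≠ 0 := fun h => hx (by rw [h])
    have : (i : ℕ) ≠ 0 := fun h => this (Fin.ext h)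
    refine (hv.adj_succ ?_).symm
    simp only
    omega
  · rw [hv.father_son h]
    exact (hv.adj_index h).symm

theorem IsCentralPath.father_injective (hv : IsCentralPath G v) {x y : V} (hx : x ≠ v 0)
    (hxy : x = hv.father y) (hyx : y = hv.father x) : False := by
  obtain ⟨i, hi⟩ := hv.father_mem y
  obtain ⟨j, hj⟩ := hv.father_mem x
  obtain rfl : v i = x := hi.trans hxy.symm
  obtain rfl : v j = y := hj.trans hyx.symm
  rw [hv.father_spine] at hxy hyx
  have h1 := congrArg Fin.val (hv.injective hxy)
  have h2 := congrArg Fin.val (hv.injective hyx)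
  have : (i : ℕ) ≠ 0 := fun h => hx (by rw [Fin.ext (a := i) (b := 0) h])
  simp only at h1 h2
  omega

/-- A tree has one edge less than vertices, so the edges that join the vertices other than `v 0` to
their fathers are all of its edges. -/
theorem IsCentralPath.adj_iff_father [Finite V] (hG : G.IsTree) (hv : IsCentralPath G v) {x y : V} :
    G.Adj x y ↔ (x ≠ v 0 ∧ hv.father x = y) ∨ (y ≠ v 0 ∧ hv.father y = x) := by
  classical
  have := Fintype.ofFinite V
  constructor
  · intro hxy
    let φ : {x : V // x ≠ v 0} → G.edgeSet := fun x => ⟨s(x.1, hv.father x.1), hv.adj_father x.2⟩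
    have hinj : Function.Injective φ := by
      intro a b hab
      have hab := congrArg Subtype.val hab
      simp only [φ, Sym2.eq_iff] at hab
      rcases hab with h | h
      · exact Subtype.ext h.1
      · exact (hv.father_injective a.2 h.1 h.2.symm).elim
    have hcard : Fintype.card {x : V // x ≠ v 0} = Fintype.card G.edgeSet := by
      have h1 := hG.card_edgeFinset
      rw [SimpleGraph.edgeFinset_card] at h1
      rw [Fintype.card_subtype_compl, Fintype.card_subtype_eq]
      omega
    obtain ⟨a, ha⟩ :=
      ((Fintype.bijective_iff_injective_and_card φ).2 ⟨hinj, hcard⟩).2 ⟨s(x, y), hxy⟩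
    have ha := congrArg Subtype.val ha
    simp only [φ, Sym2.eq_iff] at ha
    rcases ha with ⟨h1, h2⟩ | ⟨h1, h2⟩
    · subst h1
      exact Or.inl ⟨a.2, h2⟩
    · subst h1
      exact Or.inr ⟨a.2, h2⟩
  · rintro (⟨h, rfl⟩ | ⟨h, rfl⟩)
    · exact hv.adj_father h
    · exact (hv.adj_father h).symm

variable [Finite V]

theorem IsCentralPath.adj_spine_iff (hG : G.IsTree) (hv : IsCentralPath G v) {i j : Fin (k + 1)} :
    G.Adj (v i) (v j) ↔ (i : ℕ) + 1 = j ∨ (j : ℕ) + 1 = i := by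
  constructor
  · rw [hv.adj_iff_father hG]
    have key : ∀ {i j : Fin (k + 1)}, v i ≠ v 0 → hv.father (v i) = v j → (j : ℕ) + 1 = i := by
      intro i j h0 h
      rw [hv.father_spine] at h
      have h := congrArg Fin.val (hv.injective h)
      have : (i : ℕ) ≠ 0 := fun h => h0 (by rw [Fin.ext (a := i) (b := 0) h])
      simp only at h
      omega
    rintro (h | h)
    · exact Or.inr (key h.1 h.2)
    · exact Or.inl (key h.1 h.2)
  · rintro (h | h)
    · exact hv.adj_succ h
    · exact (hv.adj_succ h).symm

theorem IsCentralPath.adj_son_iff (hG : G.IsTree) (hv : IsCentralPath G v) {x y : V}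
    (hx : x ∉ Set.range v) : G.Adj x y ↔ y = v (hv.index x) := by
  constructor
  · rw [hv.adj_iff_father hG]
    rintro (h | h)
    · rw [← h.2, hv.father_son hx]
    · exact absurd (h.2 ▸ hv.father_mem y) hx
  · rintro rfl
    exact (hv.adj_index hx).symm

theorem IsCentralPath.mem_sons (hG : G.IsTree) (hv : IsCentralPath G v) {x : V} {i : Fin (k + 1)} :
    x ∈ sons G v i ↔ x ∉ Set.range v ∧ hv.index x = i := by
  constructor
  · rintro ⟨h, h'⟩
    exact ⟨h, hv.injective (((hv.adj_son_iff hG h).1 h'.symm).symm)⟩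
  · rintro ⟨h, rfl⟩
    exact ⟨h, hv.adj_index h⟩

end Structure

section NumSons

variable {V : Type*} {G : SimpleGraph V} {k : ℕ} {v : Fin (k + 1) → V}

theorem numSons_fin (i : Fin (k + 1)) : numSons G v i = (sons G v i).ncard := by
  simp [numSons, i.2]

end NumSons

/-! ### The dynamic program as a minimum over all choices -/

section DynamicProgram

/-- The load of the point `j` in a normal model with `ℓ i` left sons of `v i`, out of `m i` sons:
the size of the clique at `j`, less one. Besides the left sons of `v j` and the right sons of
`v (j - 1)`, this clique contains two vertices of the path if `1 ≤ j ≤ k`, and one if `j = 0` or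
`j = k + 1`. -/
def load (k : ℕ) (m ℓ : ℕ → ℕ) (j : ℕ) : ℕ :=
  (if j ≤ k then ℓ j else 0) + (if 1 ≤ j then m (j - 1) - ℓ (j - 1) else 0) +
    (if 1 ≤ j ∧ j ≤ k then 1 else 0)

/-- The number of fill edges of a normal model with `ℓ i` left sons of `v i`. -/
def modelCost (k : ℕ) (m ℓ : ℕ → ℕ) : ℕ :=
  ∑ j ∈ Finset.range (k + 2), (load k m ℓ j).choose 2

/-- The part of `modelCost` that comes from the points beyond `i`. -/
def tailCost (k : ℕ) (m ℓ : ℕ → ℕ) (i : ℕ) : ℕ :=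
  ∑ j ∈ Finset.Ico i (k + 1), (load k m ℓ (j + 1)).choose 2

variable {k : ℕ} {m ℓ : ℕ → ℕ}

theorem load_zero : load k m ℓ 0 = ℓ 0 := by simp [load]

theorem load_succ {i : ℕ} (hi : i < k) : load k m ℓ (i + 1) = m i - ℓ i + ℓ (i + 1) + 1 := by
  have : i + 1 ≤ k := hi
  simp [load, this]
  omega

theorem load_last : load k m ℓ (k + 1) = m k - ℓ k := by simp [load]

theorem modelCost_eq : modelCost k m ℓ = (ℓ 0).choose 2 + tailCost k m ℓ 0 := by
  rw [modelCost, Finset.sum_range_succ', load_zero, tailCost, Finset.range_eq_Ico, add_comm]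

theorem tailCost_of_lt {i : ℕ} (hi : i < k) :
    tailCost k m ℓ i = (m i - ℓ i + ℓ (i + 1) + 1).choose 2 + tailCost k m ℓ (i + 1) := by
  rw [tailCost, Finset.sum_eq_sum_Ico_succ_bot (by omega), load_succ hi, tailCost]

theorem tailCost_last : tailCost k m ℓ k = (m k - ℓ k).choose 2 := by
  simp [tailCost, load_last]

theorem dpTable_last (j : ℕ) : dpTable k m k j = (m k - j).choose 2 := by
  rw [dpTable, if_neg (lt_irrefl k)]

theorem dpTable_le {i j j' : ℕ} (hi : i < k) (hj' : j' ≤ m (i + 1)) :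
    dpTable k m i j ≤ (m i - j + j' + 1).choose 2 + dpTable k m (i + 1) j' := by
  rw [dpTable, if_pos hi]
  exact Finset.inf'_le (fun j' => (m i - j + j' + 1).choose 2 + dpTable k m (i + 1) j')
    (Finset.mem_range.2 (Nat.lt_succ_of_le hj'))

theorem exists_dpTable_eq {i : ℕ} (hi : i < k) (j : ℕ) : ∃ j' ≤ m (i + 1),
    (m i - j + j' + 1).choose 2 + dpTable k m (i + 1) j' = dpTable k m i j := by
  obtain ⟨j', hj', h⟩ := Finset.exists_mem_eq_inf' (Finset.nonempty_range_add_one (n := m (i + 1)))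
    (fun j' => (m i - j + j' + 1).choose 2 + dpTable k m (i + 1) j')
  refine ⟨j', Nat.le_of_lt_succ (Finset.mem_range.1 hj'), ?_⟩
  conv_rhs => rw [dpTable, if_pos hi]
  exact h.symm

theorem dpValue_le {j : ℕ} (hj : j ≤ m 0) : dpValue k m ≤ j.choose 2 + dpTable k m 0 j :=
  Finset.inf'_le (fun j => j.choose 2 + dpTable k m 0 j)
    (Finset.mem_range.2 (Nat.lt_succ_of_le hj))

theorem exists_dpValue_eq : ∃ j ≤ m 0, j.choose 2 + dpTable k m 0 j = dpValue k m := by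
  obtain ⟨j, hj, h⟩ := Finset.exists_mem_eq_inf' (Finset.nonempty_range_add_one (n := m 0))
    (fun j => j.choose 2 + dpTable k m 0 j)
  exact ⟨j, Nat.le_of_lt_succ (Finset.mem_range.1 hj), h.symm⟩

theorem dpTable_le_tailCost (hℓ : ∀ i ≤ k, ℓ i ≤ m i) {i : ℕ} (hi : i ≤ k) :
    dpTable k m i (ℓ i) ≤ tailCost k m ℓ i := by
  induction hi using Nat.decreasingInduction with
  | self => rw [dpTable_last, tailCost_last]
  | of_succ i hi ih =>
    rw [tailCost_of_lt hi]
    exact (dpTable_le hi (hℓ (i + 1) hi)).trans (Nat.add_le_add_left ih _)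

theorem dpValue_le_modelCost (hℓ : ∀ i ≤ k, ℓ i ≤ m i) : dpValue k m ≤ modelCost k m ℓ := by
  rw [modelCost_eq]
  exact (dpValue_le (hℓ 0 (Nat.zero_le k))).trans
    (Nat.add_le_add_left (dpTable_le_tailCost hℓ (Nat.zero_le k)) _)

theorem IsDPChoice.modelCost_eq (h : IsDPChoice k m (fun i => ℓ i)) :
    modelCost k m ℓ = dpValue k m := by
  have key : ∀ {i : ℕ}, i ≤ k → tailCost k m ℓ i = dpTable k m i (ℓ i) := by
    intro i hi
    induction hi using Nat.decreasingInduction with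
    | self => rw [dpTable_last, tailCost_last]
    | of_succ i hi ih =>
      rw [tailCost_of_lt hi, ih]
      simpa using h.next ⟨i, hi⟩
  rw [CaterpillarPIG.modelCost_eq, key (Nat.zero_le k)]
  simpa using h.first

theorem exists_isDPChoice (k : ℕ) (m : ℕ → ℕ) : ∃ ℓ : ℕ → ℕ, IsDPChoice k m (fun i => ℓ i) := by
  obtain ⟨j₀, hj₀, h₀⟩ := exists_dpValue_eq (k := k) (m := m)
  have step : ∀ i j : ℕ, ∃ j' ≤ m (i + 1), i < k →
      (m i - j + j' + 1).choose 2 + dpTable k m (i + 1) j' = dpTable k m i j := by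
    intro i j
    by_cases hi : i < k
    · obtain ⟨j', h, h'⟩ := exists_dpTable_eq (m := m) hi j
      exact ⟨j', h, fun _ => h'⟩
    · exact ⟨0, Nat.zero_le _, fun h => absurd h hi⟩
  choose g hg hg' using step
  let ℓ : ℕ → ℕ := fun i => Nat.rec j₀ (fun i j => g i j) i
  refine ⟨ℓ, ⟨?_, ?_, ?_⟩⟩
  · rintro ⟨i, hi⟩
    cases i with
    | zero => exact hj₀
    | succ i => exact hg i _
  · exact h₀
  · intro i
    exact hg' i _ i.2

/-- A choice as in the dynamic program, extended by zero to all indices. -/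
theorem IsDPChoice.exists_extension {ℓ : Fin (k + 1) → ℕ} (h : IsDPChoice k m ℓ) :
    ∃ ℓ' : ℕ → ℕ, (∀ i : Fin (k + 1), ℓ' i = ℓ i) ∧ IsDPChoice k m (fun i => ℓ' i) := by
  refine ⟨fun i => if h : i < k + 1 then ℓ ⟨i, h⟩ else 0, fun i => dif_pos i.2, ?_⟩
  convert h using 2 with i
  exact dif_pos i.2

end DynamicProgram

/-! ### Exchange and level sets of an optimal choice -/

section Exchange

theorem sum_add_eq_of_eq_off_pair {s : Finset ℕ} {f g : ℕ → ℕ} {a b : ℕ} (ha : a ∈ s) (hb : b ∈ s)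
    (hab : a ≠ b) (h : ∀ j, j ≠ a → j ≠ b → f j = g j) :
    ∑ j ∈ s, f j + (g a + g b) = ∑ j ∈ s, g j + (f a + f b) := by
  have hb' : b ∈ s.erase a := Finset.mem_erase.2 ⟨hab.symm, hb⟩
  rw [← Finset.add_sum_erase s f ha, ← Finset.add_sum_erase s g ha,
    ← Finset.add_sum_erase _ f hb', ← Finset.add_sum_erase _ g hb']
  have : ∑ j ∈ (s.erase a).erase b, f j = ∑ j ∈ (s.erase a).erase b, g j := by
    refine Finset.sum_congr rfl fun j hj => ?_
    simp only [Finset.mem_erase] at hj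
    exact h j hj.2.1 hj.1
  omega

theorem choose_two_succ (n : ℕ) : (n + 1).choose 2 = n.choose 2 + n := by
  rw [Nat.choose_succ_succ' n 1, Nat.choose_one_right, add_comm]

variable {k : ℕ} {m ℓ : ℕ → ℕ}

/-- `ℓ` is an admissible choice of least cost. -/
structure IsOptimal (k : ℕ) (m ℓ : ℕ → ℕ) : Prop where
  le : ∀ i ≤ k, ℓ i ≤ m i
  min : ∀ ℓ' : ℕ → ℕ, (∀ i ≤ k, ℓ' i ≤ m i) → modelCost k m ℓ ≤ modelCost k m ℓ'

theorem IsDPChoice.isOptimal (h : IsDPChoice k m (fun i => ℓ i)) : IsOptimal k m ℓ where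
  le i hi := h.le ⟨i, Nat.lt_succ_of_le hi⟩
  min _ hℓ' := h.modelCost_eq.trans_le (dpValue_le_modelCost hℓ')

/-- Shifting one unit of load from the point `p` to the point `q` does not decrease the cost. -/
theorem IsOptimal.load_le (h : IsOptimal k m ℓ) {ℓ' : ℕ → ℕ} (hℓ' : ∀ i ≤ k, ℓ' i ≤ m i)
    {p q : ℕ} (hp : p ≤ k + 1) (hq : q ≤ k + 1) (hpq : p ≠ q)
    (hp' : load k m ℓ' p + 1 = load k m ℓ p) (hq' : load k m ℓ' q = load k m ℓ q + 1)
    (hj : ∀ j, j ≠ p → j ≠ q → load k m ℓ' j = load k m ℓ j) :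
    load k m ℓ p ≤ load k m ℓ q + 1 := by
  have h1 := h.min ℓ' hℓ'
  have h2 := sum_add_eq_of_eq_off_pair (s := Finset.range (k + 2))
    (f := fun j => (load k m ℓ' j).choose 2) (g := fun j => (load k m ℓ j).choose 2)
    (Finset.mem_range.2 (by omega : p < k + 2)) (Finset.mem_range.2 (by omega : q < k + 2)) hpq
    (fun j h h' => by simp only [hj j h h'])
  simp only [← hp', hq', choose_two_succ] at h2
  unfold modelCost at h1
  omega

/-- Turn one left son of each of `v a, …, v (b - 1)` into a right son. -/
theorem IsOptimal.load_le_of_left (h : IsOptimal k m ℓ) {a b : ℕ} (hab : a < b) (hb : b ≤ k + 1)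
    (hpos : ∀ i, a ≤ i → i < b → 0 < ℓ i) : load k m ℓ a ≤ load k m ℓ b + 1 := by
  have hle : ∀ i, a ≤ i → i < b → ℓ i ≤ m i := fun i _ hi => h.le i (by omega)
  refine h.load_le (ℓ' := fun i => if a ≤ i ∧ i < b then ℓ i - 1 else ℓ i) ?_
    (by omega) hb hab.ne ?_ ?_ ?_
  · intro i hi
    have := h.le i hi
    split_ifs <;> omega
  · have := hpos a le_rfl hab
    simp only [load]
    split_ifs <;> omega
  · have := hpos (b - 1) (by omega) (by omega)
    have := hle (b - 1) (by omega) (by omega)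
    simp only [load]
    split_ifs <;> omega
  · intro j h1 h2
    simp only [load]
    rcases Nat.lt_or_ge j a with h3 | h3
    · split_ifs <;> omega
    rcases Nat.lt_or_ge j b with h4 | h4
    · have := hpos j h3 h4
      have := hpos (j - 1) (by omega) (by omega)
      have := hle (j - 1) (by omega) (by omega)
      split_ifs <;> omega
    · split_ifs <;> omega

/-- Turn one right son of each of `v a, …, v (b - 1)` into a left son. -/
theorem IsOptimal.load_le_of_right (h : IsOptimal k m ℓ) {a b : ℕ} (hab : a < b) (hb : b ≤ k + 1)
    (hpos : ∀ i, a ≤ i → i < b → ℓ i < m i) : load k m ℓ b ≤ load k m ℓ a + 1 := by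
  refine h.load_le (ℓ' := fun i => if a ≤ i ∧ i < b then ℓ i + 1 else ℓ i) ?_
    hb (by omega) hab.ne' ?_ ?_ ?_
  · intro i hi
    have := h.le i hi
    split_ifs with hi'
    · exact hpos i hi'.1 hi'.2
    · exact this
  · have := hpos (b - 1) (by omega) (by omega)
    simp only [load]
    split_ifs <;> omega
  · simp only [load]
    split_ifs <;> omega
  · intro j h1 h2
    simp only [load]
    rcases Nat.lt_or_ge j a with h3 | h3
    · split_ifs <;> omega
    rcases Nat.lt_or_ge j b with h4 | h4
    · have := hpos (j - 1) (by omega) (by omega)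
      split_ifs <;> omega
    · split_ifs <;> omega

/-- The points of level `t`: those whose load exceeds `t`, and those to which load can be shifted
from such a point, by turning left sons into right sons or conversely. -/
def Level (k : ℕ) (m ℓ : ℕ → ℕ) (t j : ℕ) : Prop :=
  j ≤ k + 1 ∧ ∃ p ≤ k + 1, t < load k m ℓ p ∧
    ((p ≤ j ∧ ∀ i, p ≤ i → i < j → 0 < ℓ i) ∨ (j ≤ p ∧ ∀ i, j ≤ i → i < p → ℓ i < m i))

theorem Level.of_lt_load {t j : ℕ} (hj : j ≤ k + 1) (h : t < load k m ℓ j) : Level k m ℓ t j :=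
  ⟨hj, j, hj, h, Or.inl ⟨le_rfl, fun _ h h' => absurd h (not_le.2 h')⟩⟩

theorem Level.mono {s t j : ℕ} (hst : s ≤ t) (h : Level k m ℓ t j) : Level k m ℓ s j := by
  obtain ⟨hj, p, hp, h1, h2⟩ := h
  exact ⟨hj, p, hp, hst.trans_lt h1, h2⟩

/-- A point to which load can be shifted from a point of load greater than `t` has load at least
`t`, since otherwise the shift would decrease the cost. -/
theorem Level.le_load (h : IsOptimal k m ℓ) {t j : ℕ} (hj : Level k m ℓ t j) :
    t ≤ load k m ℓ j := by
  obtain ⟨hj, p, hp, h1, ⟨h2, h3⟩ | ⟨h2, h3⟩⟩ := hj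
  · rcases h2.eq_or_lt with rfl | h2
    · exact h1.le
    · have := h.load_le_of_left h2 hj h3
      omega
  · rcases h2.eq_or_lt with rfl | h2
    · exact h1.le
    · have := h.load_le_of_right h2 hp h3
      omega

/-- A point of level `t` whose right neighbour is not of level `t` has no left sons. -/
theorem Level.left_eq_zero {t j : ℕ} (hj : j ≤ k) (h : Level k m ℓ t j)
    (h' : ¬ Level k m ℓ t (j + 1)) : ℓ j = 0 := by
  by_contra h0
  obtain ⟨-, p, hp, h1, ⟨h2, h3⟩ | ⟨h2, h3⟩⟩ := h
  · refine h' ⟨by omega, p, hp, h1, Or.inl ⟨by omega, fun i hi hi' => ?_⟩⟩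
    rcases (Nat.lt_succ_iff.1 hi').eq_or_lt with rfl | h4
    · omega
    · exact h3 i hi h4
  · rcases h2.eq_or_lt with rfl | h2
    · refine h' ⟨by omega, j, hp, h1, Or.inl ⟨by omega, fun i hi hi' => ?_⟩⟩
      obtain rfl : i = j := by omega
      omega
    · exact h' ⟨by omega, p, hp, h1, Or.inr ⟨h2, fun i hi hi' => h3 i (by omega) hi'⟩⟩

/-- A point of level `t` whose left neighbour is not of level `t` has no right sons. -/
theorem Level.right_eq_zero {t j : ℕ} (h : Level k m ℓ t (j + 1))
    (h' : ¬ Level k m ℓ t j) : m j - ℓ j = 0 := by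
  by_contra h0
  obtain ⟨hj, p, hp, h1, ⟨h2, h3⟩ | ⟨h2, h3⟩⟩ := h
  · rcases h2.eq_or_lt with rfl | h2
    · refine h' ⟨by omega, j + 1, hp, h1, Or.inr ⟨by omega, fun i hi hi' => ?_⟩⟩
      obtain rfl : i = j := by omega
      omega
    · exact h' ⟨by omega, p, hp, h1, Or.inl ⟨by omega, fun i hi hi' => h3 i hi (by omega)⟩⟩
  · refine h' ⟨by omega, p, hp, h1, Or.inr ⟨by omega, fun i hi hi' => ?_⟩⟩
    rcases hi.eq_or_lt with rfl | h4
    · omega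
    · exact h3 i h4 hi'

end Exchange

/-! ### Counting pairs by their rank difference -/

section RankCounting

variable {V : Type*} [LinearOrder V]

/-- The number of elements of `W` that are less than `x`. -/
def rankIn (W : Finset V) (x : V) : ℕ := (W.filter (· < x)).card

theorem rankIn_lt {W : Finset V} {x y : V} (hx : x ∈ W) (hxy : x < y) :
    rankIn W x < rankIn W y := by
  refine Finset.card_lt_card ⟨fun z hz => ?_, fun h => ?_⟩
  · simp only [Finset.mem_filter] at hz ⊢
    exact ⟨hz.1, hz.2.trans hxy⟩
  · have := h (Finset.mem_filter.2 ⟨hx, hxy⟩)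
    exact lt_irrefl x (Finset.mem_filter.1 this).2

/-- Rank differences are smaller in smaller sets. -/
theorem rankIn_sub_le {W W' : Finset V} (h : W' ⊆ W) {x y : V} (hxy : x < y) :
    rankIn W' y + rankIn W x ≤ rankIn W y + rankIn W' x := by
  have key : ∀ U : Finset V,
      rankIn U y = rankIn U x + (U.filter fun z => x ≤ z ∧ z < y).card := by
    intro U
    unfold rankIn
    rw [← Finset.card_union_of_disjoint]
    · congr 1
      ext z
      simp only [Finset.mem_filter, Finset.mem_union]
      constructor
      · rintro ⟨h1, h2⟩
        rcases lt_or_ge z x with h3 | h3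
        · exact Or.inl ⟨h1, h3⟩
        · exact Or.inr ⟨h1, h3, h2⟩
      · rintro (⟨h1, h2⟩ | ⟨h1, h2, h3⟩)
        · exact ⟨h1, h2.trans hxy⟩
        · exact ⟨h1, h3⟩
    · refine Finset.disjoint_filter.2 fun z _ h1 h2 => not_lt.2 h2.1 h1
  have := Finset.card_le_card (Finset.filter_subset_filter (fun z => x ≤ z ∧ z < y) h)
  rw [key W, key W']
  omega

theorem exists_rankIn_eq {W : Finset V} {i : ℕ} (hi : i < W.card) : ∃ x ∈ W, rankIn W x = i := by
  have himg : W.image (rankIn W) = Finset.range W.card := by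
    refine Finset.eq_of_subset_of_card_le (fun j hj => ?_) ?_
    · obtain ⟨x, hx, rfl⟩ := Finset.mem_image.1 hj
      refine Finset.mem_range.2 (Finset.card_lt_card ⟨Finset.filter_subset _ _, fun h => ?_⟩)
      exact lt_irrefl x (Finset.mem_filter.1 (h hx)).2
    · rw [Finset.card_range, Finset.card_image_of_injOn]
      intro x hx y hy hxy
      rcases lt_trichotomy x y with h | h | h
      · exact absurd hxy (rankIn_lt hx h).ne
      · exact h
      · exact absurd hxy (rankIn_lt hy h).ne'
  exact Finset.mem_image.1 (himg ▸ Finset.mem_range.2 hi)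

open scoped Classical in
/-- The pairs `x < y` of related elements of `W` whose ranks in `W` differ by `t + 1`. -/
noncomputable def rankPairs (R : V → V → Prop) (W : Finset V) (t : ℕ) : Finset (V × V) :=
  (W ×ˢ W).filter fun p => p.1 < p.2 ∧ rankIn W p.2 = rankIn W p.1 + (t + 1) ∧ R p.1 p.2

/-- If some element of `B` lies strictly between any two unrelated elements of `W`, then few pairs
of rank difference `t + 1` are unrelated, as every element of `B` lies strictly between at most `t`
of them. -/
theorem card_le_card_rankPairs {R : V → V → Prop} {W B : Finset V} (hB : B ⊆ W)
    (h : ∀ x ∈ W, ∀ y ∈ W, x < y → ¬ R x y → ∃ b ∈ B, x < b ∧ b < y) (t : ℕ) :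
    W.card ≤ (rankPairs R W t).card + (t + 1) + t * B.card := by
  classical
  have hsub : Finset.range (W.card - (t + 1)) ⊆ (rankPairs R W t).image (fun p => rankIn W p.1) ∪
      (B ×ˢ Finset.range t).image (fun p => rankIn W p.1 - 1 - p.2) := by
    intro i hi
    rw [Finset.mem_range] at hi
    obtain ⟨x, hx, hxi⟩ := exists_rankIn_eq (W := W) (i := i) (by omega)
    obtain ⟨y, hy, hyi⟩ := exists_rankIn_eq (W := W) (i := i + (t + 1)) (by omega)
    have hxy : x < y := by
      rcases lt_trichotomy x y with h | h | h
      · exact h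
      · subst h
        omega
      · have := rankIn_lt hy h
        omega
    rw [Finset.mem_union]
    by_cases hR : R x y
    · refine Or.inl (Finset.mem_image.2 ⟨(x, y), ?_, hxi⟩)
      simp only [rankPairs, Finset.mem_filter, Finset.mem_product]
      exact ⟨⟨hx, hy⟩, hxy, by omega, hR⟩
    · obtain ⟨b, hb, h1, h2⟩ := h x hx y hy hxy hR
      have h3 := rankIn_lt hx h1
      have h4 := rankIn_lt (hB hb) h2
      refine Or.inr (Finset.mem_image.2 ⟨(b, rankIn W b - 1 - i), ?_, ?_⟩)
      · simp only [Finset.mem_product, Finset.mem_range]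
        exact ⟨hb, by omega⟩
      · simp only
        omega
  have h1 := (Finset.card_le_card hsub).trans (Finset.card_union_le _ _)
  have h2 := Finset.card_image_le (s := rankPairs R W t) (f := fun p => rankIn W p.1)
  have h3 := Finset.card_image_le (s := B ×ˢ Finset.range t) (f := fun p => rankIn W p.1 - 1 - p.2)
  rw [Finset.card_product, Finset.card_range, mul_comm] at h3
  rw [Finset.card_range] at h1
  omega

/-- Pairs of different rank differences in nested sets are different. -/
theorem disjoint_rankPairs {R : V → V → Prop} {W W' : Finset V} (h : W' ⊆ W) {t t' : ℕ}
    (ht : t < t') : Disjoint (rankPairs R W t) (rankPairs R W' t') := by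
  classical
  refine Finset.disjoint_left.2 fun p hp hp' => ?_
  simp only [rankPairs, Finset.mem_filter] at hp hp'
  have := rankIn_sub_le h hp.2.1
  omega

theorem disjoint_rankPairs_of_disjoint {R : V → V → Prop} {W W' : Finset V} (h : Disjoint W W')
    (t t' : ℕ) : Disjoint (rankPairs R W t) (rankPairs R W' t') := by
  classical
  refine Finset.disjoint_left.2 fun p hp hp' => ?_
  simp only [rankPairs, Finset.mem_filter, Finset.mem_product] at hp hp'
  exact Finset.disjoint_left.1 h hp.1.1 hp'.1.1

end RankCounting

/-! ### The lower bound -/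

section Order

/-- The order of the left end points of a proper interval model. -/
theorem IsProperIntervalGraph.exists_linearOrder {V : Type*} [Finite V] {H : SimpleGraph V}
    (hH : IsProperIntervalGraph H) : ∃ _ : LinearOrder V,
      ∀ p x y q : V, p ≤ x → x < y → y ≤ q → H.Adj p q → H.Adj x y := by
  obtain ⟨J, hJ, hmodel, hproper⟩ := hH
  choose a b hab hJ using hJ
  have hb : ∀ x y, a x ≤ a y → b x ≤ b y := by
    intro x y hxy
    by_contra h
    push Not at h
    refine hproper y x ?_
    rw [hJ, hJ]
    refine ⟨Set.Icc_subset_Icc hxy h.le, fun h' => ?_⟩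
    exact absurd (h' ⟨hab x, le_rfl⟩).2 (not_le.2 h)
  let f : V → ℝ ×ₗ Fin (Nat.card V) := fun x => toLex (a x, Finite.equivFin V x)
  have hf : Function.Injective f := by
    intro x y hxy
    exact (Finite.equivFin V).injective (congrArg Prod.snd (toLex.injective hxy))
  let _ : LinearOrder V := LinearOrder.lift' f hf
  have hle : ∀ x y : V, x ≤ y → a x ≤ a y := by
    intro x y hxy
    have : f x ≤ f y := hxy
    rcases (Prod.Lex.toLex_le_toLex).1 this with h | h
    · exact h.le
    · exact h.1.le
  refine ⟨inferInstance, fun p x y q hpx hxy hyq hpq => ?_⟩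
  have hne : p ≠ q := H.ne_of_adj hpq
  obtain ⟨z, hz1, hz2⟩ := (hmodel p q hne).1 hpq
  rw [hJ] at hz1 hz2
  refine (hmodel x y hxy.ne).2 ⟨a y, ?_, ?_⟩
  · rw [hJ]
    exact ⟨hle x y hxy.le, (hle y q hyq).trans (hz2.1.trans (hz1.2.trans (hb p x (hle p x hpx))))⟩
  · rw [hJ]
    exact ⟨le_rfl, hab y⟩

end Order

section Count

variable {V : Type*} {G : SimpleGraph V} {k : ℕ} {v : Fin (k + 1) → V}

open scoped Classical in
theorem numSons_eq_card [Fintype V] (hG : G.IsTree) (hv : IsCentralPath G v) (i : ℕ) :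
    numSons G v i =
      (Finset.univ.filter fun x => x ∉ Set.range v ∧ (hv.index x : ℕ) = i).card := by
  by_cases hi : i < k + 1
  · rw [numSons, dif_pos hi, ← Set.ncard_coe_finset]
    congr 1
    ext x
    simp [hv.mem_sons hG, Fin.ext_iff]
  · rw [numSons, dif_neg hi, eq_comm, Finset.card_eq_zero, Finset.filter_eq_empty_iff]
    intro x _ hx
    omega

open scoped Classical in
theorem card_filter_son [Fintype V] (hG : G.IsTree) (hv : IsCentralPath G v) (s : Finset ℕ) :
    (Finset.univ.filter fun x => x ∉ Set.range v ∧ (hv.index x : ℕ) ∈ s).card =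
      ∑ i ∈ s, numSons G v i := by
  rw [Finset.card_eq_sum_card_fiberwise (f := fun x => (hv.index x : ℕ)) (t := s)]
  · refine Finset.sum_congr rfl fun i hi => ?_
    rw [numSons_eq_card hG hv, Finset.filter_filter]
    congr 1
    ext x
    simp only [Finset.mem_filter, Finset.mem_univ, true_and]
    constructor
    · exact fun h => ⟨h.1.1, h.2⟩
    · exact fun h => ⟨⟨h.1, h.2 ▸ hi⟩, h.2⟩
  · intro x hx
    exact (Finset.mem_filter.1 hx).2.2

open scoped Classical in
theorem card_filter_spine [Fintype V] (hv : IsCentralPath G v) (s : Finset ℕ)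
    (hs : ∀ i ∈ s, i < k + 1) :
    (Finset.univ.filter fun x => x ∈ Set.range v ∧ (hv.index x : ℕ) ∈ s).card = s.card := by
  refine Finset.card_bij (fun x _ => (hv.index x : ℕ)) ?_ ?_ ?_
  · intro x hx
    exact (Finset.mem_filter.1 hx).2.2
  · intro x hx y hy hxy
    obtain ⟨i, rfl⟩ := (Finset.mem_filter.1 hx).2.1
    obtain ⟨j, rfl⟩ := (Finset.mem_filter.1 hy).2.1
    simp only [hv.index_spine] at hxy
    rw [Fin.ext hxy]
  · intro i hi
    refine ⟨v ⟨i, hs i hi⟩, Finset.mem_filter.2 ⟨Finset.mem_univ _, ⟨_, rfl⟩, ?_⟩, ?_⟩ <;>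
      simp only [hv.index_spine, hi]

theorem card_eq_sum_numSons [Fintype V] (hG : G.IsTree) (hv : IsCentralPath G v) :
    Fintype.card V = k + 1 + ∑ i ∈ Finset.range (k + 1), numSons G v i := by
  classical
  have h := card_filter_spine hv (Finset.range (k + 1)) (fun i hi => Finset.mem_range.1 hi)
  rw [Finset.card_range] at h
  conv_rhs => enter [1]; rw [← h]
  rw [← card_filter_son hG hv, ← Finset.card_union_of_disjoint, ← Finset.card_univ]
  · congr 1
    ext x
    have := (hv.index x).2
    by_cases hx : x ∈ Set.range v
    · simp only [Finset.mem_univ, Finset.mem_union, Finset.mem_filter, Finset.mem_range, hx, this,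
        true_and, and_self, true_or]
    · simp only [Finset.mem_univ, Finset.mem_union, Finset.mem_filter, Finset.mem_range, hx, this,
        true_and, not_false_eq_true, and_self, or_true]
  · refine Finset.disjoint_filter.2 fun x _ h1 h2 => h2.1 h1.1

/-- Every son, and every edge of the path, contributes one to exactly one load. -/
theorem sum_load {m ℓ : ℕ → ℕ} (hℓ : ∀ i ≤ k, ℓ i ≤ m i) :
    ∑ j ∈ Finset.range (k + 2), load k m ℓ j = k + ∑ i ∈ Finset.range (k + 1), m i := by
  have key : ∀ n ≤ k, ∑ i ∈ Finset.range n, load k m ℓ (i + 1) + ℓ 0 =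
      n + ∑ i ∈ Finset.range n, m i + ℓ n := by
    intro n hn
    induction n with
    | zero => simp
    | succ n ih =>
      have := ih (by omega)
      have := hℓ n (by omega)
      rw [Finset.sum_range_succ, Finset.sum_range_succ, load_succ (by omega)]
      omega
  rw [Finset.sum_range_succ', load_zero, Finset.sum_range_succ, load_last, Finset.sum_range_succ]
  have := key k le_rfl
  have := hℓ k le_rfl
  omega

theorem fillNumber_add [Fintype V] {H : SimpleGraph V} (hG : G.IsTree) (hGH : G ≤ H) :
    fillNumber G H + (Fintype.card V - 1) = H.edgeSet.ncard := by
  classical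
  have h1 := hG.card_edgeFinset
  have h2 : G.edgeSet.ncard = Fintype.card V - 1 := by
    rw [Set.ncard_eq_toFinset_card']
    unfold SimpleGraph.edgeFinset at h1
    omega
  rw [← h2, fillNumber]
  exact Set.ncard_sdiff_add_ncard_of_subset (SimpleGraph.edgeSet_mono hGH) (Set.toFinite _)

theorem sum_range_sub (w : ℕ) : ∑ t ∈ Finset.range w, (w - t) = (w + 1).choose 2 := by
  induction w with
  | zero => simp
  | succ w ih =>
    rw [Finset.sum_range_succ', choose_two_succ (w + 1), ← ih]
    simp

end Count

section Window

variable {V : Type*} [Fintype V] {G : SimpleGraph V} {k : ℕ} {v : Fin (k + 1) → V}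

open scoped Classical in
/-- The vertices that a normal model is bound to place at the points `a, …, e`: the vertices of the
path whose intervals meet `[a, e]`, and those sons whose two possible points both lie in
`[a, e]`. -/
noncomputable def window (hv : IsCentralPath G v) (a e : ℕ) : Finset V :=
  Finset.univ.filter fun x =>
    (x ∈ Set.range v ∧ (hv.index x : ℕ) ∈ Finset.Icc (a - 1) (min e k)) ∨
      (x ∉ Set.range v ∧ (hv.index x : ℕ) ∈ Finset.Ico a e)

open scoped Classical in
/-- The vertices of the path whose intervals lie in `[a, e]`. -/
noncomputable def core (hv : IsCentralPath G v) (a e : ℕ) : Finset V :=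
  Finset.univ.filter fun x => x ∈ Set.range v ∧ (hv.index x : ℕ) ∈ Finset.Ico a e

theorem mem_window {hv : IsCentralPath G v} {a e : ℕ} {x : V} : x ∈ window hv a e ↔
    (x ∈ Set.range v ∧ a ≤ hv.index x + 1 ∧ (hv.index x : ℕ) ≤ e) ∨
      (x ∉ Set.range v ∧ a ≤ hv.index x ∧ (hv.index x : ℕ) + 1 ≤ e) := by
  have := (hv.index x).2
  have h1 : a - 1 ≤ (hv.index x : ℕ) ∧ (hv.index x : ℕ) ≤ min e k ↔
      a ≤ hv.index x + 1 ∧ (hv.index x : ℕ) ≤ e := by omega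
  simp only [window, Finset.mem_filter, Finset.mem_univ, true_and, Finset.mem_Icc, Finset.mem_Ico,
    h1, Nat.succ_le_iff]

theorem mem_core {hv : IsCentralPath G v} {a e : ℕ} {x : V} : x ∈ core hv a e ↔
    x ∈ Set.range v ∧ a ≤ hv.index x ∧ (hv.index x : ℕ) < e := by
  simp only [core, Finset.mem_filter, Finset.mem_univ, true_and, Finset.mem_Ico]

theorem core_subset_window (hv : IsCentralPath G v) (a e : ℕ) : core hv a e ⊆ window hv a e := by
  intro x hx
  rw [mem_core] at hx
  exact mem_window.2 (Or.inl ⟨hx.1, by omega, by omega⟩)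

theorem card_core (hv : IsCentralPath G v) {a e : ℕ} (he : e ≤ k + 1) :
    (core hv a e).card = e - a := by
  classical
  rw [← Nat.card_Ico]
  exact card_filter_spine hv _ fun i hi => by
    rw [Finset.mem_Ico] at hi
    omega

theorem card_window (hG : G.IsTree) (hv : IsCentralPath G v) (a e : ℕ) :
    (window hv a e).card = (min e k + 1 - (a - 1)) + ∑ i ∈ Finset.Ico a e, numSons G v i := by
  classical
  rw [window, Finset.filter_or, Finset.card_union_of_disjoint, card_filter_spine,
    card_filter_son hG, Nat.card_Icc]
  · intro i hi
    rw [Finset.mem_Icc] at hi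
    omega
  · exact Finset.disjoint_filter.2 fun x _ h1 h2 => h2.1 h1.1

/-- If no son is free to leave the points `a, …, e`, the window contains at least as many vertices
as the load of these points requires. -/
theorem sum_load_lt_card_window (hG : G.IsTree) (hv : IsCentralPath G v) {ℓ : ℕ → ℕ}
    (hℓ : ∀ i ≤ k, ℓ i ≤ numSons G v i) {a e : ℕ} (hae : a ≤ e) (he : e ≤ k + 1)
    (ha : a = 0 ∨ numSons G v (a - 1) - ℓ (a - 1) = 0) (he' : e = k + 1 ∨ ℓ e = 0) :
    ∑ j ∈ Finset.Ico a (e + 1), load k (numSons G v) ℓ j + 1 ≤ (window hv a e).card := by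
  rw [card_window hG]
  set m := numSons G v
  have key : ∀ e, a ≤ e → e ≤ k + 1 → ∑ j ∈ Finset.Ico a (e + 1), load k m ℓ j + 1 ≤
      (min e k + 1 - (a - 1)) + ∑ i ∈ Finset.Ico a e, m i + (if e ≤ k then ℓ e else 0) := by
    intro e hae
    induction e, hae using Nat.le_induction with
    | base =>
      intro he
      rw [Nat.Ico_succ_singleton, Finset.sum_singleton, Finset.Ico_self, Finset.sum_empty, load]
      split_ifs <;> omega
    | succ e hae ih =>
      intro he
      have ih := ih (by omega)
      have := hℓ e (by omega)
      have hload : load k m ℓ (e + 1) = m e - ℓ e + if e + 1 ≤ k then ℓ (e + 1) + 1 else 0 := by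
        simp only [load, Nat.add_sub_cancel]
        split_ifs <;> omega
      rw [Finset.sum_Ico_succ_top (by omega), Finset.sum_Ico_succ_top hae m, hload]
      have h1 : e ≤ k := by omega
      rw [if_pos h1] at ih
      split_ifs <;> omega
  have := key e hae he
  split_ifs at this <;> omega

/-- In a proper interval completion, two vertices `x < y` of a window that are not adjacent are
separated by a vertex of the core. Otherwise the core, which is a path, lies on one side of the
two, since an edge of `H` that passes over both would make them adjacent; and as both have
neighbours in the core or belong to it, such an edge exists then, too. -/
theorem exists_core_between [LinearOrder V] {H : SimpleGraph V} (hv : IsCentralPath G v)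
    (hGH : G ≤ H) (hH : ∀ p x y q : V, p ≤ x → x < y → y ≤ q → H.Adj p q → H.Adj x y)
    {a e : ℕ} (hae : a ≤ e) (he : e ≤ k + 1) {x y : V} (hx : x ∈ window hv a e)
    (hy : y ∈ window hv a e) (hxy : x < y) (hadj : ¬ H.Adj x y) :
    ∃ b ∈ core hv a e, x < b ∧ b < y := by
  by_contra hcon
  push Not at hcon
  rcases hae.eq_or_lt with rfl | hae
  · -- the window consists of at most two consecutive vertices of the path
    rw [mem_window] at hx hy
    rcases hx with ⟨⟨i, rfl⟩, h1⟩ | h1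
    · rcases hy with ⟨⟨j, rfl⟩, h2⟩ | h2
      · rw [hv.index_spine] at h1 h2
        rcases lt_trichotomy (i : ℕ) j with h | h | h
        · exact hadj (hGH (hv.adj_succ (by omega)))
        · rw [Fin.ext h] at hxy
          exact lt_irrefl _ hxy
        · exact hadj (hGH (hv.adj_succ (by omega)).symm)
      · omega
    · omega
  -- every vertex of the window is in the core or has a neighbour there
  have hnbr : ∀ z ∈ window hv a e, ∃ b ∈ core hv a e, b = z ∨ H.Adj b z := by
    intro z hz
    rw [mem_window] at hz
    rcases hz with ⟨⟨i, rfl⟩, h1⟩ | ⟨hz, h1⟩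
    · rw [hv.index_spine] at h1
      by_cases h2 : a ≤ i
      · by_cases h3 : (i : ℕ) < e
        · exact ⟨v i, mem_core.2 ⟨⟨_, rfl⟩, by rw [hv.index_spine]; exact ⟨h2, h3⟩⟩, Or.inl rfl⟩
        · refine ⟨v ⟨i - 1, by omega⟩, mem_core.2 ⟨⟨_, rfl⟩, ?_⟩,
            Or.inr (hGH (hv.adj_succ ?_))⟩
          · rw [hv.index_spine]
            dsimp only
            omega
          · dsimp only
            omega
      · refine ⟨v ⟨i + 1, by omega⟩, mem_core.2 ⟨⟨_, rfl⟩, ?_⟩,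
          Or.inr (hGH (hv.adj_succ ?_).symm)⟩
        · rw [hv.index_spine]
          dsimp only
          omega
        · rfl
    · refine ⟨v (hv.index z), mem_core.2 ⟨⟨_, rfl⟩, ?_⟩, Or.inr (hGH (hv.adj_index hz))⟩
      rw [hv.index_spine]
      omega
  -- the core lies on one side
  have hside : ∀ b ∈ core hv a e, b ≤ x ∨ y ≤ b := by
    intro b hb
    rcases le_or_gt b x with h | h
    · exact Or.inl h
    · exact Or.inr (hcon b hb h)
  have hstep : ∀ i : ℕ, ∀ h : i + 1 < k + 1, (v ⟨i, by omega⟩ ≤ x → y ≤ v ⟨i + 1, h⟩ → False) ∧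
      (v ⟨i + 1, h⟩ ≤ x → y ≤ v ⟨i, by omega⟩ → False) := by
    intro i h
    have hadj' : H.Adj (v ⟨i, by omega⟩) (v ⟨i + 1, h⟩) := hGH (hv.adj_succ rfl)
    exact ⟨fun h1 h2 => hadj (hH _ _ _ _ h1 hxy h2 hadj'),
      fun h1 h2 => hadj (hH _ _ _ _ h1 hxy h2 hadj'.symm)⟩
  have hmem : ∀ i : ℕ, a ≤ i → i < e → ∀ h : i < k + 1, v ⟨i, h⟩ ∈ core hv a e := by
    intro i h1 h2 h
    refine mem_core.2 ⟨⟨_, rfl⟩, ?_⟩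
    rw [hv.index_spine]
    exact ⟨h1, h2⟩
  obtain ⟨b, hb, hbx⟩ := hnbr x hx
  obtain ⟨c, hc, hcy⟩ := hnbr y hy
  have hall : ∀ i : ℕ, a ≤ i → i < e → ∀ h : i < k + 1,
      (v ⟨i, h⟩ ≤ x ↔ v ⟨a, by omega⟩ ≤ x) := by
    intro i hai
    induction i, hai using Nat.le_induction with
    | base => exact fun _ _ => Iff.rfl
    | succ i hai ih =>
      intro h1 h2
      rw [← ih (by omega) (by omega)]
      have := hstep i h2
      rcases hside _ (hmem i hai (by omega) (by omega)) with h3 | h3 <;>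
        rcases hside _ (hmem (i + 1) (by omega) h1 h2) with h4 | h4
      · exact ⟨fun _ => h3, fun _ => h4⟩
      · exact absurd h4 (fun h4 => this.1 h3 h4)
      · exact absurd h3 (fun h3 => this.2 h4 h3)
      · exact ⟨fun h => absurd (hxy.trans_le h4) (not_lt.2 h),
          fun h => absurd (hxy.trans_le h3) (not_lt.2 h)⟩
  have hcore : ∀ z ∈ core hv a e, (z ≤ x ↔ v ⟨a, by omega⟩ ≤ x) := by
    intro z hz
    obtain ⟨⟨i, rfl⟩, hz⟩ := mem_core.1 hz
    rw [hv.index_spine] at hz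
    exact hall i hz.1 hz.2 i.2
  rcases hside c hc with h | h
  · rcases hcy with rfl | hcy
    · exact absurd hxy (not_lt.2 h)
    · exact hadj (hH _ _ _ _ h hxy le_rfl hcy)
  · have hb' : y ≤ b := by
      refine (hside b hb).resolve_left fun h' => ?_
      exact absurd (hxy.trans_le h) (not_lt.2 ((hcore c hc).2 ((hcore b hb).1 h')))
    rcases hbx with rfl | hbx
    · exact absurd hxy (not_lt.2 hb')
    · exact hadj (hH _ _ _ _ le_rfl hxy hb' hbx.symm)

end Window

section Runs

open scoped Classical in
/-- The maximal intervals of points of level `t`. -/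
noncomputable def runs (k : ℕ) (m ℓ : ℕ → ℕ) (t : ℕ) : Finset (ℕ × ℕ) :=
  (Finset.range (k + 2) ×ˢ Finset.range (k + 2)).filter fun R =>
    R.1 ≤ R.2 ∧ (∀ j, R.1 ≤ j → j ≤ R.2 → Level k m ℓ t j) ∧
      (R.1 = 0 ∨ ¬ Level k m ℓ t (R.1 - 1)) ∧ ¬ Level k m ℓ t (R.2 + 1)

variable {k : ℕ} {m ℓ : ℕ → ℕ}

theorem mem_runs {t : ℕ} {R : ℕ × ℕ} : R ∈ runs k m ℓ t ↔
    R.2 ≤ k + 1 ∧ R.1 ≤ R.2 ∧ (∀ j, R.1 ≤ j → j ≤ R.2 → Level k m ℓ t j) ∧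
      (R.1 = 0 ∨ ¬ Level k m ℓ t (R.1 - 1)) ∧ ¬ Level k m ℓ t (R.2 + 1) := by
  simp only [runs, Finset.mem_filter, Finset.mem_product, Finset.mem_range]
  constructor
  · rintro ⟨h1, h2⟩
    exact ⟨by omega, h2⟩
  · rintro ⟨h1, h2⟩
    exact ⟨by omega, h2⟩

theorem Level.exists_run {t j : ℕ} (hj : Level k m ℓ t j) :
    ∃ R ∈ runs k m ℓ t, j ∈ Finset.Ico R.1 (R.2 + 1) := by
  have hleft : ∀ j, Level k m ℓ t j → ∃ a ≤ j, (∀ i, a ≤ i → i ≤ j → Level k m ℓ t i) ∧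
      (a = 0 ∨ ¬ Level k m ℓ t (a - 1)) := by
    intro j
    induction j with
    | zero =>
      intro hj
      refine ⟨0, le_rfl, fun i _ hi => ?_, Or.inl rfl⟩
      rwa [Nat.le_zero.1 hi]
    | succ j ih =>
      intro hj
      by_cases h : Level k m ℓ t j
      · obtain ⟨a, ha, h1, h2⟩ := ih h
        refine ⟨a, by omega, fun i h3 h4 => ?_, h2⟩
        rcases h4.eq_or_lt with rfl | h4
        · exact hj
        · exact h1 i h3 (by omega)
      · refine ⟨j + 1, le_rfl, fun i h3 h4 => ?_, Or.inr h⟩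
        rwa [le_antisymm h4 h3]
  have hright : ∀ d j, k + 1 - j = d → Level k m ℓ t j → ∃ e, j ≤ e ∧ e ≤ k + 1 ∧
      (∀ i, j ≤ i → i ≤ e → Level k m ℓ t i) ∧ ¬ Level k m ℓ t (e + 1) := by
    intro d
    induction d with
    | zero =>
      intro j hd hj
      have := hj.1
      refine ⟨j, le_rfl, this, fun i h1 h2 => ?_, fun h => ?_⟩
      · rwa [le_antisymm h2 h1]
      · have := h.1
        omega
    | succ d ih =>
      intro j hd hj
      by_cases h : Level k m ℓ t (j + 1)
      · obtain ⟨e, h1, h2, h3, h4⟩ := ih (j + 1) (by omega) h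
        refine ⟨e, by omega, h2, fun i h5 h6 => ?_, h4⟩
        rcases h5.eq_or_lt with rfl | h5
        · exact hj
        · exact h3 i h5 h6
      · refine ⟨j, le_rfl, hj.1, fun i h1 h2 => ?_, h⟩
        rwa [le_antisymm h2 h1]
  obtain ⟨a, h1, h2, h3⟩ := hleft j hj
  obtain ⟨e, h4, h5, h6, h7⟩ := hright _ j rfl hj
  refine ⟨(a, e), mem_runs.2 ⟨h5, h1.trans h4, fun i h8 h9 => ?_, h3, h7⟩, ?_⟩
  · rcases le_total i j with h | h
    · exact h2 i h8 h
    · exact h6 i h h9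
  · simp only [Finset.mem_Ico]
    omega

variable {V : Type*} [Fintype V] {G : SimpleGraph V} {v : Fin (k + 1) → V}

/-- The level sets are decreasing, so windows of runs are nested or disjoint. -/
theorem runs_nested (hv : IsCentralPath G v) {s t : ℕ} (hst : s ≤ t) {R S : ℕ × ℕ}
    (hR : R ∈ runs k m ℓ s) (hS : S ∈ runs k m ℓ t) {x : V} (hxR : x ∈ window hv R.1 R.2)
    (hxS : x ∈ window hv S.1 S.2) : R.1 ≤ S.1 ∧ S.2 ≤ R.2 := by
  obtain ⟨hR1, hR2, hR3, hR4, hR5⟩ := mem_runs.1 hR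
  obtain ⟨hS1, hS2, hS3, hS4, hS5⟩ := mem_runs.1 hS
  rw [mem_window] at hxR hxS
  constructor
  · by_contra h
    have h1 : ¬ (S.1 ≤ R.1 - 1 ∧ R.1 - 1 ≤ S.2) := fun h' =>
      (hR4.resolve_left (by omega)) ((hS3 _ h'.1 h'.2).mono hst)
    rcases hxR with ⟨h2, h3⟩ | ⟨h2, h3⟩ <;> rcases hxS with ⟨h4, h5⟩ | ⟨h4, h5⟩
    · omega
    · exact h4 h2
    · exact h2 h4
    · omega
  · by_contra h
    have h1 : ¬ (S.1 ≤ R.2 + 1 ∧ R.2 + 1 ≤ S.2) := fun h' => hR5 ((hS3 _ h'.1 h'.2).mono hst)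
    rcases hxR with ⟨h2, h3⟩ | ⟨h2, h3⟩ <;> rcases hxS with ⟨h4, h5⟩ | ⟨h4, h5⟩
    · omega
    · exact h4 h2
    · exact h2 h4
    · omega

theorem window_mono (hv : IsCentralPath G v) {a e a' e' : ℕ} (ha : a ≤ a') (he : e' ≤ e) :
    window hv a' e' ⊆ window hv a e := by
  intro x hx
  rw [mem_window] at hx ⊢
  rcases hx with ⟨h1, h2⟩ | ⟨h1, h2⟩
  · exact Or.inl ⟨h1, by omega⟩
  · exact Or.inr ⟨h1, by omega⟩

theorem sum_load_sub_le_sum_runs (t : ℕ) :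
    ∑ j ∈ Finset.range (k + 2), (load k m ℓ j - t) ≤
      ∑ R ∈ runs k m ℓ t, ∑ j ∈ Finset.Ico R.1 (R.2 + 1), (load k m ℓ j - t) := by
  rw [Finset.sum_comm' (t' := Finset.range (k + 2))
    (s' := fun j => (runs k m ℓ t).filter fun R => j ∈ Finset.Ico R.1 (R.2 + 1))]
  · refine Finset.sum_le_sum fun j hj => ?_
    rw [Finset.mem_range] at hj
    rw [Finset.sum_const, smul_eq_mul]
    rcases Nat.eq_zero_or_pos (load k m ℓ j - t) with h | h
    · rw [h]
      exact Nat.zero_le _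
    · obtain ⟨R, hR, hjR⟩ := Level.exists_run (Level.of_lt_load (k := k) (m := m) (ℓ := ℓ) (t := t)
        (j := j) (by omega) (by omega))
      refine Nat.le_mul_of_pos_left _ (Finset.card_pos.2 ⟨R, ?_⟩)
      exact Finset.mem_filter.2 ⟨hR, hjR⟩
  · intro R j
    simp only [Finset.mem_filter, Finset.mem_range, Finset.mem_Ico]
    constructor
    · rintro ⟨h1, h2⟩
      have := (mem_runs.1 h1).1
      exact ⟨⟨h1, h2⟩, by omega⟩
    · rintro ⟨h1, -⟩
      exact h1

/-- The contribution of one run of level `t` to the number of edges of `H`. -/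
theorem sum_load_sub_le_card_rankPairs [LinearOrder V] {H : SimpleGraph V} (hG : G.IsTree)
    (hv : IsCentralPath G v) (hGH : G ≤ H)
    (hH : ∀ p x y q : V, p ≤ x → x < y → y ≤ q → H.Adj p q → H.Adj x y)
    (hopt : IsOptimal k (numSons G v) ℓ) {t : ℕ} {R : ℕ × ℕ}
    (hR : R ∈ runs k (numSons G v) ℓ t) :
    ∑ j ∈ Finset.Ico R.1 (R.2 + 1), (load k (numSons G v) ℓ j - t) ≤
      (rankPairs H.Adj (window hv R.1 R.2) t).card := by
  obtain ⟨a, e⟩ := R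
  obtain ⟨he, hae, hlevel, ha, he'⟩ := mem_runs.1 hR
  simp only at he hae hlevel ha he' ⊢
  have h1 := card_le_card_rankPairs (R := H.Adj) (core_subset_window hv a e)
    (fun x hx y hy hxy hadj => exists_core_between hv hGH hH hae he hx hy hxy hadj) t
  rw [card_core hv he] at h1
  have h2 := sum_load_lt_card_window hG hv hopt.le hae he
    (by
      rcases Nat.eq_zero_or_pos a with h | h
      · exact Or.inl h
      · refine Or.inr (Level.right_eq_zero (k := k) (t := t) ?_ (ha.resolve_left h.ne'))
        rw [Nat.sub_add_cancel h]
        exact hlevel a le_rfl hae)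
    (by
      rcases he.eq_or_lt with h | h
      · exact Or.inl h
      · exact Or.inr (Level.left_eq_zero (Nat.lt_succ_iff.1 h) (hlevel e hae le_rfl) he'))
  have h3 : ∑ j ∈ Finset.Ico a (e + 1), (load k (numSons G v) ℓ j - t) + t * (e + 1 - a) =
      ∑ j ∈ Finset.Ico a (e + 1), load k (numSons G v) ℓ j := by
    have : t * (e + 1 - a) = ∑ j ∈ Finset.Ico a (e + 1), t := by
      rw [Finset.sum_const, Nat.card_Ico, smul_eq_mul, mul_comm]
    rw [this, ← Finset.sum_add_distrib]
    refine Finset.sum_congr rfl fun j hj => ?_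
    rw [Finset.mem_Ico] at hj
    exact Nat.sub_add_cancel ((hlevel j hj.1 (by omega)).le_load hopt)
  have h4 : t * (e + 1 - a) = t * (e - a) + t := by
    rw [← Nat.mul_succ]
    congr 1
    omega
  omega

/-- No edge is counted twice: two windows are nested or disjoint, and the windows of higher levels
are the smaller ones. -/
theorem sum_card_rankPairs_le [LinearOrder V] (H : SimpleGraph V) (hv : IsCentralPath G v)
    (T : ℕ) :
    ∑ t ∈ Finset.range T, ∑ R ∈ runs k m ℓ t, (rankPairs H.Adj (window hv R.1 R.2) t).card ≤
      H.edgeSet.ncard := by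
  classical
  have hwin : ∀ {s t : ℕ}, s ≤ t → ∀ {R S : ℕ × ℕ}, R ∈ runs k m ℓ s → S ∈ runs k m ℓ t →
      window hv S.1 S.2 ⊆ window hv R.1 R.2 ∨ Disjoint (window hv R.1 R.2) (window hv S.1 S.2) := by
    intro s t hst R S hR hS
    by_cases h : Disjoint (window hv R.1 R.2) (window hv S.1 S.2)
    · exact Or.inr h
    · obtain ⟨x, h1, h2⟩ := Finset.not_disjoint_iff.1 h
      have := runs_nested hv hst hR hS h1 h2
      exact Or.inl (window_mono hv this.1 this.2)
  rw [← Finset.sum_sigma (Finset.range T) (fun t => runs k m ℓ t)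
    (fun p => (rankPairs H.Adj (window hv p.2.1 p.2.2) p.1).card), ← Finset.card_biUnion]
  · have hinj : Set.InjOn (fun p : V × V => s(p.1, p.2))
        {p : V × V | p.1 < p.2 ∧ H.Adj p.1 p.2} := by
      rintro ⟨x, y⟩ ⟨hxy, -⟩ ⟨x', y'⟩ ⟨hxy', -⟩ h
      rcases Sym2.eq_iff.1 h with ⟨h1, h2⟩ | ⟨h1, h2⟩
      · exact Prod.ext h1 h2
      · simp only at h1 h2 hxy hxy'
        subst h1 h2
        exact absurd hxy (not_lt.2 hxy'.le)
    have hmem : ∀ p ∈ ((Finset.range T).sigma fun t => runs k m ℓ t).biUnion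
        (fun p => rankPairs H.Adj (window hv p.2.1 p.2.2) p.1), p.1 < p.2 ∧ H.Adj p.1 p.2 := by
      intro p hp
      obtain ⟨i, -, hp⟩ := Finset.mem_biUnion.1 hp
      simp only [rankPairs, Finset.mem_filter] at hp
      exact ⟨hp.2.1, hp.2.2.2⟩
    rw [← Set.ncard_coe_finset]
    refine Set.ncard_le_ncard_of_injOn (fun p : V × V => s(p.1, p.2)) (fun p hp => ?_)
      (hinj.mono fun p hp => hmem p hp) (Set.toFinite _)
    exact (hmem p hp).2
  · rintro ⟨s, R⟩ hR ⟨t, S⟩ hS hne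
    have hR := (Finset.mem_sigma.1 hR).2
    have hS := (Finset.mem_sigma.1 hS).2
    simp only at hR hS ⊢
    rcases lt_trichotomy s t with h | rfl | h
    · rcases hwin h.le hR hS with h' | h'
      · exact disjoint_rankPairs h' h
      · exact disjoint_rankPairs_of_disjoint h' s t
    · refine disjoint_rankPairs_of_disjoint (Finset.disjoint_left.2 fun x h1 h2 => hne ?_) s s
      have h3 := runs_nested hv le_rfl hR hS h1 h2
      have h4 := runs_nested hv le_rfl hS hR h2 h1
      rw [Prod.ext (le_antisymm h3.1 h4.1) (le_antisymm h4.2 h3.2)]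
    · rcases hwin h.le hS hR with h' | h'
      · exact (disjoint_rankPairs h' h).symm
      · exact (disjoint_rankPairs_of_disjoint h' t s).symm

/-- The lower bound: summed over all levels, the runs provide `∑ j, (load j + 1).choose 2` edges of
`H`, of which `∑ j, load j` are edges of the tree. -/
theorem IsOptimal.modelCost_le_fillNumber {H : SimpleGraph V} (hG : G.IsTree)
    (hv : IsCentralPath G v) (hopt : IsOptimal k (numSons G v) ℓ) (hH : IsPIGCompletion G H) :
    modelCost k (numSons G v) ℓ ≤ fillNumber G H := by
  obtain ⟨hGH, hH⟩ := hH
  obtain ⟨_, hH⟩ := hH.exists_linearOrder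
  set w := load k (numSons G v) ℓ with hw
  set T := ∑ j ∈ Finset.range (k + 2), w j with hT
  have h1 : ∑ j ∈ Finset.range (k + 2), (w j + 1).choose 2 ≤
      ∑ t ∈ Finset.range T, ∑ j ∈ Finset.range (k + 2), (w j - t) := by
    rw [Finset.sum_comm]
    refine Finset.sum_le_sum fun j hj => ?_
    rw [← sum_range_sub]
    refine Finset.sum_le_sum_of_subset (Finset.range_mono ?_)
    exact Finset.single_le_sum (f := w) (fun _ _ => Nat.zero_le _) hj
  have h2 : ∑ t ∈ Finset.range T, ∑ j ∈ Finset.range (k + 2), (w j - t) ≤ H.edgeSet.ncard := by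
    refine le_trans (Finset.sum_le_sum fun t _ => ?_)
      (sum_card_rankPairs_le (m := numSons G v) (ℓ := ℓ) H hv T)
    exact (sum_load_sub_le_sum_runs t).trans
      (Finset.sum_le_sum fun R hR => sum_load_sub_le_card_rankPairs hG hv hGH hH hopt hR)
  have h3 := fillNumber_add hG hGH
  have h4 := card_eq_sum_numSons hG hv
  have h5 : T = k + ∑ i ∈ Finset.range (k + 1), numSons G v i := sum_load hopt.le
  have h6 : ∑ j ∈ Finset.range (k + 2), (w j + 1).choose 2 = modelCost k (numSons G v) ℓ + T := by
    rw [modelCost, hT, ← Finset.sum_add_distrib]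
    exact Finset.sum_congr rfl fun j _ => choose_two_succ _
  omega

end Runs

/-! ### Normal models -/

section NormalModel

variable {V : Type*} {G : SimpleGraph V} {k : ℕ} {v : Fin (k + 1) → V}

/-- The normal model in which the sons in `A` are left sons, and the others are right sons. -/
noncomputable def normalModel (hv : IsCentralPath G v) (A : Set V) (x : V) : Set ℝ :=
  open scoped Classical in
  if x ∈ Set.range v then Set.Icc ((hv.index x : ℕ) : ℝ) (((hv.index x : ℕ) : ℝ) + 1)
  else if x ∈ A then {((hv.index x : ℕ) : ℝ)} else {((hv.index x : ℕ) : ℝ) + 1}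

variable {J : V → Set ℝ} {H : SimpleGraph V}

/-- The end points of the intervals of a normal model. -/
theorem IsNormalModel.exists_endpoints [Finite V] (hG : G.IsTree) (hv : IsCentralPath G v)
    (hJ : IsNormalModel G v J) : ∃ lo hi : V → ℕ,
      (∀ x, J x = Set.Icc (lo x : ℝ) (hi x)) ∧
      (∀ x ∈ Set.range v, lo x = hv.index x ∧ hi x = hv.index x + 1) ∧
      ∀ x ∉ Set.range v, hi x = lo x ∧ (lo x = hv.index x ∨ lo x = hv.index x + 1) := by
  have h : ∀ x, ∃ p : ℕ × ℕ, J x = Set.Icc (p.1 : ℝ) p.2 ∧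
      (x ∈ Set.range v → p.1 = hv.index x ∧ p.2 = hv.index x + 1) ∧
      (x ∉ Set.range v → p.2 = p.1 ∧ (p.1 = hv.index x ∨ p.1 = hv.index x + 1)) := by
    intro x
    by_cases hx : x ∈ Set.range v
    · obtain ⟨i, rfl⟩ := hx
      refine ⟨(i, i + 1), ?_, fun _ => ?_, fun h => absurd ⟨i, rfl⟩ h⟩
      · rw [hJ.spine]
        push_cast
        rfl
      · rw [hv.index_spine]
        exact ⟨rfl, rfl⟩
    · rcases hJ.leaf (hv.index x) x ((hv.mem_sons hG).2 ⟨hx, rfl⟩) with h | h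
      · exact ⟨(hv.index x, hv.index x), by rw [h, Set.Icc_self], fun h => absurd h hx,
          fun _ => ⟨rfl, Or.inl rfl⟩⟩
      · refine ⟨(hv.index x + 1, hv.index x + 1), ?_, fun h => absurd h hx,
          fun _ => ⟨rfl, Or.inr rfl⟩⟩
        rw [h]
        push_cast
        rw [Set.Icc_self]
  choose p h1 h2 h3 using h
  exact ⟨fun x => (p x).1, fun x => (p x).2, h1, h2, h3⟩

theorem Icc_inter_Icc_nonempty {a b c d : ℝ} (hab : a ≤ b) (hcd : c ≤ d) :
    (Set.Icc a b ∩ Set.Icc c d).Nonempty ↔ a ≤ d ∧ c ≤ b := by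
  rw [Set.Icc_inter_Icc, Set.nonempty_Icc, sup_le_iff, le_inf_iff, le_inf_iff]
  tauto

/-- To make a normal model proper, it suffices to widen every point to an interval of length
`2 / 3`. -/
theorem IsNormalModel.isPIGCompletion [Finite V] (hG : G.IsTree) (hv : IsCentralPath G v)
    (hJ : IsNormalModel G v J) (hH : IsIntersectionModel H J) : IsPIGCompletion G H := by
  classical
  obtain ⟨lo, hi, hJ', hspine, hson⟩ := hJ.exists_endpoints hG hv
  have hle : ∀ x, lo x ≤ hi x := by
    intro x
    by_cases hx : x ∈ Set.range v
    · have := hspine x hx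
      omega
    · exact (hson x hx).1.ge
  have hadj : ∀ x y, x ≠ y → (H.Adj x y ↔ lo x ≤ hi y ∧ lo y ≤ hi x) := by
    intro x y hxy
    rw [hH x y hxy, hJ', hJ', Icc_inter_Icc_nonempty (by exact_mod_cast hle x)
      (by exact_mod_cast hle y)]
    norm_cast
  refine ⟨fun x y hxy => ?_, ?_⟩
  · have hne := G.ne_of_adj hxy
    rw [hadj x y hne]
    by_cases hx : x ∈ Set.range v
    · by_cases hy : y ∈ Set.range v
      · have h1 := hspine x hx
        have h2 := hspine y hy
        obtain ⟨i, rfl⟩ := hx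
        obtain ⟨j, rfl⟩ := hy
        have h3 := (hv.adj_spine_iff hG).1 hxy
        rw [hv.index_spine] at h1 h2
        omega
      · have h1 := (hv.adj_son_iff hG hy).1 hxy.symm
        have h2 := hspine x hx
        have h3 := hson y hy
        have h4 := congrArg hv.index h1
        rw [hv.index_spine] at h4
        rw [h4] at h2
        omega
    · have h1 := (hv.adj_son_iff hG hx).1 hxy
      have h3 := hson x hx
      have h4 := congrArg hv.index h1
      rw [hv.index_spine] at h4
      have h2 := hspine y ⟨_, h1.symm⟩
      rw [h4] at h2
      omega
  · let δ : V → ℝ := fun x => if x ∈ Set.range v then 0 else 1 / 3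
    have hδ0 : ∀ x, 0 ≤ δ x := by
      intro x
      simp only [δ]
      split_ifs <;> norm_num
    have hδ1 : ∀ x, δ x ≤ 1 / 3 := by
      intro x
      simp only [δ]
      split_ifs <;> norm_num
    have hle' : ∀ x, (lo x : ℝ) - δ x ≤ hi x + δ x := by
      intro x
      have : (lo x : ℝ) ≤ hi x := by exact_mod_cast hle x
      linarith [hδ0 x]
    have hround : ∀ x y, ((lo x : ℝ) - δ x ≤ hi y + δ y ↔ lo x ≤ hi y) := by
      intro x y
      constructor
      · intro h
        have : (lo x : ℝ) < hi y + 1 := by linarith [hδ1 x, hδ1 y]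
        exact Nat.lt_succ_iff.1 (by exact_mod_cast this)
      · intro h
        have : (lo x : ℝ) ≤ hi y := by exact_mod_cast h
        linarith [hδ0 x, hδ0 y]
    refine ⟨fun x => Set.Icc (lo x - δ x) (hi x + δ x), fun x => ⟨_, _, hle' x, rfl⟩, ?_, ?_⟩
    · intro x y hxy
      rw [hadj x y hxy, Icc_inter_Icc_nonempty (hle' x) (hle' y), hround, hround]
    · intro x y hxy
      obtain ⟨h1, h2⟩ := (Set.Icc_subset_Icc_iff (hle' x)).1 hxy.1
      refine hxy.2 ((Set.Icc_subset_Icc_iff (hle' y)).2 ?_)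
      by_cases hx : x ∈ Set.range v <;> by_cases hy : y ∈ Set.range v
      · have h3 := hspine x hx
        have h4 := hspine y hy
        simp only [δ, hx, hy, if_true, sub_zero, add_zero] at h1 h2 ⊢
        norm_cast at h1 h2 ⊢
        omega
      · have h3 := hspine x hx
        have h4 := hson y hy
        simp only [δ, hx, hy, if_true, if_false, sub_zero, add_zero, h3.1, h3.2, h4.1] at h1 h2
        push_cast at h2
        linarith
      · have h3 := hson x hx
        have h4 := hspine y hy
        simp only [δ, hx, hy, if_true, if_false, sub_zero, add_zero, h3.1, h4.1, h4.2] at h1 h2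
        have h5 : ((hv.index y : ℕ) : ℝ) < lo x := by linarith
        have h6 : (lo x : ℝ) < ((hv.index y + 1 : ℕ) : ℝ) := by linarith
        norm_cast at h5 h6
        omega
      · have h3 := hson x hx
        have h4 := hson y hy
        simp only [δ, hx, hy, if_false, h3.1, h4.1] at h1 h2 ⊢
        constructor <;> linarith

theorem IsNormalModel.ncard_right_sons [Finite V] (i : Fin (k + 1)) :
    {x ∈ sons G v i | J x ≠ {((i : ℕ) : ℝ)}}.ncard = numSons G v i - numLeftSons G v J i := by
  rw [numSons_fin, numLeftSons, ← Set.ncard_sdiff (Set.sep_subset _ _) (Set.toFinite _)]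
  congr 1
  ext x
  simp only [Set.mem_sep_iff, Set.mem_sdiff]
  tauto

/-- A normal model has at most as many fill edges as its loads require: its cliques cover all
edges, and the edges of the tree are as many as the loads add up to. -/
theorem IsNormalModel.fillNumber_le [Finite V] (hG : G.IsTree) (hv : IsCentralPath G v)
    (hJ : IsNormalModel G v J) (hH : IsIntersectionModel H J) {ℓ : ℕ → ℕ}
    (hℓ : ∀ i : Fin (k + 1), ℓ i = numLeftSons G v J i) (hle : ∀ i ≤ k, ℓ i ≤ numSons G v i) :
    fillNumber G H ≤ modelCost k (numSons G v) ℓ := by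
  classical
  have := Fintype.ofFinite V
  have hcomp := hJ.isPIGCompletion hG hv hH
  obtain ⟨lo, hi, hJ', hspine, hson⟩ := hJ.exists_endpoints hG hv
  set m := numSons G v with hm
  let K : ℕ → Finset V := fun j => Finset.univ.filter fun x => lo x ≤ j ∧ j ≤ hi x
  have hbound : ∀ x, lo x ≤ hi x ∧ hi x ≤ k + 1 := by
    intro x
    have := (hv.index x).2
    by_cases hx : x ∈ Set.range v
    · have := hspine x hx
      omega
    · have := hson x hx
      omega
  have hK : ∀ j ≤ k + 1, (K j).card ≤ load k m ℓ j + 1 := by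
    intro j hj
    let S := Finset.univ.filter fun x =>
      x ∈ Set.range v ∧ (hv.index x : ℕ) ∈ Finset.Icc (j - 1) (min j k)
    let L := Finset.univ.filter fun x => x ∉ Set.range v ∧ (hv.index x : ℕ) = j ∧ lo x = j
    let R := Finset.univ.filter fun x => x ∉ Set.range v ∧ (hv.index x : ℕ) + 1 = j ∧ lo x = j
    have hsub : K j ⊆ S ∪ L ∪ R := by
      intro x hx
      have hx := (Finset.mem_filter.1 hx).2
      have := (hv.index x).2
      simp only [S, L, R, Finset.mem_union, Finset.mem_filter, Finset.mem_univ, true_and,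
        Finset.mem_Icc]
      by_cases hxv : x ∈ Set.range v
      · have := hspine x hxv
        exact Or.inl (Or.inl ⟨hxv, by omega⟩)
      · have := hson x hxv
        rcases this.2 with h | h
        · exact Or.inl (Or.inr ⟨hxv, by omega⟩)
        · exact Or.inr ⟨hxv, by omega⟩
    have hS : S.card = min j k + 1 - (j - 1) := by
      rw [← Nat.card_Icc]
      refine card_filter_spine hv _ fun i hi => ?_
      rw [Finset.mem_Icc] at hi
      omega
    have hJlo : ∀ x ∉ Set.range v, ∀ i : ℕ, J x = {(i : ℝ)} ↔ lo x = i := by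
      intro x hx i
      rw [hJ', (hson x hx).1, Set.Icc_self, Set.singleton_eq_singleton_iff, Nat.cast_inj]
    have hL : L.card ≤ if j ≤ k then ℓ j else 0 := by
      split_ifs with h
      · have h' := hℓ ⟨j, by omega⟩
        simp only at h'
        rw [h', numLeftSons, ← Set.ncard_coe_finset]
        refine Set.ncard_le_ncard (fun x hx => ?_) (Set.toFinite _)
        have hx := (Finset.mem_filter.1 (Finset.mem_coe.1 hx)).2
        exact ⟨(hv.mem_sons hG).2 ⟨hx.1, Fin.ext hx.2.1⟩, (hJlo x hx.1 j).2 hx.2.2⟩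
      · refine (Finset.card_eq_zero.2 (Finset.filter_eq_empty_iff.2 fun x _ hx => ?_)).le
        have := (hv.index x).2
        omega
    have hR : R.card ≤ if 1 ≤ j then m (j - 1) - ℓ (j - 1) else 0 := by
      split_ifs with h
      · have h' := hℓ ⟨j - 1, by omega⟩
        simp only at h'
        have h2 := IsNormalModel.ncard_right_sons (G := G) (v := v) (J := J) ⟨j - 1, by omega⟩
        simp only at h2
        rw [h', hm, ← h2, ← Set.ncard_coe_finset]
        refine Set.ncard_le_ncard (fun x hx => ?_) (Set.toFinite _)
        have hx := (Finset.mem_filter.1 (Finset.mem_coe.1 hx)).2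
        refine ⟨(hv.mem_sons hG).2 ⟨hx.1, Fin.ext ?_⟩, fun h3 => ?_⟩
        · dsimp only
          omega
        · have := (hJlo x hx.1 _).1 h3
          omega
      · refine (Finset.card_eq_zero.2 (Finset.filter_eq_empty_iff.2 fun x _ hx => ?_)).le
        omega
    have h1 := (Finset.card_le_card hsub).trans (Finset.card_union_le _ _)
    have h2 := Finset.card_union_le S L
    have h3 : load k m ℓ j = (if j ≤ k then ℓ j else 0) +
      (if 1 ≤ j then m (j - 1) - ℓ (j - 1) else 0) + (if 1 ≤ j ∧ j ≤ k then 1 else 0) := rfl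
    have h4 : min j k + 1 - (j - 1) ≤ (if 1 ≤ j ∧ j ≤ k then 1 else 0) + 1 := by
      split_ifs <;> omega
    omega
  have hedges : H.edgeSet.ncard ≤ ∑ j ∈ Finset.range (k + 2), (load k m ℓ j + 1).choose 2 := by
    have hsub : H.edgeSet ⊆ ((Finset.range (k + 2)).biUnion fun j =>
        (K j).offDiag.image fun p : V × V => s(p.1, p.2) : Finset (Sym2 V)) := by
      intro e he
      induction e using Sym2.ind with
      | h x y =>
        have hxy : H.Adj x y := he
        have hne := H.ne_of_adj hxy
        have h := (hH x y hne).1 hxy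
        have hx := hbound x
        have hy := hbound y
        rw [hJ', hJ', Icc_inter_Icc_nonempty (by exact_mod_cast hx.1)
          (by exact_mod_cast hy.1)] at h
        norm_cast at h
        simp only [Finset.coe_biUnion, Set.mem_iUnion, Finset.mem_coe, Finset.mem_image]
        refine ⟨max (lo x) (lo y), Finset.mem_range.2 (by omega), (x, y), ?_, rfl⟩
        simp only [K, Finset.mem_offDiag, Finset.mem_filter, Finset.mem_univ, true_and]
        exact ⟨by omega, by omega, hne⟩
    refine (Set.ncard_le_ncard hsub (Finset.finite_toSet _)).trans ?_
    rw [Set.ncard_coe_finset]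
    refine Finset.card_biUnion_le.trans (Finset.sum_le_sum fun j hj => ?_)
    have h := Sym2.card_image_offDiag (K j)
    exact h.trans_le (Nat.choose_le_choose 2 (hK j (by rw [Finset.mem_range] at hj; omega)))
  have h3 := fillNumber_add hG hcomp.1
  have h4 := card_eq_sum_numSons hG hv
  rw [← hm] at h4
  have h5 : ∑ j ∈ Finset.range (k + 2), load k m ℓ j = k + ∑ i ∈ Finset.range (k + 1), m i :=
    sum_load hle
  have h6 : ∑ j ∈ Finset.range (k + 2), (load k m ℓ j + 1).choose 2 =
      modelCost k m ℓ + ∑ j ∈ Finset.range (k + 2), load k m ℓ j := by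
    rw [modelCost, ← Finset.sum_add_distrib]
    exact Finset.sum_congr rfl fun j _ => choose_two_succ _
  omega

theorem isNormalModel_normalModel (hv : IsCentralPath G v) (hG : G.IsTree) [Finite V] (A : Set V) :
    IsNormalModel G v (normalModel hv A) where
  spine i := by
    have : v i ∈ Set.range v := ⟨i, rfl⟩
    rw [normalModel, if_pos this, hv.index_spine]
  leaf i x hx := by
    obtain ⟨hx', rfl⟩ := (hv.mem_sons hG).1 hx
    rw [normalModel, if_neg hx']
    split_ifs
    · exact Or.inl rfl
    · exact Or.inr rfl

theorem numLeftSons_normalModel (hv : IsCentralPath G v) (hG : G.IsTree) [Finite V] (A : Set V)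
    (i : Fin (k + 1)) : numLeftSons G v (normalModel hv A) i = (sons G v i ∩ A).ncard := by
  rw [numLeftSons]
  congr 1
  ext x
  simp only [Set.mem_sep_iff, Set.mem_inter_iff, and_congr_right_iff]
  intro hx
  obtain ⟨hx', rfl⟩ := (hv.mem_sons hG).1 hx
  rw [normalModel, if_neg hx']
  split_ifs with h
  · simp [h]
  · simp [h]

theorem exists_isNormalModel_numLeftSons [Finite V] (hG : G.IsTree) (hv : IsCentralPath G v)
    {ℓ : Fin (k + 1) → ℕ} (hℓ : ∀ i, ℓ i ≤ numSons G v i) :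
    ∃ J : V → Set ℝ, IsNormalModel G v J ∧ numLeftSons G v J = ℓ := by
  have h : ∀ i, ∃ A ⊆ sons G v i, A.ncard = ℓ i := fun i =>
    Set.exists_subset_card_eq ((hℓ i).trans_eq (numSons_fin i))
  choose A hA hA' using h
  refine ⟨normalModel hv (⋃ i, A i), isNormalModel_normalModel hv hG _, funext fun i => ?_⟩
  rw [numLeftSons_normalModel hv hG, ← hA' i]
  congr 1
  ext x
  simp only [Set.mem_inter_iff, Set.mem_iUnion]
  constructor
  · rintro ⟨hx, j, hj⟩
    have h1 := ((hv.mem_sons hG).1 hx).2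
    have h2 := ((hv.mem_sons hG).1 (hA j hj)).2
    rwa [← h1, h2]
  · exact fun hx => ⟨hA i hx, i, hx⟩

/-- The intersection graph of a family of sets. -/
def intersectionGraph (J : V → Set ℝ) : SimpleGraph V where
  Adj x y := x ≠ y ∧ (J x ∩ J y).Nonempty
  symm := ⟨fun x y h => ⟨h.1.symm, by rw [Set.inter_comm]; exact h.2⟩⟩
  loopless := ⟨fun _ h => h.1 rfl⟩

theorem isIntersectionModel_intersectionGraph (J : V → Set ℝ) :
    IsIntersectionModel (intersectionGraph J) J := fun _ _ hxy => and_iff_right hxy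

/-- Every completion has at least `dpValue` fill edges, and a normal model whose numbers of left
sons attain the minima of the dynamic program has no more. -/
theorem IsDPChoice.isMinPIGCompletion [Finite V] (hG : G.IsTree) (hv : IsCentralPath G v)
    (hℓ : IsDPChoice k (numSons G v) (numLeftSons G v J)) (hJ : IsNormalModel G v J)
    (hH : IsIntersectionModel H J) : IsMinPIGCompletion G H := by
  have := Fintype.ofFinite V
  obtain ⟨ℓ', h1, h2⟩ := hℓ.exists_extension
  have h3 := h2.isOptimal
  exact ⟨hJ.isPIGCompletion hG hv hH, fun H' hH' =>
    (hJ.fillNumber_le hG hv hH h1 h3.le).trans (h3.modelCost_le_fillNumber hG hv hH')⟩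

theorem IsMinPIGCompletion.fillNumber_eq [Finite V] (hG : G.IsTree) (hv : IsCentralPath G v)
    (hH : IsMinPIGCompletion G H) : fillNumber G H = dpValue k (numSons G v) := by
  have := Fintype.ofFinite V
  obtain ⟨ℓ, hℓ⟩ := exists_isDPChoice k (numSons G v)
  obtain ⟨J, hJ, hJℓ⟩ := exists_isNormalModel_numLeftSons hG hv hℓ.le
  have h1 := isIntersectionModel_intersectionGraph J
  refine le_antisymm ?_ ?_
  · refine (hH.2 _ (hJ.isPIGCompletion hG hv h1)).trans ?_
    rw [← hℓ.modelCost_eq]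
    exact hJ.fillNumber_le hG hv h1 (fun i => (congrFun hJℓ i).symm) hℓ.isOptimal.le
  · rw [← hℓ.modelCost_eq]
    exact hℓ.isOptimal.modelCost_le_fillNumber hG hv hH.1

end NormalModel

/-! ### Reasoning about programs -/

/-- The registers that a program may change. -/
def Program.WritesReg : Program → ℕ → Prop
  | .skip, _ => False
  | .assign x _, r => x = r
  | .write _ _ _, _ => False
  | .seq p q, r => p.WritesReg r ∨ q.WritesReg r
  | .ite _ p q, r => p.WritesReg r ∨ q.WritesReg r
  | .loop _ p, r => p.WritesReg r

/-- The arrays that a program may change. -/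
def Program.WritesArr : Program → ℕ → Prop
  | .skip, _ => False
  | .assign _ _, _ => False
  | .write a _ _, b => a = b
  | .seq p q, b => p.WritesArr b ∨ q.WritesArr b
  | .ite _ p q, b => p.WritesArr b ∨ q.WritesArr b
  | .loop _ p, b => p.WritesArr b

/-- The stores `s` and `s'` agree on everything that `p` does not write. -/
structure Unchanged (p : Program) (s s' : Store) : Prop where
  reg : ∀ r, ¬ p.WritesReg r → s'.reg r = s.reg r
  arr : ∀ a, ¬ p.WritesArr a → s'.arr a = s.arr a

theorem Unchanged.refl (p : Program) (s : Store) : Unchanged p s s :=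
  ⟨fun _ _ => rfl, fun _ _ => rfl⟩

theorem Unchanged.trans {p : Program} {s s' s'' : Store} (h : Unchanged p s s')
    (h' : Unchanged p s' s'') : Unchanged p s s'' :=
  ⟨fun r hr => (h'.reg r hr).trans (h.reg r hr), fun a ha => (h'.arr a ha).trans (h.arr a ha)⟩

theorem Unchanged.mono {p q : Program} {s s' : Store} (h : Unchanged p s s')
    (hr : ∀ r, p.WritesReg r → q.WritesReg r) (ha : ∀ a, p.WritesArr a → q.WritesArr a) :
    Unchanged q s s' :=
  ⟨fun r h' => h.reg r fun h'' => h' (hr r h''), fun a h' => h.arr a fun h'' => h' (ha a h'')⟩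

theorem Run.unchanged {p : Program} {s s' : Store} {t : ℕ} (h : Run p s t s') :
    Unchanged p s s' := by
  induction h with
  | skip s => exact Unchanged.refl _ s
  | assign s x e =>
    exact ⟨fun r hr => Function.update_of_ne (fun h => hr h.symm) _ _, fun _ _ => rfl⟩
  | write s a pos e =>
    exact ⟨fun _ _ => rfl, fun b hb => Function.update_of_ne (fun h => hb h.symm) _ _⟩
  | seq _ _ ih1 ih2 =>
    exact (ih1.mono (fun _ => Or.inl) fun _ => Or.inl).trans
      (ih2.mono (fun _ => Or.inr) fun _ => Or.inr)
  | ite_true _ _ ih => exact ih.mono (fun _ => Or.inl) fun _ => Or.inl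
  | ite_false _ _ ih => exact ih.mono (fun _ => Or.inr) fun _ => Or.inr
  | loop_true _ _ _ ih1 ih2 =>
    exact Unchanged.trans (ih1.mono (q := .loop _ _) (fun _ => id) fun _ => id) ih2
  | loop_false _ => exact Unchanged.refl _ _

/-- Started in the store `s`, the program `p` halts after at most `T` steps in a store that
satisfies `Q`. What `p` leaves unchanged need not be part of `Q`, see `Halts.mono` and `Halts.seq`.
-/
def Halts (p : Program) (s : Store) (T : ℕ) (Q : Store → Prop) : Prop :=
  ∃ t s', Run p s t s' ∧ t ≤ T ∧ Q s'

theorem Halts.mono {p : Program} {s : Store} {T T' : ℕ} {Q Q' : Store → Prop} (h : Halts p s T Q)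
    (hT : T ≤ T') (hQ : ∀ s', Unchanged p s s' → Q s' → Q' s') : Halts p s T' Q' := by
  obtain ⟨t, s', h1, h2, h3⟩ := h
  exact ⟨t, s', h1, h2.trans hT, hQ s' h1.unchanged h3⟩

theorem Halts.seq {p q : Program} {s : Store} {T U : ℕ} {P Q : Store → Prop} (h : Halts p s T P)
    (h' : ∀ s', Unchanged p s s' → P s' → Halts q s' U Q) : Halts (.seq p q) s (T + U) Q := by
  obtain ⟨t, s', h1, h2, h3⟩ := h
  obtain ⟨u, s'', h4, h5, h6⟩ := h' s' h1.unchanged h3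
  exact ⟨t + u, s'', h1.seq h4, Nat.add_le_add h2 h5, h6⟩

/-- A loop that is known to be repeated `B` times, with an invariant that depends on the number of
repetitions. -/
theorem Halts.loop {e : RExpr} {p : Program} {s : Store} {B T : ℕ} (I : ℕ → Store → Prop)
    (h0 : I 0 s)
    (hstep : ∀ i < B, ∀ s', I i s' → Unchanged p s s' → e.eval s' ≠ 0 ∧ Halts p s' T (I (i + 1)))
    (hend : ∀ s', I B s' → Unchanged p s s' → e.eval s' = 0) :
    Halts (.loop e p) s (B * (T + e.cost + 1) + (e.cost + 1)) (I B) := by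
  have key : ∀ d i, i + d = B → ∀ s', I i s' → Unchanged p s s' →
      Halts (.loop e p) s' (d * (T + e.cost + 1) + (e.cost + 1)) (I B) := by
    intro d
    induction d with
    | zero =>
      intro i hi s' hs' hu
      obtain rfl : i = B := hi
      refine ⟨e.cost + 1, s', Run.loop_false (hend s' hs' hu), by omega, hs'⟩
    | succ d ih =>
      intro i hi s' hs' hu
      obtain ⟨h1, t, s'', h2, h3, h4⟩ := hstep i (by omega) s' hs' hu
      obtain ⟨u, s₃, h5, h6, h7⟩ := ih (i + 1) (by omega) s'' h4 (hu.trans h2.unchanged)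
      refine ⟨e.cost + t + u + 1, s₃, Run.loop_true h1 h2 h5, ?_, h7⟩
      rw [Nat.succ_mul]
      omega
  exact key B 0 (Nat.zero_add B) s h0 (Unchanged.refl _ _)

namespace Program

/-- A program without loops. -/
def LoopFree : Program → Prop
  | skip => True
  | assign _ _ => True
  | write _ _ _ => True
  | seq p q => p.LoopFree ∧ q.LoopFree
  | ite _ p q => p.LoopFree ∧ q.LoopFree
  | loop _ _ => False

/-- The effect of a program without loops. -/
def exec : Program → Store → Store
  | skip, s => s
  | assign x e, s => s.setReg x (e.eval s)
  | write a pos e, s => s.setArr a (pos.eval s) (e.eval s)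
  | seq p q, s => q.exec (p.exec s)
  | ite e p q, s => if e.eval s ≠ 0 then p.exec s else q.exec s
  | loop _ _, s => s

/-- A bound for the number of steps of a program without loops. -/
def size : Program → ℕ
  | skip => 1
  | assign _ e => e.cost + 1
  | write _ pos e => pos.cost + e.cost + 1
  | seq p q => p.size + q.size
  | ite e p q => e.cost + (p.size + q.size) + 1
  | loop _ _ => 0

/-- The loop that repeats `p` for the values `0, 1, …` of the register `x` below that of `e`. -/
def forLoop (x : ℕ) (e : RExpr) (p : Program) : Program :=
  seq (assign x (.const 0)) (loop (.lt (.reg x) e) (seq p (assign x (.add (.reg x) (.const 1)))))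

end Program

theorem Halts.of_exec {p : Program} (hp : p.LoopFree) {s : Store} {Q : Store → Prop}
    (h : Q (p.exec s)) : Halts p s p.size Q := by
  have key : ∀ (p : Program), p.LoopFree → ∀ s, ∃ t ≤ p.size, Run p s t (p.exec s) := by
    intro p
    induction p with
    | skip => exact fun _ s => ⟨1, le_rfl, Run.skip s⟩
    | assign x e => exact fun _ s => ⟨_, le_rfl, Run.assign s x e⟩
    | write a pos e => exact fun _ s => ⟨_, le_rfl, Run.write s a pos e⟩
    | seq p q ih1 ih2 =>
      intro hp s
      obtain ⟨t, h1, h2⟩ := ih1 hp.1 s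
      obtain ⟨u, h3, h4⟩ := ih2 hp.2 (p.exec s)
      exact ⟨t + u, Nat.add_le_add h1 h3, h2.seq h4⟩
    | ite e p q ih1 ih2 =>
      intro hp s
      by_cases he : e.eval s = 0
      · obtain ⟨t, h1, h2⟩ := ih2 hp.2 s
        refine ⟨e.cost + t + 1, by simp only [Program.size]; omega, ?_⟩
        rw [Program.exec, if_neg (not_not.2 he)]
        exact Run.ite_false he h2
      · obtain ⟨t, h1, h2⟩ := ih1 hp.1 s
        refine ⟨e.cost + t + 1, by simp only [Program.size]; omega, ?_⟩
        rw [Program.exec, if_pos he]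
        exact Run.ite_true he h2
    | loop e p ih => exact fun hp => hp.elim
  obtain ⟨t, h1, h2⟩ := key p hp s
  exact ⟨t, _, h2, h1, h⟩

theorem Halts.of_exec_le {p : Program} {s : Store} {T : ℕ} {Q : Store → Prop} (hp : p.LoopFree)
    (hT : p.size ≤ T) (h : Q (p.exec s)) : Halts p s T Q :=
  (Halts.of_exec hp h).mono hT fun _ _ h => h

/-- The rule for `forLoop`, with an invariant that does not depend on the counter. Besides `T`
steps for `p`, each repetition takes `e.cost + 3` steps for the test and four for the increment. -/
theorem Halts.forLoop {x : ℕ} {e : RExpr} {p : Program} {s : Store} {B T : ℕ}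
    (I : ℕ → Store → Prop) (hx : ¬ p.WritesReg x)
    (hI : ∀ i s c, I i s → I i (s.setReg x c)) (h0 : I 0 s)
    (he : ∀ s', Unchanged (Program.forLoop x e p) s s' → e.eval s' = B)
    (hstep : ∀ i < B, ∀ s', I i s' → Unchanged (Program.forLoop x e p) s s' → s'.reg x = i →
      Halts p s' T (I (i + 1))) :
    Halts (Program.forLoop x e p) s (B * (T + e.cost + 7) + (e.cost + 5)) (I B) := by
  set q : Program := .seq p (.assign x (.add (.reg x) (.const 1))) with hq
  have hassign : ∀ (s : Store) (c : ℕ), Unchanged (Program.forLoop x e p) s (s.setReg x c) :=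
    fun s c => ⟨fun r hr => Function.update_of_ne (fun h => hr (Or.inl h.symm)) _ _, fun _ _ => rfl⟩
  have hmono : ∀ {s s' : Store}, Unchanged q s s' → Unchanged (Program.forLoop x e p) s s' :=
    fun h => h.mono (fun _ h => Or.inr h) (fun _ h => Or.inr h)
  have h1 : Halts (.assign x (.const 0)) s 2 (fun s' => s' = s.setReg x 0) :=
    Halts.of_exec (p := .assign x (.const 0)) trivial rfl
  have h2 := h1.seq (q := .loop (.lt (.reg x) e) q)
    (U := B * ((T + 4) + (e.cost + 2) + 1) + (e.cost + 2 + 1)) (Q := I B) fun s' _ hs' => by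
      subst hs'
      have h3 := Halts.loop (e := .lt (.reg x) e) (p := q) (s := s.setReg x 0) (B := B)
        (T := T + 4) (fun i s' => I i s' ∧ s'.reg x = i) ⟨hI 0 s 0 h0, Function.update_self _ _ _⟩
        (fun i hi s' hs' hu => by
          have hu' := (hassign s 0).trans (hmono hu)
          refine ⟨?_, ?_⟩
          · simp only [RExpr.eval, he s' hu', hs'.2, if_pos hi]
            exact one_ne_zero
          · refine Halts.seq (hstep i hi s' hs'.1 hu' hs'.2) fun s'' hu'' hs'' => ?_
            refine Halts.of_exec (p := .assign x (.add (.reg x) (.const 1))) trivial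
              ⟨hI _ _ _ hs'', ?_⟩
            rw [Program.exec, RExpr.eval, RExpr.eval, RExpr.eval, hu''.reg x hx, hs'.2]
            exact Function.update_self _ _ _)
        (fun s' hs' hu => by
          have hu' := (hassign s 0).trans (hmono hu)
          simp only [RExpr.eval, he s' hu', hs'.2, lt_irrefl, if_false])
      have hcost : (RExpr.lt (.reg x) e).cost = e.cost + 2 := by
        simp only [RExpr.cost]
        omega
      rw [hcost] at h3
      exact h3.mono le_rfl fun s' _ h => h.1
  refine h2.mono (le_of_eq ?_) fun _ _ h => h
  ring

/-- The rule for a `forLoop` over `0, …, n - 1`, where `n` is in register `0`. -/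
theorem Halts.forLoop_reg {x : ℕ} {p : Program} {s : Store} {n T : ℕ}
    (I : ℕ → Store → Prop) (hx : ¬ p.WritesReg x) (hx0 : x ≠ 0) (hp0 : ¬ p.WritesReg 0)
    (hn : s.reg 0 = n) (hI : ∀ i s c, I i s → I i (s.setReg x c)) (h0 : I 0 s)
    (hstep : ∀ i < n, ∀ s', I i s' → Unchanged (Program.forLoop x (.reg 0) p) s s' →
      s'.reg x = i → Halts p s' T (I (i + 1))) :
    Halts (Program.forLoop x (.reg 0) p) s (n * (T + 8) + 6) (I n) := by
  refine Halts.forLoop I hx hI h0 (fun s' hu => ?_) hstep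
  refine (hu.reg 0 ?_).trans hn
  rintro (h | h | h)
  · exact hx0 h
  · exact hp0 h
  · exact hx0 h

/-! ### The central path that is traversed -/

section Start

variable {V : Type*} {G : SimpleGraph V} {k : ℕ} {v : Fin (k + 1) → V}

/-- A vertex with at least two neighbours. -/
def IsInner (G : SimpleGraph V) (x : V) : Prop := ∃ y z, y ≠ z ∧ G.Adj x y ∧ G.Adj x z

theorem IsCentralPath.reverse (hv : IsCentralPath G v) : IsCentralPath G (fun i => v i.rev) where
  injective := hv.injective.comp Fin.rev_injective
  adj i := (hv.adj_succ (by simp only [Fin.val_rev, Fin.val_succ, Fin.val_castSucc]; omega)).symm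
  dominating x hx := by
    obtain ⟨i, hi⟩ := hv.dominating x (fun ⟨j, hj⟩ => hx ⟨j.rev, by simpa using hj⟩)
    exact ⟨i.rev, by simpa using hi⟩

theorem IsCentralPath.tail {v : Fin (k + 1 + 1) → V} (hv : IsCentralPath G v)
    (h0 : ¬ IsInner G (v 0)) : IsCentralPath G (fun i => v i.succ) where
  injective := hv.injective.comp (Fin.succ_injective _)
  adj i := hv.adj_succ (by simp)
  dominating x hx := by
    by_cases hx0 : x = v 0
    · exact ⟨0, hx0 ▸ (hv.adj_succ (by simp)).symm⟩
    · have hxv : x ∉ Set.range v := by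
        rintro ⟨i, rfl⟩
        obtain ⟨j, rfl⟩ := Fin.exists_succ_eq.2 (fun h : i = 0 => hx0 (by rw [h]))
        exact hx ⟨j, rfl⟩
      obtain ⟨i, hi⟩ := hv.dominating x hxv
      have hi0 : i ≠ 0 := by
        rintro rfl
        exact h0 ⟨x, v 1, fun h => hxv ⟨1, h.symm⟩, hi, hv.adj_succ (by simp)⟩
      obtain ⟨j, rfl⟩ := Fin.exists_succ_eq.2 hi0
      exact ⟨j, hi⟩

variable [Finite V]

/-- If there is a vertex with two neighbours, these vertices form a central path: a shortest
central path consists of them. -/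
theorem exists_centralPath_range_eq (hG : IsCaterpillar G) (h : ∃ x, IsInner G x) :
    ∃ (k : ℕ) (v : Fin (k + 1) → V), IsCentralPath G v ∧ ∀ x, x ∈ Set.range v ↔ IsInner G x := by
  classical
  obtain ⟨hG, hex⟩ := hG
  obtain ⟨k, ⟨v, hv⟩, hmin⟩ : ∃ k, (∃ v : Fin (k + 1) → V, IsCentralPath G v) ∧
      ∀ (k' : ℕ) (v' : Fin (k' + 1) → V), IsCentralPath G v' → k ≤ k' :=
    ⟨Nat.find hex, Nat.find_spec hex, fun k' v' h' => Nat.find_min' hex ⟨v', h'⟩⟩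
  have hson : ∀ x, IsInner G x → x ∈ Set.range v := by
    rintro x ⟨y, z, hyz, hy, hz⟩
    by_contra hx
    exact hyz (((hv.adj_son_iff hG hx).1 hy).trans ((hv.adj_son_iff hG hx).1 hz).symm)
  refine ⟨k, v, hv, fun x => ⟨?_, hson x⟩⟩
  rintro ⟨i, rfl⟩
  cases k with
  | zero =>
    obtain ⟨x, hx⟩ := h
    obtain ⟨j, rfl⟩ := hson x hx
    rwa [show i = j from Fin.ext (by omega)]
  | succ k =>
    have hend : ∀ v' : Fin (k + 1 + 1) → V, IsCentralPath G v' → IsInner G (v' 0) := by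
      intro v' hv'
      by_contra h0
      have := hmin k _ (hv'.tail h0)
      omega
    rcases Nat.eq_zero_or_pos (i : ℕ) with h0 | h0
    · rw [show i = 0 from Fin.ext h0]
      exact hend v hv
    · by_cases h1 : (i : ℕ) = k + 1
      · have := hend _ hv.reverse
        rwa [Fin.rev_zero, show Fin.last (k + 1) = i from Fin.ext h1.symm] at this
      · refine ⟨v ⟨i - 1, by omega⟩, v ⟨i + 1, by omega⟩, fun h => ?_,
          (hv.adj_succ ?_).symm, hv.adj_succ rfl⟩
        · have := congrArg Fin.val (hv.injective h)
          simp only at this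
          omega
        · simp only
          omega

/-- The vertices with two neighbours, and the vertex `u`, form a central path that starts in `u`,
if `u` is a vertex with two neighbours of which at most one has two neighbours, or if there is no
such vertex. -/
theorem exists_centralPath_start (hG : IsCaterpillar G) {u : V}
    (hu : (∀ x, ¬ (IsInner G x ∧
        ∀ y z, G.Adj x y → IsInner G y → G.Adj x z → IsInner G z → y = z)) ∨
      (IsInner G u ∧ ∀ y z, G.Adj u y → IsInner G y → G.Adj u z → IsInner G z → y = z)) :
    ∃ (k : ℕ) (v : Fin (k + 1) → V), IsCentralPath G v ∧ v 0 = u ∧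
      ∀ x, x ∈ Set.range v ↔ x = u ∨ IsInner G x := by
  by_cases h : ∃ x, IsInner G x
  · obtain ⟨k, v, hv, hrange⟩ := exists_centralPath_range_eq hG h
    have hG' := hG.1
    have hu' : IsInner G u ∧ ∀ y z, G.Adj u y → IsInner G y → G.Adj u z → IsInner G z → y = z := by
      refine hu.resolve_left fun hnone => hnone (v 0) ⟨(hrange _).1 ⟨0, rfl⟩, ?_⟩
      intro y z hy hy' hz hz'
      obtain ⟨i, rfl⟩ := (hrange _).2 hy'
      obtain ⟨j, rfl⟩ := (hrange _).2 hz'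
      have h1 := (hv.adj_spine_iff hG').1 hy
      have h2 := (hv.adj_spine_iff hG').1 hz
      simp only [Fin.val_zero] at h1 h2
      rw [show i = j from Fin.ext (by omega)]
    obtain ⟨i, hi⟩ := (hrange u).2 hu'.1
    have hrange' : ∀ x, x ∈ Set.range v ↔ x = u ∨ IsInner G x := fun x => by
      rw [hrange]
      exact ⟨Or.inr, fun h => h.elim (fun h => h ▸ hu'.1) id⟩
    rcases Nat.eq_zero_or_pos (i : ℕ) with h0 | h0
    · exact ⟨k, v, hv, by rw [← hi, show i = 0 from Fin.ext h0], hrange'⟩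
    · have hik : (i : ℕ) = k := by
        by_contra hik
        have h1 : G.Adj u (v ⟨i - 1, by omega⟩) := by
          rw [← hi]
          exact (hv.adj_succ (by simp only; omega)).symm
        have h2 : G.Adj u (v ⟨i + 1, by omega⟩) := by
          rw [← hi]
          exact hv.adj_succ rfl
        have h3 := hu'.2 _ _ h1 ((hrange _).1 ⟨_, rfl⟩) h2 ((hrange _).1 ⟨_, rfl⟩)
        have h4 := congrArg Fin.val (hv.injective h3)
        simp only at h4
        omega
      refine ⟨k, fun i => v i.rev, hv.reverse, ?_, fun x => ?_⟩
      · change v (Fin.rev 0) = u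
        rw [Fin.rev_zero, ← hi, show i = Fin.last k from Fin.ext hik]
      · rw [← hrange']
        constructor
        · rintro ⟨i, rfl⟩
          exact ⟨_, rfl⟩
        · rintro ⟨i, rfl⟩
          exact ⟨i.rev, by simp⟩
  · push Not at h
    have hclosed : ∀ x, x = u ∨ G.Adj u x := by
      intro x
      obtain ⟨w⟩ := hG.1.connected.preconnected u x
      have key : ∀ {a b : V}, G.Walk a b → (a = u ∨ G.Adj u a) → (b = u ∨ G.Adj u b) := by
        intro a b w
        induction w with
        | nil => exact id
        | @cons a c b hab _ ih =>
          rintro (rfl | ha)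
          · exact ih (Or.inr hab)
          · by_cases hc : c = u
            · exact ih (Or.inl hc)
            · exact absurd ⟨c, u, hc, hab, ha.symm⟩ (h a)
      exact key w (Or.inl rfl)
    refine ⟨0, fun _ => u, ⟨fun i j _ => Fin.ext (by omega), fun i => i.elim0, fun x hx => ?_⟩,
      rfl, fun x => ?_⟩
    · exact ⟨0, (hclosed x).resolve_left fun h => hx ⟨0, h.symm⟩⟩
    · constructor
      · rintro ⟨_, rfl⟩
        exact Or.inl rfl
      · rintro (rfl | hx)
        · exact ⟨0, rfl⟩
        · exact absurd hx (h x)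

end Start

/-! ### The order of the vertices in the traversal -/

section Traversal

variable {n : ℕ} {G : SimpleGraph (Fin n)} {k : ℕ} {v : Fin (k + 1) → Fin n}

open scoped Classical in
/-- The vertices are traversed by increasing keys: every vertex of the central path is followed by
its sons, in their numerical order. -/
noncomputable def key (hv : IsCentralPath G v) (x : Fin n) : ℕ :=
  hv.index x * (n + 1) + if x ∈ Set.range v then 0 else (x : ℕ) + 1

/-- The position of a vertex in the traversal, counted from one. -/
noncomputable def position (hv : IsCentralPath G v) (x : Fin n) : ℕ :=
  (Finset.univ.filter fun y => key hv y ≤ key hv x).card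

open scoped Classical in
/-- The rank of a son among its brothers, counted from one, and zero for the vertices of the
central path. -/
noncomputable def sonRank (hv : IsCentralPath G v) (x : Fin n) : ℕ :=
  if x ∈ Set.range v then 0
  else (Finset.univ.filter fun y =>
    y ∉ Set.range v ∧ (hv.index y : ℕ) = hv.index x ∧ key hv y ≤ key hv x).card

theorem key_bounds (hv : IsCentralPath G v) (x : Fin n) :
    hv.index x * (n + 1) ≤ key hv x ∧ key hv x < (hv.index x + 1) * (n + 1) := by
  unfold key
  rw [Nat.succ_mul]
  split_ifs <;> omega

theorem key_lt_iff (hv : IsCentralPath G v) (x : Fin n) (i : ℕ) :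
    key hv x < i * (n + 1) ↔ (hv.index x : ℕ) < i := by
  have h := key_bounds hv x
  constructor
  · intro h'
    exact Nat.lt_of_mul_lt_mul_right (h.1.trans_lt h')
  · intro h'
    exact h.2.trans_le (Nat.mul_le_mul_right _ h')

theorem key_spine (hv : IsCentralPath G v) (i : Fin (k + 1)) : key hv (v i) = i * (n + 1) := by
  have : v i ∈ Set.range v := ⟨i, rfl⟩
  rw [key, if_pos this, hv.index_spine, Nat.add_zero]

theorem key_son (hv : IsCentralPath G v) {x : Fin n} (hx : x ∉ Set.range v) :
    key hv x = hv.index x * (n + 1) + (x + 1) := by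
  rw [key, if_neg hx]

theorem index_le_of_key_le (hv : IsCentralPath G v) {x y : Fin n} (h : key hv x ≤ key hv y) :
    (hv.index x : ℕ) ≤ hv.index y :=
  Nat.lt_succ_iff.1 ((key_lt_iff hv x _).1 (h.trans_lt (key_bounds hv y).2))

theorem key_injective (hv : IsCentralPath G v) : Function.Injective (key hv) := by
  intro x y h
  have h1 : (hv.index x : ℕ) = hv.index y :=
    le_antisymm (index_le_of_key_le hv h.le) (index_le_of_key_le hv h.ge)
  by_cases hx : x ∈ Set.range v <;> by_cases hy : y ∈ Set.range v
  · obtain ⟨i, rfl⟩ := hx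
    obtain ⟨j, rfl⟩ := hy
    rw [hv.index_spine, hv.index_spine] at h1
    rw [Fin.ext h1]
  · rw [key, key, if_pos hx, if_neg hy, h1] at h
    omega
  · rw [key, key, if_neg hx, if_pos hy, h1] at h
    omega
  · rw [key, key, if_neg hx, if_neg hy, h1] at h
    exact Fin.ext (by omega)

theorem position_pos (hv : IsCentralPath G v) (x : Fin n) : 0 < position hv x :=
  Finset.card_pos.2 ⟨x, Finset.mem_filter.2 ⟨Finset.mem_univ _, le_rfl⟩⟩

theorem position_le (hv : IsCentralPath G v) (x : Fin n) : position hv x ≤ n :=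
  (Finset.card_le_univ _).trans_eq (Fintype.card_fin n)

theorem position_lt_position (hv : IsCentralPath G v) {x y : Fin n} (h : key hv x < key hv y) :
    position hv x < position hv y := by
  refine Finset.card_lt_card ⟨fun z hz => ?_, fun h' => ?_⟩
  · rw [Finset.mem_filter] at hz ⊢
    exact ⟨hz.1, hz.2.trans h.le⟩
  · have := h' (Finset.mem_filter.2 ⟨Finset.mem_univ y, le_rfl⟩)
    exact absurd (Finset.mem_filter.1 this).2 (not_le.2 h)

theorem position_injective (hv : IsCentralPath G v) : Function.Injective (position hv) := by
  intro x y h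
  rcases lt_trichotomy (key hv x) (key hv y) with h' | h' | h'
  · exact absurd h (position_lt_position hv h').ne
  · exact key_injective hv h'
  · exact absurd h (position_lt_position hv h').ne'

theorem exists_position_eq (hv : IsCentralPath G v) {q : ℕ} (h1 : 1 ≤ q) (hq : q ≤ n) :
    ∃ x, position hv x = q := by
  have himg : Finset.univ.image (position hv) = Finset.Icc 1 n := by
    refine Finset.eq_of_subset_of_card_le (fun j hj => ?_) ?_
    · obtain ⟨x, -, rfl⟩ := Finset.mem_image.1 hj
      exact Finset.mem_Icc.2 ⟨position_pos hv x, position_le hv x⟩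
    · rw [Finset.card_image_of_injective _ (position_injective hv), Finset.card_univ,
        Fintype.card_fin, Nat.card_Icc]
      omega
  obtain ⟨x, -, hx⟩ := Finset.mem_image.1 (himg ▸ Finset.mem_Icc.2 ⟨h1, hq⟩)
  exact ⟨x, hx⟩

theorem position_eq (hv : IsCentralPath G v) (x : Fin n) :
    position hv x = (Finset.univ.filter fun y => key hv y < key hv x).card + 1 := by
  rw [position, ← Finset.card_insert_of_notMem (a := x)]
  · congr 1
    ext y
    simp only [Finset.mem_filter, Finset.mem_univ, true_and, Finset.mem_insert, le_iff_lt_or_eq]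
    rw [(key_injective hv).eq_iff, or_comm]
  · simp

theorem index_lt_of_position_lt (hv : IsCentralPath G v) {x y : Fin n}
    (h : (hv.index x : ℕ) < hv.index y) : position hv x < position hv y := by
  refine position_lt_position hv (lt_of_not_ge fun h' => ?_)
  have := index_le_of_key_le hv h'
  omega

theorem sonRank_spine (hv : IsCentralPath G v) {x : Fin n} (hx : x ∈ Set.range v) :
    sonRank hv x = 0 := if_pos hx

open scoped Classical in
theorem sonRank_eq (hv : IsCentralPath G v) {x : Fin n} (hx : x ∉ Set.range v) :
    sonRank hv x = (Finset.univ.filter fun y =>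
      y ∉ Set.range v ∧ (hv.index y : ℕ) = hv.index x ∧ key hv y < key hv x).card + 1 := by
  rw [sonRank, if_neg hx, ← Finset.card_insert_of_notMem (a := x)]
  · congr 1
    ext y
    simp only [Finset.mem_filter, Finset.mem_univ, true_and, Finset.mem_insert, le_iff_lt_or_eq]
    rw [(key_injective hv).eq_iff]
    constructor
    · rintro ⟨h1, h2, h3 | h3⟩
      · exact Or.inr ⟨h1, h2, h3⟩
      · exact Or.inl h3
    · rintro (rfl | ⟨h1, h2, h3⟩)
      · exact ⟨hx, rfl, Or.inr rfl⟩
      · exact ⟨h1, h2, Or.inl h3⟩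
  · simp

theorem sonRank_le (hG : G.IsTree) (hv : IsCentralPath G v) (x : Fin n) :
    sonRank hv x ≤ numSons G v (hv.index x) := by
  classical
  rw [numSons_eq_card hG hv, sonRank]
  split_ifs
  · exact Nat.zero_le _
  · refine Finset.card_le_card fun y hy => ?_
    simp only [Finset.mem_filter, Finset.mem_univ, true_and] at hy ⊢
    exact ⟨hy.1, hy.2.1⟩

theorem sonRank_lt_sonRank (hv : IsCentralPath G v) {x y : Fin n} (hx : x ∉ Set.range v)
    (hy : y ∉ Set.range v) (hxy : hv.index x = hv.index y) (h : key hv x < key hv y) :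
    sonRank hv x < sonRank hv y := by
  classical
  rw [sonRank, if_neg hx, sonRank_eq hv hy, Nat.lt_succ_iff]
  refine Finset.card_le_card fun z hz => ?_
  simp only [Finset.mem_filter, Finset.mem_univ, true_and] at hz ⊢
  exact ⟨hz.1, by rw [hz.2.1, hxy], hz.2.2.trans_lt h⟩

theorem sonRank_injOn (hv : IsCentralPath G v) {x y : Fin n} (hx : x ∉ Set.range v)
    (hy : y ∉ Set.range v) (hxy : hv.index x = hv.index y) (h : sonRank hv x = sonRank hv y) :
    x = y := by
  rcases lt_trichotomy (key hv x) (key hv y) with h' | h' | h'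
  · exact absurd h (sonRank_lt_sonRank hv hx hy hxy h').ne
  · exact key_injective hv h'
  · exact absurd h (sonRank_lt_sonRank hv hy hx hxy.symm h').ne'

open scoped Classical in
theorem image_sonRank (hG : G.IsTree) (hv : IsCentralPath G v) (i : Fin (k + 1)) :
    (Finset.univ.filter fun x => x ∉ Set.range v ∧ (hv.index x : ℕ) = i).image (sonRank hv) =
      Finset.Icc 1 (numSons G v i) := by
  refine Finset.eq_of_subset_of_card_le (fun j hj => ?_) ?_
  · obtain ⟨x, hx, rfl⟩ := Finset.mem_image.1 hj
    have hx := (Finset.mem_filter.1 hx).2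
    refine Finset.mem_Icc.2 ⟨?_, hx.2 ▸ sonRank_le hG hv x⟩
    rw [sonRank_eq hv hx.1]
    omega
  · rw [Finset.card_image_of_injOn, Nat.card_Icc, numSons_eq_card hG hv, Nat.add_sub_cancel]
    · exact le_of_eq (by congr)
    · intro x hx y hy hxy
      have hx := (Finset.mem_filter.1 (Finset.mem_coe.1 hx)).2
      have hy := (Finset.mem_filter.1 (Finset.mem_coe.1 hy)).2
      exact sonRank_injOn hv hx.1 hy.1 (Fin.ext (hx.2.trans hy.2.symm)) hxy

theorem exists_sonRank_eq (hG : G.IsTree) (hv : IsCentralPath G v) (i : Fin (k + 1)) {j : ℕ}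
    (hj : j ≤ numSons G v i) : ∃ x, hv.index x = i ∧ sonRank hv x = j := by
  classical
  rcases Nat.eq_zero_or_pos j with rfl | h
  · exact ⟨v i, hv.index_spine i, sonRank_spine hv ⟨i, rfl⟩⟩
  · have := (image_sonRank hG hv i).symm ▸ Finset.mem_Icc.2 ⟨h, hj⟩
    obtain ⟨x, hx, hxj⟩ := Finset.mem_image.1 this
    exact ⟨x, Fin.ext (Finset.mem_filter.1 hx).2.2, hxj⟩

theorem ncard_sonRank_le (hG : G.IsTree) (hv : IsCentralPath G v) (i : Fin (k + 1)) {l : ℕ}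
    (hl : l ≤ numSons G v i) : (sons G v i ∩ {x | sonRank hv x ≤ l}).ncard = l := by
  classical
  have h1 : sons G v i ∩ {x | sonRank hv x ≤ l} = ((Finset.univ.filter fun x =>
      x ∉ Set.range v ∧ (hv.index x : ℕ) = i).filter fun x => sonRank hv x ≤ l :
        Finset (Fin n)) := by
    ext x
    simp only [Set.mem_inter_iff, hv.mem_sons hG, Set.mem_ofPred_eq, Finset.coe_filter,
      Finset.mem_filter, Finset.mem_univ, true_and, Fin.ext_iff]
  have h2 : ((Finset.univ.filter fun x => x ∉ Set.range v ∧ (hv.index x : ℕ) = i).filter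
      fun x => sonRank hv x ≤ l).image (sonRank hv) = Finset.Icc 1 l := by
    ext j
    constructor
    · intro hj
      obtain ⟨x, hx, rfl⟩ := Finset.mem_image.1 hj
      rw [Finset.mem_filter] at hx
      have := image_sonRank hG hv i ▸ Finset.mem_image_of_mem (sonRank hv) hx.1
      exact Finset.mem_Icc.2 ⟨(Finset.mem_Icc.1 this).1, hx.2⟩
    · intro hj
      rw [Finset.mem_Icc] at hj
      have := (image_sonRank hG hv i).symm ▸ Finset.mem_Icc.2 ⟨hj.1, hj.2.trans hl⟩
      obtain ⟨x, hx, rfl⟩ := Finset.mem_image.1 this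
      exact Finset.mem_image_of_mem _ (Finset.mem_filter.2 ⟨hx, hj.2⟩)
  rw [h1, Set.ncard_coe_finset]
  conv_rhs => rw [← Nat.add_sub_cancel (n := l) (m := 1), ← Nat.card_Icc, ← h2]
  refine (Finset.card_image_of_injOn fun x hx y hy hxy => ?_).symm
  have hx := (Finset.mem_filter.1 (Finset.mem_filter.1 (Finset.mem_coe.1 hx)).1).2
  have hy := (Finset.mem_filter.1 (Finset.mem_filter.1 (Finset.mem_coe.1 hy)).1).2
  exact sonRank_injOn hv hx.1 hy.1 (Fin.ext (hx.2.trans hy.2.symm)) hxy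

end Traversal

/-! ### The program: tables, degrees and the start of the path -/

section Preparation

local notation "resultReg" => (1 : ℕ)
local notation "xReg" => (2 : ℕ)
local notation "yReg" => (3 : ℕ)
local notation "curReg" => (4 : ℕ)
local notation "rowArr" => (2 : ℕ)
local notation "degArr" => (3 : ℕ)
local notation "innerDegArr" => (4 : ℕ)
local notation "triArr" => (9 : ℕ)

@[simp] theorem Store.setReg_reg (s : Store) (x c r : ℕ) :
    (s.setReg x c).reg r = if r = x then c else s.reg r := Function.update_apply _ _ _ _

@[simp] theorem Store.setReg_arr (s : Store) (x c : ℕ) : (s.setReg x c).arr = s.arr := rfl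

@[simp] theorem Store.setArr_reg (s : Store) (a p c : ℕ) : (s.setArr a p c).reg = s.reg := rfl

@[simp] theorem Store.setArr_arr (s : Store) (a p c b q : ℕ) :
    (s.setArr a p c).arr b q = if b = a ∧ q = p then c else s.arr b q := by
  simp only [Store.setArr, Function.update_apply]
  split_ifs <;> simp_all

/-- Fills the tables of the multiples of `n` and of the triangular numbers. -/
def tables : Program :=
  .forLoop xReg (.reg 0)
    (.seq
      (.write rowArr (.add (.reg xReg) (.const 1)) (.add (.read rowArr (.reg xReg)) (.reg 0)))
      (.write triArr (.add (.reg xReg) (.const 1)) (.add (.read triArr (.reg xReg)) (.reg xReg))))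

theorem halts_tables {s : Store} {n : ℕ} (hn : s.reg 0 = n) (hrow : s.arr rowArr 0 = 0)
    (htri : s.arr triArr 0 = 0) :
    Halts tables s (n * (16 + 8) + 6) fun s' =>
      ∀ i ≤ n, s'.arr rowArr i = i * n ∧ s'.arr triArr i = i.choose 2 := by
  refine Halts.forLoop_reg
    (fun m s' => ∀ i ≤ m, s'.arr rowArr i = i * n ∧ s'.arr triArr i = i.choose 2)
    (by simp [Program.WritesReg]) (by simp) (by simp [Program.WritesReg]) hn
    (fun _ _ _ h => h) ?_ ?_
  · intro i hi
    obtain rfl := Nat.le_zero.1 hi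
    simp [hrow, htri]
  · intro m _ s' hs' hu hx
    have h0 : s'.reg 0 = n := (hu.reg 0 (by simp [Program.WritesReg, Program.forLoop])).trans hn
    refine Halts.of_exec_le ⟨trivial, trivial⟩ (by decide) ?_
    intro i hi
    simp only [Program.exec, RExpr.eval, Store.setArr_arr, Store.setArr_reg, hx, h0]
    rcases hi.eq_or_lt with rfl | hi
    · have := hs' m le_rfl
      simp [this, choose_two_succ, Nat.succ_mul]
    · have := hs' i (by omega)
      have h1 : i ≠ m + 1 := by omega
      simp [this, h1]

/-- Sums the expression `e` over all values of the register `y`, for every value of the register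
`x`. -/
def accumulate (d : ℕ) (e : RExpr) : Program :=
  .forLoop xReg (.reg 0)
    (.forLoop yReg (.reg 0) (.write d (.reg xReg) (.add (.read d (.reg xReg)) e)))

theorem halts_accumulate {s : Store} {n d : ℕ} {e : RExpr} (f : ℕ → ℕ → ℕ) (hn : s.reg 0 = n)
    (hd : ∀ i, s.arr d i = 0)
    (he : ∀ i < n, ∀ j < n, ∀ s', Unchanged (accumulate d e) s s' → s'.reg xReg = i →
      s'.reg yReg = j → e.eval s' = f i j) :
    Halts (accumulate d e) s (n * (n * (e.cost + 5 + 8) + 6 + 8) + 6) fun s' =>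
      ∀ i < n, s'.arr d i = ∑ j ∈ Finset.range n, f i j := by
  refine (Halts.forLoop_reg
    (fun m s' => ∀ i, s'.arr d i = if i < m then ∑ j ∈ Finset.range n, f i j else 0)
    (by simp [Program.WritesReg, Program.forLoop]) (by simp)
    (by simp [Program.WritesReg, Program.forLoop]) hn (fun _ _ _ h => h) ?_ ?_).mono le_rfl
    fun s' _ hs' i hi => ?_
  · intro i
    simp [hd]
  · intro m hm s' hs' hu hx
    have h0 : s'.reg 0 = n := (hu.reg 0 (by simp [Program.WritesReg, Program.forLoop])).trans hn
    refine (Halts.forLoop_reg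
      (fun l s'' => ∀ i, s''.arr d i =
        if i = m then ∑ j ∈ Finset.range l, f i j else s'.arr d i)
      (by simp [Program.WritesReg]) (by simp)
      (by simp [Program.WritesReg]) h0 (fun _ _ _ h => h) ?_ ?_).mono le_rfl
      fun s'' _ hs'' i => ?_
    · intro i
      split_ifs with h
      · simp [hs', h]
      · rfl
    · intro l hl s'' hs'' hu' hy
      have hx' : s''.reg xReg = m :=
        (hu'.reg _ (by simp [Program.WritesReg, Program.forLoop])).trans hx
      have hev := he m hm l hl s''
        (hu.trans (hu'.mono
          (fun _ h => Or.inr (Or.inl h)) (fun _ h => Or.inr (Or.inl h)))) hx' hy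
      refine Halts.of_exec_le trivial ?_ ?_
      rotate_left
      · intro i
        simp only [Program.exec, RExpr.eval, Store.setArr_arr, hx', hev, true_and, hs'']
        split_ifs with h
        · rw [Finset.sum_range_succ, h]
        · rfl
      · simp only [Program.size, RExpr.cost]
        omega
    · rw [hs'', hs']
      rcases lt_trichotomy i m with h | rfl | h
      · rw [if_neg h.ne, if_pos h, if_pos (by omega)]
      · rw [if_pos rfl, if_pos (by omega)]
      · rw [if_neg h.ne', if_neg (by omega), if_neg (by omega)]
  · rw [hs', if_pos hi]

/-- The entry of the adjacency matrix in row `x` and column `y`. -/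
def adjExpr (x y : ℕ) : RExpr := .read 0 (.add (.read rowArr (.reg x)) (.reg y))

/-- Computes the degrees. -/
def degrees : Program := accumulate degArr (adjExpr xReg yReg)

/-- Computes the numbers of those neighbours that have at least two neighbours themselves. -/
def innerDegrees : Program :=
  accumulate innerDegArr
    (.lt (.const 1) (.add (adjExpr xReg yReg) (.lt (.const 1) (.read degArr (.reg yReg)))))

/-- Chooses a vertex of degree at least two with at most one neighbour of degree at least two. -/
def chooseStart : Program :=
  .forLoop xReg (.reg 0)
    (.ite (.lt (.const 1) (.add (.lt (.const 1) (.read degArr (.reg xReg)))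
        (.lt (.read innerDegArr (.reg xReg)) (.const 2))))
      (.assign curReg (.reg xReg)) .skip)

theorem halts_chooseStart {s : Store} {n : ℕ} (hn : s.reg 0 = n) (hcur : s.reg curReg = 0) :
    Halts chooseStart s (n * (15 + 8) + 6) fun s' =>
      (s'.reg curReg = 0 ∧ ∀ i < n, ¬ (1 < s.arr degArr i ∧ s.arr innerDegArr i < 2)) ∨
      (s'.reg curReg < n ∧ 1 < s.arr degArr (s'.reg curReg) ∧
        s.arr innerDegArr (s'.reg curReg) < 2) := by
  refine Halts.forLoop_reg (fun m s' =>
      (s'.reg curReg = 0 ∧ ∀ i < m, ¬ (1 < s.arr degArr i ∧ s.arr innerDegArr i < 2)) ∨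
      (s'.reg curReg < n ∧ 1 < s.arr degArr (s'.reg curReg) ∧
        s.arr innerDegArr (s'.reg curReg) < 2))
    (by simp [Program.WritesReg]) (by simp) (by simp [Program.WritesReg]) hn
    ?_ (Or.inl ⟨hcur, fun i hi => absurd hi (Nat.not_lt_zero i)⟩) ?_
  · intro i s' c h
    simpa using h
  · intro m hm s' hs' hu hx
    have h1 : s'.arr degArr = s.arr degArr :=
      hu.arr _ (by simp [Program.WritesArr, Program.forLoop])
    have h2 : s'.arr innerDegArr = s.arr innerDegArr :=
      hu.arr _ (by simp [Program.WritesArr, Program.forLoop])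
    refine Halts.of_exec_le ⟨trivial, trivial⟩ (by decide) ?_
    by_cases h3 : 1 < s.arr degArr m ∧ s.arr innerDegArr m < 2
    · simp [Program.exec, RExpr.eval, hx, h1, h2, h3, hm]
    · have h4 : ¬ (1 < (if 1 < s.arr degArr m then 1 else 0) +
          if s.arr innerDegArr m < 2 then 1 else 0) := by
        split_ifs <;> omega
      simp only [Program.exec, RExpr.eval, hx, h1, h2, h4, if_false, ne_eq, not_true_eq_false]
      rcases hs' with h5 | h5
      · refine Or.inl ⟨h5.1, fun i hi => ?_⟩
        rcases (Nat.lt_succ_iff.1 hi).eq_or_lt with rfl | hi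
        · exact h3
        · exact h5.2 i hi
      · exact Or.inr h5

end Preparation

/-! ### The program: traversal of the caterpillar -/

section Walk

local notation "yReg" => (3 : ℕ)
local notation "curReg" => (4 : ℕ)
local notation "nextReg" => (5 : ℕ)
local notation "colReg" => (6 : ℕ)
local notation "countReg" => (7 : ℕ)
local notation "rowArr" => (2 : ℕ)
local notation "degArr" => (3 : ℕ)
local notation "posArr" => (5 : ℕ)
local notation "colArr" => (6 : ℕ)
local notation "rankArr" => (7 : ℕ)
local notation "numArr" => (8 : ℕ)

/-- Gives the next position, in a new column, to the current vertex of the path. -/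
def visitSpine : Program :=
  .seq (.assign colReg (.add (.reg colReg) (.const 1)))
    (.seq (.assign countReg (.add (.reg countReg) (.const 1)))
      (.seq (.write posArr (.reg curReg) (.reg countReg))
        (.seq (.write colArr (.reg countReg) (.reg colReg))
          (.assign nextReg (.reg curReg)))))

/-- Gives the next position to the vertex `y`, which is a son of the current vertex. -/
def visitSon : Program :=
  .seq (.assign countReg (.add (.reg countReg) (.const 1)))
    (.seq (.write posArr (.reg yReg) (.reg countReg))
      (.seq (.write colArr (.reg countReg) (.reg colReg))
        (.seq (.write numArr (.reg colReg) (.add (.read numArr (.reg colReg)) (.const 1)))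
          (.write rankArr (.reg countReg) (.read numArr (.reg colReg))))))

/-- Treats the vertex `y` if it is a neighbour of the current vertex without a position. -/
def visitNeighbour : Program :=
  .ite (.lt (.const 1) (.add (adjExpr curReg yReg)
      (.eq (.read posArr (.reg yReg)) (.const 0))))
    (.ite (.lt (.const 1) (.read degArr (.reg yReg))) (.assign nextReg (.reg yReg)) visitSon)
    .skip

/-- Traverses the caterpillar along the central path. The path ends where no neighbour provides the
next vertex, so that the current vertex, which has a position, is repeated. -/
def walk : Program :=
  .loop (.eq (.read posArr (.reg curReg)) (.const 0))
    (.seq visitSpine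
      (.seq (.forLoop yReg (.reg 0) visitNeighbour) (.assign curReg (.reg nextReg))))

variable {n : ℕ} {G : SimpleGraph (Fin n)} {k : ℕ} {v : Fin (k + 1) → Fin n}

open scoped Classical in
/-- The store after the visit of the vertices whose keys are less than `θ`. The columns of the
vertices are numbered from one. -/
structure WalkState (hv : IsCentralPath G v) (θ : ℕ) (s : Store) : Prop where
  count : s.reg countReg = (Finset.univ.filter fun x => key hv x < θ).card
  pos : ∀ x : Fin n, s.arr posArr x = if key hv x < θ then position hv x else 0
  col : ∀ x, key hv x < θ → s.arr colArr (position hv x) = hv.index x + 1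
  rank : ∀ x, key hv x < θ → s.arr rankArr (position hv x) = sonRank hv x
  zero : ∀ q, q = 0 ∨ s.reg countReg < q → s.arr colArr q = 0 ∧ s.arr rankArr q = 0
  num : ∀ q, s.arr numArr q = (Finset.univ.filter fun x =>
    x ∉ Set.range v ∧ (hv.index x : ℕ) + 1 = q ∧ key hv x < θ).card

/-- No vertex has the key `θ`. -/
theorem WalkState.skip {hv : IsCentralPath G v} {θ : ℕ} {s s' : Store} (h : WalkState hv θ s)
    (hθ : ∀ x, key hv x ≠ θ) (hc : s'.reg countReg = s.reg countReg)
    (hp : ∀ x : Fin n, s'.arr posArr x = s.arr posArr x) (hi : s'.arr colArr = s.arr colArr)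
    (hr : s'.arr rankArr = s.arr rankArr) (hm : s'.arr numArr = s.arr numArr) :
    WalkState hv (θ + 1) s' := by
  have hlt : ∀ x, key hv x < θ + 1 ↔ key hv x < θ := fun x => by
    have := hθ x
    omega
  refine ⟨?_, ?_, ?_, ?_, ?_, ?_⟩
  · simp only [hlt, hc, h.count]
  · simp only [hlt, hp, h.pos, implies_true]
  · simp only [hlt, hi]
    exact h.col
  · simp only [hlt, hr]
    exact h.rank
  · simp only [hc, hi, hr]
    exact h.zero
  · simp only [hlt, hm]
    exact h.num

open scoped Classical in
/-- The vertex `z` with the key `θ` gets the next position. -/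
theorem WalkState.insert {hv : IsCentralPath G v} {θ : ℕ} {s s' : Store} (h : WalkState hv θ s)
    {z : Fin n} (hz : key hv z = θ) (hc : s'.reg countReg = s.reg countReg + 1)
    (hp : ∀ q, s'.arr posArr q = if q = z then s.reg countReg + 1 else s.arr posArr q)
    (hi : ∀ q, s'.arr colArr q =
      if q = s.reg countReg + 1 then (hv.index z : ℕ) + 1 else s.arr colArr q)
    (hr : ∀ q, s'.arr rankArr q =
      if q = s.reg countReg + 1 then sonRank hv z else s.arr rankArr q)
    (hm : ∀ q, s'.arr numArr q =
      s.arr numArr q + if z ∉ Set.range v ∧ (hv.index z : ℕ) + 1 = q then 1 else 0) :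
    WalkState hv (θ + 1) s' := by
  have hlt : ∀ x, key hv x < θ + 1 ↔ x = z ∨ key hv x < θ := fun x => by
    rw [← (key_injective hv).eq_iff, hz]
    omega
  have hpos : position hv z = s.reg countReg + 1 := by
    rw [position_eq, h.count, hz]
  have hne : ∀ x, key hv x < θ → position hv x ≠ s.reg countReg + 1 := fun x hx h' => by
    have h' := position_injective hv (h'.trans hpos.symm)
    rw [h', hz] at hx
    exact lt_irrefl _ hx
  refine ⟨?_, ?_, ?_, ?_, ?_, ?_⟩
  · rw [hc, h.count, ← Finset.card_insert_of_notMem (a := z)]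
    · congr 1
      ext x
      simp only [Finset.mem_insert, Finset.mem_filter, Finset.mem_univ, true_and, hlt]
    · simp [hz]
  · intro x
    rw [hp, h.pos]
    by_cases hx : x = z
    · subst hx
      rw [if_pos rfl, if_pos (by omega), hpos]
    · rw [if_neg (fun h => hx (Fin.ext h))]
      simp only [hlt, hx, false_or]
  · intro x hx
    rw [hi]
    rcases (hlt x).1 hx with rfl | hx
    · rw [if_pos hpos]
    · rw [if_neg (hne x hx), h.col x hx]
  · intro x hx
    rw [hr]
    rcases (hlt x).1 hx with rfl | hx
    · rw [if_pos hpos]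
    · rw [if_neg (hne x hx), h.rank x hx]
  · intro q hq
    have hq' : q ≠ s.reg countReg + 1 := by omega
    rw [hi, hr, if_neg hq', if_neg hq']
    exact h.zero q (by omega)
  · intro q
    rw [hm, h.num]
    split_ifs with hq
    · rw [← Finset.card_insert_of_notMem (a := z)]
      · congr 1
        ext x
        simp only [Finset.mem_insert, Finset.mem_filter, Finset.mem_univ, true_and, hlt]
        constructor
        · rintro (rfl | ⟨h1, h2, h3⟩)
          · exact ⟨hq.1, hq.2, Or.inl rfl⟩
          · exact ⟨h1, h2, Or.inr h3⟩
        · rintro ⟨h1, h2, rfl | h3⟩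
          · exact Or.inl rfl
          · exact Or.inr ⟨h1, h2, h3⟩
      · simp [hz]
    · rw [Nat.add_zero]
      congr 1
      ext x
      simp only [Finset.mem_filter, Finset.mem_univ, true_and, hlt]
      constructor
      · rintro ⟨h1, h2, h3⟩
        exact ⟨h1, h2, Or.inr h3⟩
      · rintro ⟨h1, h2, rfl | h3⟩
        · exact absurd ⟨h1, h2⟩ hq
        · exact ⟨h1, h2, h3⟩

theorem WalkState.pos_eq_zero_iff {hv : IsCentralPath G v} {θ : ℕ} {s : Store}
    (h : WalkState hv θ s) (x : Fin n) : s.arr posArr x = 0 ↔ θ ≤ key hv x := by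
  have := position_pos hv x
  rw [h.pos]
  split_ifs <;> omega

/-- What the traversal uses of the store: the adjacency matrix and the degrees. -/
structure WalkInput (hv : IsCentralPath G v) (s : Store) : Prop where
  n_eq : s.reg 0 = n
  adj : ∀ x y : Fin n, G.Adj x y → s.arr 0 (s.arr rowArr x + y) = 1
  not_adj : ∀ x y : Fin n, ¬ G.Adj x y → s.arr 0 (s.arr rowArr x + y) = 0
  son : ∀ x ∉ Set.range v, s.arr degArr x ≤ 1
  spine : ∀ i, i ≠ 0 → 1 < s.arr degArr (v i)

theorem WalkInput.of_unchanged {hv : IsCentralPath G v} {s s' : Store} (h : WalkInput hv s)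
    (hu : Unchanged walk s s') : WalkInput hv s' := by
  have h0 : s'.reg 0 = s.reg 0 := hu.reg _ (by
    simp [Program.WritesReg, Program.forLoop, walk, visitSpine, visitNeighbour, visitSon])
  have h1 : s'.arr 0 = s.arr 0 := hu.arr _ (by
    simp [Program.WritesArr, Program.forLoop, walk, visitSpine, visitNeighbour, visitSon])
  have h2 : s'.arr rowArr = s.arr rowArr := hu.arr _ (by
    simp [Program.WritesArr, Program.forLoop, walk, visitSpine, visitNeighbour, visitSon])
  have h3 : s'.arr degArr = s.arr degArr := hu.arr _ (by
    simp [Program.WritesArr, Program.forLoop, walk, visitSpine, visitNeighbour, visitSon])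
  exact ⟨h0 ▸ h.n_eq, by rw [h1, h2]; exact h.adj, by rw [h1, h2]; exact h.not_adj,
    by rw [h3]; exact h.son, by rw [h3]; exact h.spine⟩

/-- The store after the first `l` vertices have been examined as neighbours of `v i`. -/
structure NeighbourState (hv : IsCentralPath G v) (i : Fin (k + 1)) (l : ℕ) (s : Store) :
    Prop where
  state : WalkState hv (i * (n + 1) + 1 + l) s
  col : s.reg colReg = i + 1
  cur : s.reg curReg = v i
  next : ∀ j : Fin (k + 1), (i : ℕ) + 1 = j → (v j : ℕ) < l → s.reg nextReg = v j
  next' : (∀ j : Fin (k + 1), (i : ℕ) + 1 = j → l ≤ (v j : ℕ)) → s.reg nextReg = v i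

theorem halts_visitNeighbour (hG : G.IsTree) {hv : IsCentralPath G v} {i : Fin (k + 1)} {l : ℕ}
    {s : Store} (hs : NeighbourState hv i l s) (hin : WalkInput hv s) (hl : l < n)
    (hy : s.reg yReg = l) : Halts visitNeighbour s 41 (NeighbourState hv i (l + 1)) := by
  refine Halts.of_exec_le (by simp [visitNeighbour, visitSon, Program.LoopFree]) (by decide) ?_
  obtain ⟨z, rfl⟩ : ∃ z : Fin n, (z : ℕ) = l := ⟨⟨l, hl⟩, rfl⟩
  have hkey : ∀ x, key hv x = i * (n + 1) + 1 + z ↔ x = z ∧ z ∉ Set.range v ∧ hv.index z = i := by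
    intro x
    constructor
    · intro h
      have h1 : (hv.index x : ℕ) = i := by
        have h2 := (key_lt_iff hv x (i + 1)).1 (by rw [h, Nat.succ_mul]; omega)
        have h3 := (key_lt_iff hv x i).not.1 (by omega)
        omega
      have h2 : x ∉ Set.range v := by
        rintro ⟨j, rfl⟩
        rw [hv.index_spine] at h1
        rw [key_spine, h1] at h
        omega
      rw [key_son hv h2, h1] at h
      obtain rfl : x = z := Fin.ext (by omega)
      exact ⟨rfl, h2, Fin.ext h1⟩
    · rintro ⟨rfl, h1, h2⟩
      rw [key_son hv h1, h2]
      omega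
  have hpos := hs.state.pos_eq_zero_iff z
  by_cases hzson : z ∉ Set.range v ∧ hv.index z = i
  · -- a son of the current vertex
    have hz := (hkey z).2 ⟨rfl, hzson⟩
    have hadj : G.Adj (v i) z := hzson.2 ▸ hv.adj_index hzson.1
    have h1 : s.arr 0 (s.arr rowArr (v i) + z) = 1 := hin.adj _ _ hadj
    have h2 : s.arr posArr z = 0 := hpos.2 hz.ge
    have h3 : ¬ 1 < s.arr degArr z := not_lt.2 (hin.son z hzson.1)
    have hexec : visitNeighbour.exec s = visitSon.exec s := by
      simp [visitNeighbour, adjExpr, Program.exec, RExpr.eval, hy, hs.cur, h1, h2, h3]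
    rw [hexec]
    have hrank : sonRank hv z = s.arr numArr (i + 1) + 1 := by
      rw [sonRank_eq hv hzson.1, hs.state.num]
      congr 3
      ext x
      rw [hz, hzson.2]
      simp only [Nat.add_right_cancel_iff]
    refine ⟨hs.state.insert hz ?_ ?_ ?_ ?_ ?_, ?_, ?_, ?_, ?_⟩
    · simp [visitSon, Program.exec, RExpr.eval]
    · intro q
      simp [visitSon, Program.exec, RExpr.eval, hy]
    · intro q
      simp [visitSon, Program.exec, RExpr.eval, hs.col, hzson.2]
    · intro q
      simp [visitSon, Program.exec, RExpr.eval, hs.col, hrank]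
    · intro q
      simp only [visitSon, Program.exec, RExpr.eval, hs.col, hzson, Store.setArr_arr,
        Store.setReg_arr, Store.setArr_reg, Store.setReg_reg]
      by_cases hq : (i : ℕ) + 1 = q
      · simp [hq]
      · have : ¬ q = i + 1 := fun h => hq h.symm
        simp [hq, this]
    · simpa [visitSon, Program.exec, RExpr.eval] using hs.col
    · simpa [visitSon, Program.exec, RExpr.eval] using hs.cur
    · intro j hj hjl
      have : (visitSon.exec s).reg nextReg = s.reg nextReg := by
        simp [visitSon, Program.exec, RExpr.eval]
      rw [this]
      refine hs.next j hj ?_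
      rcases (Nat.lt_succ_iff.1 hjl).eq_or_lt with h | h
      · exact absurd ⟨j, Fin.ext h⟩ hzson.1
      · exact h
    · intro h
      have : (visitSon.exec s).reg nextReg = s.reg nextReg := by
        simp [visitSon, Program.exec, RExpr.eval]
      rw [this]
      exact hs.next' fun j hj => (Nat.le_succ _).trans (h j hj)
  · have hθ : ∀ x, key hv x ≠ i * (n + 1) + 1 + z := fun x h => hzson ((hkey x).1 h).2
    by_cases hnext : ∃ j : Fin (k + 1), (i : ℕ) + 1 = j ∧ v j = z
    · -- the next vertex of the path
      obtain ⟨j, hij, rfl⟩ := hnext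
      have h1 : s.arr 0 (s.arr rowArr (v i) + v j) = 1 := hin.adj _ _ (hv.adj_succ hij)
      have hkj : i * (n + 1) + 1 + (v j : ℕ) ≤ key hv (v j) := by
        rw [key_spine, ← hij, Nat.succ_mul]
        omega
      have h2 : s.arr posArr (v j) = 0 := hpos.2 hkj
      have h3 : 1 < s.arr degArr (v j) := hin.spine j fun h => by
        rw [h] at hij
        simp at hij
      have hexec : visitNeighbour.exec s = s.setReg nextReg (v j) := by
        simp [visitNeighbour, adjExpr, Program.exec, RExpr.eval, hy, hs.cur, h1, h2, h3]
      rw [hexec]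
      refine ⟨hs.state.skip hθ ?_ ?_ ?_ ?_ ?_, ?_, ?_, ?_, ?_⟩
      all_goals try simp
      · exact hs.col
      · exact hs.cur
      · intro j' hj' _
        rw [show j' = j from Fin.ext (by omega)]
      · intro h
        have := h j hij
        omega
    · -- no vertex to be visited from the current one
      have hcond : ¬ (1 < s.arr 0 (s.arr rowArr (v i) + z) +
          if s.arr posArr z = 0 then 1 else 0) := by
        by_cases hadj : G.Adj (v i) z
        · by_cases hzv : z ∈ Set.range v
          · obtain ⟨j, rfl⟩ := hzv
            have h1 := (hv.adj_spine_iff hG).1 hadj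
            have h2 : (j : ℕ) + 1 = i := h1.resolve_left fun h => hnext ⟨j, h, rfl⟩
            have h3 : ¬ s.arr posArr (v j) = 0 := fun h => by
              have h4 := hpos.1 h
              have h5 := (key_lt_iff hv (v j) i).2 (by rw [hv.index_spine]; omega)
              omega
            rw [if_neg h3, hin.adj _ _ hadj]
            omega
          · refine absurd ⟨hzv, ?_⟩ hzson
            exact (hv.injective ((hv.adj_son_iff hG hzv).1 hadj.symm)).symm
        · rw [hin.not_adj _ _ hadj]
          split_ifs <;> omega
      have hexec : visitNeighbour.exec s = s := by
        simp only [visitNeighbour, adjExpr, Program.exec, RExpr.eval, hy, hs.cur, hcond, if_false,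
          ne_eq, not_true_eq_false]
      rw [hexec]
      refine ⟨hs.state.skip hθ rfl (fun _ => rfl) rfl rfl rfl, hs.col, hs.cur, ?_, ?_⟩
      · intro j hj hjl
        refine hs.next j hj ?_
        rcases (Nat.lt_succ_iff.1 hjl).eq_or_lt with h | h
        · exact absurd ⟨j, hj, Fin.ext h⟩ hnext
        · exact h
      · exact fun h => hs.next' fun j hj => (Nat.le_succ _).trans (h j hj)

/-- The traversal visits all vertices. -/
theorem halts_walk (hG : G.IsTree) (hv : IsCentralPath G v) {s : Store} (hin : WalkInput hv s)
    (hcur : s.reg curReg = v 0) (hcol : s.reg colReg = 0) (hcount : s.reg countReg = 0)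
    (hpos : ∀ q, s.arr posArr q = 0) (hcolArr : ∀ q, s.arr colArr q = 0)
    (hrank : ∀ q, s.arr rankArr q = 0) (hnum : ∀ q, s.arr numArr q = 0) :
    Halts walk s ((k + 1) * (n * (41 + 8) + 31) + 5) fun s' =>
      WalkState hv ((k + 1) * (n + 1)) s' ∧ s'.reg colReg = k + 1 := by
  have hloop := Halts.loop (e := .eq (.read posArr (.reg curReg)) (.const 0))
    (p := .seq visitSpine
      (.seq (.forLoop yReg (.reg 0) visitNeighbour) (.assign curReg (.reg nextReg))))
    (s := s) (B := k + 1) (T := 16 + (n * (41 + 8) + 6 + 2))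
    (fun i s' => WalkState hv (i * (n + 1)) s' ∧ s'.reg colReg = i ∧
      (∀ h : i < k + 1, s'.reg curReg = v ⟨i, h⟩) ∧ (i = k + 1 → s'.reg curReg = v (Fin.last k)))
    ?_ ?_ ?_
  · refine hloop.mono ?_ fun s' _ h => ⟨h.1, h.2.1⟩
    refine Nat.add_le_add (Nat.mul_le_mul_left _ ?_) ?_ <;> simp only [RExpr.cost] <;> omega
  · refine ⟨⟨?_, ?_, ?_, ?_, ?_, ?_⟩, hcol, fun _ => hcur, fun h => by omega⟩
    · simp [hcount]
    · simp [hpos]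
    · simp
    · simp
    · simp [hcolArr, hrank]
    · simp [hnum]
  · rintro i hi s' ⟨hst, hc, hcur', -⟩ hu
    have hin' := hin.of_unchanged (hu.mono (q := walk) (fun _ h => h) (fun _ h => h))
    have hcur' := hcur' hi
    have hk := key_spine hv ⟨i, hi⟩
    simp only at hk
    have h2 : s'.arr posArr (v ⟨i, hi⟩) = 0 := (hst.pos_eq_zero_iff _).2 hk.ge
    refine ⟨?_, ?_⟩
    · simp [RExpr.eval, hcur', h2]
    refine Halts.seq (P := NeighbourState hv ⟨i, hi⟩ 0) (Halts.of_exec_le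
      (by simp [visitSpine, Program.LoopFree]) (by decide) ?_) ?_
    · have hsp := sonRank_spine hv (x := v ⟨i, hi⟩) ⟨_, rfl⟩
      have hsp' : ¬ (v ⟨i, hi⟩ ∉ Set.range v) := fun h => h ⟨_, rfl⟩
      refine ⟨hst.insert hk ?_ ?_ ?_ ?_ ?_, ?_, ?_, ?_, ?_⟩
      · simp [visitSpine, Program.exec, RExpr.eval]
      · intro q
        simp [visitSpine, Program.exec, RExpr.eval, hcur']
      · intro q
        simp [visitSpine, Program.exec, RExpr.eval, hc, hv.index_spine]
      · intro q
        have h : (visitSpine.exec s').arr rankArr q = s'.arr rankArr q := by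
          simp [visitSpine, Program.exec, RExpr.eval]
        rw [h, hsp]
        split_ifs with h
        · exact (hst.zero q (Or.inr (by omega))).2
        · rfl
      · intro q
        simp [visitSpine, Program.exec, RExpr.eval]
      · simp [visitSpine, Program.exec, RExpr.eval, hc]
      · simp [visitSpine, Program.exec, RExpr.eval, hcur']
      · intro j _ h
        exact absurd h (Nat.not_lt_zero _)
      · intro _
        simp [visitSpine, Program.exec, RExpr.eval, hcur']
    · intro s₁ hu₁ hs₁
      have hin₁ := hin'.of_unchanged (hu₁.mono (q := walk) (fun _ h => Or.inl h)
        (fun _ h => Or.inl h))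
      refine Halts.seq (Halts.forLoop_reg (NeighbourState hv ⟨i, hi⟩) ?_ (by simp) ?_ hin₁.n_eq
        ?_ hs₁ ?_) ?_
      · simp [visitNeighbour, visitSon, Program.WritesReg]
      · simp [visitNeighbour, visitSon, Program.WritesReg]
      · rintro l s₂ c ⟨⟨h1, h2, h3, h4, h5, h6⟩, h7, h8, h9, h10⟩
        exact ⟨⟨h1, h2, h3, h4, h5, h6⟩, h7, h8, h9, h10⟩
      · intro l hl s₂ hs₂ hu₂ hy
        exact halts_visitNeighbour hG hs₂ (hin₁.of_unchanged (hu₂.mono (q := walk)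
          (fun _ h => Or.inr (Or.inl h)) (fun _ h => Or.inr (Or.inl h)))) hl hy
      · intro s₂ _ hs₂
        refine Halts.of_exec_le trivial (by decide) ⟨?_, ?_, ?_, ?_⟩
        · obtain ⟨h1, h2, h3, h4, h5, h6⟩ := hs₂.state
          have h : (i + 1) * (n + 1) = i * (n + 1) + 1 + n := by ring
          rw [h]
          exact ⟨h1, h2, h3, h4, h5, h6⟩
        · simpa [Program.exec] using hs₂.col
        · intro h
          simpa [Program.exec, RExpr.eval] using hs₂.next ⟨i + 1, h⟩ rfl (v ⟨i + 1, h⟩).2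
        · intro h
          have h1 : Fin.last k = ⟨i, hi⟩ := Fin.ext (by simp only [Fin.val_last]; omega)
          rw [h1]
          simpa [Program.exec, RExpr.eval] using hs₂.next' fun j hj => by
            have := j.2
            simp only at hj
            omega
  · rintro s' ⟨hst, hc, -, hlast⟩ hu
    have h1 : s'.arr posArr (v (Fin.last k)) ≠ 0 := fun h => by
      have h2 := (hst.pos_eq_zero_iff _).1 h
      have h3 := (key_lt_iff hv (v (Fin.last k)) (k + 1)).2 (Fin.is_lt _)
      omega
    simp [RExpr.eval, hlast rfl, h1]

end Walk

/-! ### The program: evaluation of the dynamic program -/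

section Evaluate

local notation "qReg" => (3 : ℕ)
local notation "colReg" => (6 : ℕ)
local notation "pReg" => (8 : ℕ)
local notation "bestReg" => (9 : ℕ)
local notation "candReg" => (10 : ℕ)
local notation "colArr" => (6 : ℕ)
local notation "rankArr" => (7 : ℕ)
local notation "numArr" => (8 : ℕ)
local notation "triArr" => (9 : ℕ)
local notation "valArr" => (10 : ℕ)
local notation "succArr" => (11 : ℕ)

/-- The values of the dynamic program on columns that are numbered from one, between a source in
column zero and a sink in column `k + 2`. -/
def columnValue (k : ℕ) (m : ℕ → ℕ) : ℕ → ℕ → ℕ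
  | 0, _ => dpValue k m
  | i + 1, j => if i ≤ k then dpTable k m i j else 0

/-- The excess of the load of the point between the columns `i` and `i + 1` over the number of sons
at this point. -/
def extraLoad (k i : ℕ) : ℕ := (if 0 < i then 1 else 0) - (if i = k + 1 then 1 else 0)

/-- The cost of the point between the columns `i` and `i + 1`, if `j` sons of the vertex of column
`i` and `j'` sons of the vertex of column `i + 1` are left sons. -/
def columnCost (k : ℕ) (M : ℕ → ℕ) (i j j' : ℕ) : ℕ := (M i - j + j' + extraLoad k i).choose 2

theorem columnValue_le {k : ℕ} {M : ℕ → ℕ} (h0 : M 0 = 0) (hk : M (k + 2) = 0) {i j j' : ℕ}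
    (hi : i ≤ k + 1) (hj' : j' ≤ M (i + 1)) :
    columnValue k (fun i => M (i + 1)) i j ≤
      columnCost k M i j j' + columnValue k (fun i => M (i + 1)) (i + 1) j' := by
  rcases Nat.eq_zero_or_pos i with rfl | h1
  · have := dpValue_le (k := k) (m := fun i => M (i + 1)) hj'
    simpa [columnValue, columnCost, extraLoad, h0] using this
  · obtain ⟨i, rfl⟩ := Nat.exists_eq_succ_of_ne_zero h1.ne'
    rcases (Nat.lt_succ_iff.1 hi).eq_or_lt with rfl | h2
    · have hk' : M (i.succ + 1) = 0 := hk
      obtain rfl : j' = 0 := by omega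
      simp [columnValue, columnCost, extraLoad, dpTable_last]
    · have h3 : i ≤ k := h2.le
      have h4 : i + 1 ≤ k := h2
      have h5 : i ≠ k := h2.ne
      have := dpTable_le (m := fun i => M (i + 1)) (j := j) h2 hj'
      simpa [columnValue, columnCost, extraLoad, h3, h4, h5] using this

theorem exists_columnValue_eq {k : ℕ} {M : ℕ → ℕ} (h0 : M 0 = 0) {i : ℕ} (j : ℕ)
    (hi : i ≤ k + 1) : ∃ j' ≤ M (i + 1), columnValue k (fun i => M (i + 1)) i j =
      columnCost k M i j j' + columnValue k (fun i => M (i + 1)) (i + 1) j' := by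
  rcases Nat.eq_zero_or_pos i with rfl | h1
  · obtain ⟨j', hj', h⟩ := exists_dpValue_eq (k := k) (m := fun i => M (i + 1))
    refine ⟨j', hj', ?_⟩
    simpa [columnValue, columnCost, extraLoad, h0] using h.symm
  · obtain ⟨i, rfl⟩ := Nat.exists_eq_succ_of_ne_zero h1.ne'
    rcases (Nat.lt_succ_iff.1 hi).eq_or_lt with rfl | h2
    · refine ⟨0, Nat.zero_le _, ?_⟩
      simp [columnValue, columnCost, extraLoad, dpTable_last]
    · have h3 : i ≤ k := h2.le
      have h4 : i + 1 ≤ k := h2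
      have h5 : i ≠ k := h2.ne
      obtain ⟨j', hj', h⟩ := exists_dpTable_eq (m := fun i => M (i + 1)) h2 j
      refine ⟨j', hj', ?_⟩
      simpa [columnValue, columnCost, extraLoad, h3, h4, h5] using h.symm

/-- The positions `0, …, n + 1` are arranged by columns `0, …, k + 2`, and the ranks of the
positions of the column `i` are `0, …, M i`. -/
structure IsLayout (n k : ℕ) (I J M : ℕ → ℕ) : Prop where
  col_zero : I 0 = 0
  rank_zero : J 0 = 0
  num_zero : M 0 = 0
  num_last : M (k + 2) = 0
  col_sink : I (n + 1) = k + 2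
  col_le : ∀ q ≤ n, I q ≤ k + 1
  rank_le : ∀ q ≤ n + 1, J q ≤ M (I q)
  exists_pos : ∀ i ≤ k + 2, ∀ j ≤ M i, ∃ q ≤ n + 1, I q = i ∧ J q = j
  lt : ∀ p ≤ n + 1, ∀ q ≤ n + 1, I q = I p + 1 → p < q
  num_le : ∀ i ≤ k + 1, M i + M (i + 1) + extraLoad k i ≤ n

/-- The cost of the continuation from the position `p` to the position `q`. -/
def posCost (k : ℕ) (I J M : ℕ → ℕ) (p q : ℕ) : ℕ :=
  columnCost k M (I p) (J p) (J q) + columnValue k (fun i => M (i + 1)) (I q) (J q)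

/-- The value at the position `p`. -/
def posValue (k : ℕ) (I J M : ℕ → ℕ) (p : ℕ) : ℕ :=
  columnValue k (fun i => M (i + 1)) (I p) (J p)

variable {n k : ℕ} {I J M : ℕ → ℕ}

theorem IsLayout.posValue_le (h : IsLayout n k I J M) {p q : ℕ} (hp : p ≤ n) (hq : q ≤ n + 1)
    (hpq : I q = I p + 1) : posValue k I J M p ≤ posCost k I J M p q := by
  have h1 := h.rank_le q hq
  rw [hpq] at h1
  have := columnValue_le h.num_zero h.num_last (j := J p) (h.col_le p hp) h1
  rwa [← hpq] at this

theorem IsLayout.exists_posCost_eq (h : IsLayout n k I J M) {p : ℕ} (hp : p ≤ n) :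
    ∃ q ≤ n + 1, I q = I p + 1 ∧ posCost k I J M p q = posValue k I J M p := by
  have h1 := h.col_le p hp
  obtain ⟨j', hj', h2⟩ := exists_columnValue_eq h.num_zero (J p) h1
  obtain ⟨q, hq, h3, h4⟩ := h.exists_pos (I p + 1) (by omega) j' hj'
  refine ⟨q, hq, h3, ?_⟩
  rw [posCost, posValue, h2, h3, h4]

/-- The cost of the continuation from `p` to `q`, read off the tables. -/
def costExpr : RExpr :=
  .add (.read triArr (.add (.add (.sub (.read numArr (.read colArr (.reg pReg)))
        (.read rankArr (.reg pReg))) (.read rankArr (.reg qReg)))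
      (.sub (.lt (.const 0) (.read colArr (.reg pReg)))
        (.eq (.read colArr (.reg pReg)) (.reg colReg)))))
    (.read valArr (.reg qReg))

/-- Compares the continuation from `p` to `q` with the best one so far. The register of the best
cost holds the cost plus one, and zero as long as there is no continuation. -/
def tryContinuation : Program :=
  .ite (.eq (.read colArr (.reg qReg)) (.add (.read colArr (.reg pReg)) (.const 1)))
    (.seq (.assign candReg (.add costExpr (.const 1)))
      (.ite (.add (.eq (.reg bestReg) (.const 0)) (.lt (.reg candReg) (.reg bestReg)))
        (.seq (.assign bestReg (.reg candReg)) (.write succArr (.reg pReg) (.reg qReg)))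
        .skip))
    .skip

/-- Finds the value of, and the best continuation from, all positions in decreasing order. -/
def evaluate : Program :=
  .seq (.assign pReg (.add (.reg 0) (.const 1)))
    (.loop (.reg pReg)
      (.seq (.assign pReg (.sub (.reg pReg) (.const 1)))
        (.seq (.assign bestReg (.const 0))
          (.seq (.forLoop qReg (.add (.reg 0) (.const 2)) tryContinuation)
            (.write valArr (.reg pReg) (.sub (.reg bestReg) (.const 1)))))))

/-- What the evaluation uses of the store. -/
structure EvalInput (n k : ℕ) (I J M : ℕ → ℕ) (s : Store) : Prop where
  n_eq : s.reg 0 = n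
  last : s.reg colReg = k + 1
  col : s.arr colArr = I
  rank : s.arr rankArr = J
  num : s.arr numArr = M
  tri : ∀ i ≤ n, s.arr triArr i = i.choose 2

theorem EvalInput.of_unchanged {s s' : Store} (h : EvalInput n k I J M s)
    (hu : Unchanged evaluate s s') : EvalInput n k I J M s' := by
  have hr : ∀ r, r = 0 ∨ r = colReg → s'.reg r = s.reg r := fun r hr => hu.reg _ (by
    rcases hr with rfl | rfl <;>
      simp [Program.WritesReg, Program.forLoop, evaluate, tryContinuation])
  have ha : ∀ a, a = colArr ∨ a = rankArr ∨ a = numArr ∨ a = triArr → s'.arr a = s.arr a :=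
    fun a ha => hu.arr _ (by
      rcases ha with rfl | rfl | rfl | rfl <;>
        simp [Program.WritesArr, Program.forLoop, evaluate, tryContinuation])
  exact ⟨by rw [hr 0 (by simp), h.n_eq], by rw [hr colReg (by simp), h.last],
    by rw [ha colArr (by simp), h.col], by rw [ha rankArr (by simp), h.rank],
    by rw [ha numArr (by simp), h.num], by rw [ha triArr (by simp)]; exact h.tri⟩

theorem eval_costExpr {s : Store} (hL : IsLayout n k I J M) (hin : EvalInput n k I J M s) {p q : ℕ}
    (hp : s.reg pReg = p) (hq : s.reg qReg = q) (hpn : p ≤ n) (hqn : q ≤ n + 1)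
    (hpq : I q = I p + 1) (hval : s.arr valArr q = posValue k I J M q) :
    costExpr.eval s = posCost k I J M p q := by
  have h1 : M (I p) - J p + J q + extraLoad k (I p) ≤ n := by
    have h2 := hL.rank_le q hqn
    rw [hpq] at h2
    have h3 := hL.num_le (I p) (hL.col_le p hpn)
    omega
  have h2 := hin.tri _ h1
  simp only [costExpr, RExpr.eval, hp, hq, hin.col, hin.rank, hin.num, hin.last, hval, posCost,
    columnCost, posValue]
  rw [← h2]
  rfl

/-- The store after the comparison of the continuations from `p` to the positions below `l`. The
array `C` holds the best continuations from the other positions. -/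
structure BestState (k : ℕ) (I J M C : ℕ → ℕ) (p l : ℕ) (s : Store) : Prop where
  le : ∀ q < l, I q = I p + 1 → s.reg bestReg ≠ 0 ∧ s.reg bestReg ≤ posCost k I J M p q + 1
  eq : s.reg bestReg ≠ 0 → s.arr succArr p < l ∧ I (s.arr succArr p) = I p + 1 ∧
    s.reg bestReg = posCost k I J M p (s.arr succArr p) + 1
  other : ∀ p' ≠ p, s.arr succArr p' = C p'

theorem halts_tryContinuation {C : ℕ → ℕ} {s : Store} (hL : IsLayout n k I J M)
    (hin : EvalInput n k I J M s) {p l : ℕ} (hp : s.reg pReg = p) (hl : s.reg qReg = l)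
    (hpn : p ≤ n) (hln : l ≤ n + 1)
    (hval : ∀ q, p < q → q ≤ n + 1 → s.arr valArr q = posValue k I J M q)
    (hs : BestState k I J M C p l s) :
    Halts tryContinuation s 60 (BestState k I J M C p (l + 1)) := by
  refine Halts.of_exec_le (by simp [tryContinuation, Program.LoopFree]) (by decide) ?_
  by_cases hcol : I l = I p + 1
  · have hcost := eval_costExpr hL hin hp hl hpn hln hcol
      (hval l (hL.lt p (by omega) l hln hcol) hln)
    by_cases hbest : s.reg bestReg = 0 ∨ posCost k I J M p l + 1 < s.reg bestReg
    · have hexec : tryContinuation.exec s =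
          ((s.setReg candReg (posCost k I J M p l + 1)).setReg bestReg
            (posCost k I J M p l + 1)).setArr succArr p l := by
        rcases hbest with h1 | h1 <;>
          simp [tryContinuation, Program.exec, RExpr.eval, hp, hl, hin.col, hcol, hcost, h1]
      rw [hexec]
      refine ⟨?_, ?_, ?_⟩
      · intro q hq hq'
        simp only [Store.setArr_reg, Store.setReg_reg, if_true]
        refine ⟨Nat.succ_ne_zero _, ?_⟩
        rcases (Nat.lt_succ_iff.1 hq).eq_or_lt with rfl | hq
        · exact le_rfl
        · have := hs.le q hq hq'
          omega
      · intro _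
        simp [hcol]
      · intro p' hp'
        simp [hp', hs.other p' hp']
    · have hexec : tryContinuation.exec s = s.setReg candReg (posCost k I J M p l + 1) := by
        have h1 : ¬ s.reg bestReg = 0 := fun h => hbest (Or.inl h)
        have h2 : ¬ posCost k I J M p l + 1 < s.reg bestReg := fun h => hbest (Or.inr h)
        simp [tryContinuation, Program.exec, RExpr.eval, hp, hl, hin.col, hcol, hcost, h1,
          not_lt.1 h2]
      rw [hexec]
      refine ⟨?_, ?_, ?_⟩
      · intro q hq hq'
        rw [show (s.setReg candReg (posCost k I J M p l + 1)).reg bestReg = s.reg bestReg by simp]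
        rcases (Nat.lt_succ_iff.1 hq).eq_or_lt with rfl | hq
        · omega
        · exact hs.le q hq hq'
      · intro h
        rw [show (s.setReg candReg (posCost k I J M p l + 1)).reg bestReg = s.reg bestReg by simp]
          at h ⊢
        have := hs.eq h
        exact ⟨this.1.trans (Nat.lt_succ_self _), this.2⟩
      · exact hs.other
  · have hexec : tryContinuation.exec s = s := by
      simp [tryContinuation, Program.exec, RExpr.eval, hp, hl, hin.col, hcol]
    rw [hexec]
    refine ⟨?_, ?_, hs.other⟩
    · intro q hq hq'
      rcases (Nat.lt_succ_iff.1 hq).eq_or_lt with rfl | hq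
      · exact absurd hq' hcol
      · exact hs.le q hq hq'
    · intro h
      have := hs.eq h
      exact ⟨this.1.trans (Nat.lt_succ_self _), this.2⟩

theorem halts_evaluate {s : Store} (hL : IsLayout n k I J M) (hin : EvalInput n k I J M s)
    (hsink : s.arr valArr (n + 1) = 0) :
    Halts evaluate s ((n + 1) * ((n + 2) * (60 + 10) + 21) + 6) fun s' =>
      ∀ q ≤ n, s'.arr valArr q = posValue k I J M q ∧ s'.arr succArr q ≤ n + 1 ∧
        I (s'.arr succArr q) = I q + 1 ∧
        posCost k I J M q (s'.arr succArr q) = posValue k I J M q := by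
  have h1 : Halts (.assign pReg (.add (.reg 0) (.const 1))) s 4
      (fun s' => s' = s.setReg pReg (n + 1)) :=
    Halts.of_exec_le trivial (by decide) (by simp [Program.exec, RExpr.eval, hin.n_eq])
  have h2 := h1.seq (q := .loop (.reg pReg)
      (.seq (.assign pReg (.sub (.reg pReg) (.const 1)))
        (.seq (.assign bestReg (.const 0))
          (.seq (.forLoop qReg (.add (.reg 0) (.const 2)) tryContinuation)
            (.write valArr (.reg pReg) (.sub (.reg bestReg) (.const 1)))))))
    (U := (n + 1) * ((4 + (2 + (((n + 2) * (60 + 3 + 7) + (3 + 5)) + 5))) + 1 + 1) + (1 + 1))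
    (Q := fun s' => s'.reg pReg = n + 1 - (n + 1) ∧ ∀ q, n + 1 ≤ q + (n + 1) → q ≤ n + 1 →
      s'.arr valArr q = posValue k I J M q ∧ (q ≤ n → s'.arr succArr q ≤ n + 1 ∧
        I (s'.arr succArr q) = I q + 1 ∧
        posCost k I J M q (s'.arr succArr q) = posValue k I J M q)) ?_
  · refine h2.mono (le_of_eq (by ring)) fun s' _ h q hq => ?_
    have := h.2 q (by omega) (by omega)
    exact ⟨this.1, this.2 hq⟩
  rintro s₁ hu₁ rfl
  have hin₁ := hin.of_unchanged (hu₁.mono (q := evaluate) (fun _ => Or.inl) (fun _ => Or.inl))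
  refine Halts.loop (e := .reg pReg) (fun i s' => s'.reg pReg = n + 1 - i ∧
    ∀ q, n + 1 ≤ q + i → q ≤ n + 1 →
      s'.arr valArr q = posValue k I J M q ∧ (q ≤ n → s'.arr succArr q ≤ n + 1 ∧
        I (s'.arr succArr q) = I q + 1 ∧
        posCost k I J M q (s'.arr succArr q) = posValue k I J M q)) ?_ ?_ ?_
  · refine ⟨by simp, fun q hq hq' => ?_⟩
    obtain rfl : q = n + 1 := by omega
    refine ⟨?_, fun h => by omega⟩
    simp [hsink, posValue, hL.col_sink, columnValue]
  · rintro i hi s₂ ⟨hp₂, hs₂⟩ hu₂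
    have hin₂ := hin₁.of_unchanged (hu₂.mono (q := evaluate) (fun _ => Or.inr) (fun _ => Or.inr))
    refine ⟨by simp only [RExpr.eval]; omega, ?_⟩
    obtain ⟨p, hp⟩ : ∃ p, p = n - i := ⟨_, rfl⟩
    have hsub : n + 1 - i - 1 = p := by omega
    refine Halts.seq (P := fun s' => s' = s₂.setReg pReg p) (Halts.of_exec_le trivial
      (by decide) (by simp [Program.exec, RExpr.eval, hp₂, hsub])) ?_
    rintro s₃ hu₃ rfl
    refine Halts.seq (P := fun s' => s' = (s₂.setReg pReg p).setReg bestReg 0)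
      (Halts.of_exec_le trivial (by decide) (by simp [Program.exec, RExpr.eval])) ?_
    rintro s₄ hu₄ rfl
    have hin₄ := (hin₂.of_unchanged (hu₃.mono (q := evaluate)
      (fun _ h => Or.inr (Or.inl h)) (fun _ h => Or.inr (Or.inl h)))).of_unchanged
      (hu₄.mono (q := evaluate)
      (fun _ h => Or.inr (Or.inr (Or.inl h))) (fun _ h => Or.inr (Or.inr (Or.inl h))))
    refine Halts.seq (P := fun s' => BestState k I J M (s₂.arr succArr) p (n + 2) s' ∧
      s'.reg pReg = p ∧ s'.arr valArr = s₂.arr valArr) ?_ ?_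
    · refine (Halts.forLoop (B := n + 2) (BestState k I J M (s₂.arr succArr) p) ?_ ?_ ?_ ?_
        (T := 60) ?_).mono (le_of_eq rfl) ?_
      · simp [tryContinuation, Program.WritesReg]
      · rintro l s' c ⟨h1, h2, h3⟩
        exact ⟨by simpa using h1, by simpa using h2, by simpa using h3⟩
      · exact ⟨fun q hq => absurd hq (Nat.not_lt_zero q), fun h => absurd rfl h, fun _ _ => rfl⟩
      · intro s' hu'
        have hin' := hin₄.of_unchanged (hu'.mono (q := evaluate)
          (fun _ h => Or.inr (Or.inr (Or.inr (Or.inl h))))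
          (fun _ h => Or.inr (Or.inr (Or.inr (Or.inl h)))))
        simp only [RExpr.eval, hin'.n_eq]
      · intro l hl s' hs' hu' hq
        have hin' := hin₄.of_unchanged (hu'.mono (q := evaluate)
          (fun _ h => Or.inr (Or.inr (Or.inr (Or.inl h))))
          (fun _ h => Or.inr (Or.inr (Or.inr (Or.inl h)))))
        have hp' := hu'.reg pReg (by simp [Program.WritesReg, Program.forLoop, tryContinuation])
        have hv' := hu'.arr valArr (by simp [Program.WritesArr, Program.forLoop, tryContinuation])
        refine halts_tryContinuation hL hin' (by simp [hp']) hq (by omega) (by omega) ?_ hs'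
        intro q hq hqn
        rw [hv']
        exact (hs₂ q (by omega) hqn).1
      · intro s' hu' hs'
        have hp' := hu'.reg pReg (by simp [Program.WritesReg, Program.forLoop, tryContinuation])
        have hv' := hu'.arr valArr (by simp [Program.WritesArr, Program.forLoop, tryContinuation])
        exact ⟨hs', by simp [hp'], by simp [hv']⟩
    · rintro s₅ hu₅ ⟨hs₅, hp₅, hv₅⟩
      refine Halts.of_exec_le trivial (by decide) ?_
      have hexec : Program.exec (.write valArr (.reg pReg) (.sub (.reg bestReg) (.const 1))) s₅ =
          s₅.setArr valArr p (s₅.reg bestReg - 1) := by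
        simp [Program.exec, RExpr.eval, hp₅]
      rw [hexec]
      refine ⟨by simp [hp₅]; omega, fun q hq hqn => ?_⟩
      by_cases hqp : q = p
      · subst hqp
        obtain ⟨r, hr, hr1, hr2⟩ := hL.exists_posCost_eq (p := q) (by omega)
        have h3 := hs₅.le r (by omega) hr1
        have h4 := hs₅.eq h3.1
        have h5 := hL.posValue_le (p := q) (by omega) (by omega : s₅.arr succArr q ≤ n + 1) h4.2.1
        simp only [Store.setArr_arr, and_true, if_true]
        rw [if_neg (by decide)]
        exact ⟨by omega, fun _ => ⟨by omega, h4.2.1, by omega⟩⟩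
      · have h3 := hs₂ q (by omega) hqn
        have h4 := hs₅.other q hqp
        simpa [hqp, hv₅, h4] using h3
  · rintro s' ⟨h, -⟩ _
    simp only [RExpr.eval, h, Nat.sub_self]

end Evaluate

/-! ### The layout of a caterpillar -/

section Layout

variable {n : ℕ} {G : SimpleGraph (Fin n)} {k : ℕ} {v : Fin (k + 1) → Fin n}

/-- The columns, the ranks and the numbers of sons of a caterpillar, with a source in column zero
and a sink in column `k + 2`. -/
structure IsLayoutOf (hv : IsCentralPath G v) (I J M : ℕ → ℕ) : Prop where
  col : ∀ x, I (position hv x) = hv.index x + 1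
  rank : ∀ x, J (position hv x) = sonRank hv x
  source : I 0 = 0 ∧ J 0 = 0
  sink : I (n + 1) = k + 2 ∧ J (n + 1) = 0
  num_zero : M 0 = 0
  num : ∀ i, M (i + 1) = numSons G v i

theorem IsLayoutOf.isLayout {hv : IsCentralPath G v} {I J M : ℕ → ℕ} (hG : G.IsTree)
    (h : IsLayoutOf hv I J M) : IsLayout n k I J M := by
  have hlast : M (k + 2) = 0 := by
    rw [h.num, numSons, dif_neg (lt_irrefl _)]
  have hcases : ∀ q ≤ n + 1, q = 0 ∨ q = n + 1 ∨ ∃ x, position hv x = q := fun q hq => by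
    by_cases h0 : q = 0
    · exact Or.inl h0
    by_cases h1 : q = n + 1
    · exact Or.inr (Or.inl h1)
    · exact Or.inr (Or.inr (exists_position_eq hv (by omega) (by omega)))
  have hcol : ∀ q ≤ n, I q ≤ k + 1 := fun q hq => by
    rcases hcases q (by omega) with rfl | rfl | ⟨x, rfl⟩
    · simp [h.source]
    · omega
    · rw [h.col]
      exact Nat.succ_le_succ (Nat.lt_succ_iff.1 (hv.index x).2)
  have hcol0 : ∀ q ≤ n + 1, I q = 0 → q = 0 := fun q hq hq' => by
    rcases hcases q hq with rfl | rfl | ⟨x, rfl⟩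
    · rfl
    · rw [h.sink.1] at hq'
      omega
    · rw [h.col] at hq'
      omega
  refine ⟨h.source.1, h.source.2, h.num_zero, hlast, h.sink.1, hcol, ?_, ?_, ?_, ?_⟩
  · intro q hq
    rcases hcases q hq with rfl | rfl | ⟨x, rfl⟩
    · simp [h.source]
    · simp [h.sink]
    · rw [h.col, h.rank, h.num]
      exact sonRank_le hG hv x
  · intro i hi j hj
    rcases Nat.eq_zero_or_pos i with rfl | h0
    · rw [h.num_zero] at hj
      exact ⟨0, Nat.zero_le _, h.source.1, by rw [h.source.2]; omega⟩
    · obtain ⟨i, rfl⟩ := Nat.exists_eq_succ_of_ne_zero h0.ne'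
      by_cases h1 : i = k + 1
      · subst h1
        rw [show (k + 1).succ = k + 2 from rfl, hlast] at hj
        exact ⟨n + 1, le_rfl, h.sink.1, by rw [h.sink.2]; omega⟩
      · rw [Nat.succ_eq_add_one, h.num] at hj
        obtain ⟨x, hx, hxj⟩ := exists_sonRank_eq hG hv ⟨i, by omega⟩ hj
        exact ⟨position hv x, (position_le hv x).trans (Nat.le_succ n), by rw [h.col, hx],
          by rw [h.rank, hxj]⟩
  · intro p hp q hq hpq
    rcases hcases q hq with rfl | rfl | ⟨y, rfl⟩
    · rw [h.source.1] at hpq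
      omega
    · refine lt_of_le_of_ne hp fun hp' => ?_
      rw [hp', h.sink.1] at hpq
      omega
    · rcases hcases p hp with rfl | rfl | ⟨x, rfl⟩
      · exact position_pos hv y
      · have := hcol _ (position_le hv y)
        rw [hpq, h.sink.1] at this
        omega
      · rw [h.col, h.col] at hpq
        exact index_lt_of_position_lt hv (by omega)
  · intro i hi
    have hcard := card_eq_sum_numSons hG hv
    rw [Fintype.card_fin] at hcard
    have hsingle : ∀ i ≤ k, numSons G v i ≤ ∑ i ∈ Finset.range (k + 1), numSons G v i :=
      fun i hi => Finset.single_le_sum (fun _ _ => Nat.zero_le _)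
        (Finset.mem_range.2 (Nat.lt_succ_iff.2 hi))
    have hextra : extraLoad k i ≤ 1 := by
      rw [extraLoad]
      split_ifs <;> omega
    rcases Nat.eq_zero_or_pos i with rfl | h0
    · have := hsingle 0 (Nat.zero_le k)
      rw [h.num_zero, h.num]
      omega
    · obtain ⟨i, rfl⟩ : ∃ j, i = j + 1 := ⟨i - 1, by omega⟩
      rcases (Nat.lt_succ_iff.1 hi).eq_or_lt with rfl | h1
      · have := hsingle i le_rfl
        rw [hlast, h.num]
        omega
      · have hpair : ∑ j ∈ ({i, i + 1} : Finset ℕ), numSons G v j ≤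
            ∑ j ∈ Finset.range (k + 1), numSons G v j := by
          refine Finset.sum_le_sum_of_subset fun j hj => ?_
          rw [Finset.mem_insert, Finset.mem_singleton] at hj
          exact Finset.mem_range.2 (by omega)
        rw [Finset.sum_pair (by omega : i ≠ i + 1)] at hpair
        rw [h.num, h.num]
        omega

/-- After the traversal, the arrays hold the layout except for the column of the sink. -/
theorem WalkState.isLayoutOf {hv : IsCentralPath G v} {s : Store} (hG : G.IsTree)
    (h : WalkState hv ((k + 1) * (n + 1)) s) :
    IsLayoutOf hv (Function.update (s.arr 6) (n + 1) (k + 2)) (s.arr 7) (s.arr 8) ∧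
      ∀ x : Fin n, s.arr 5 x = position hv x := by
  classical
  have hkey : ∀ x, key hv x < (k + 1) * (n + 1) := fun x =>
    (key_lt_iff hv x (k + 1)).2 (hv.index x).2
  have hcount : s.reg 7 = n := by
    rw [h.count]
    simp [hkey]
  refine ⟨⟨fun x => ?_, fun x => h.rank x (hkey x), ?_, ?_, ?_, fun i => ?_⟩, fun x => ?_⟩
  · rw [Function.update_of_ne, h.col x (hkey x)]
    have := position_le hv x
    omega
  · rw [Function.update_of_ne (Nat.succ_ne_zero n).symm]
    exact h.zero 0 (Or.inl rfl)
  · exact ⟨Function.update_self _ _ _, (h.zero (n + 1) (Or.inr (by omega))).2⟩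
  · rw [h.num]
    simp
  · rw [h.num, numSons_eq_card hG hv]
    simp [hkey]
  · rw [h.pos, if_pos (hkey x)]

end Layout

/-! ### The program: the choices -/

section Follow

local notation "resultReg" => (1 : ℕ)
local notation "colReg" => (6 : ℕ)
local notation "pReg" => (8 : ℕ)
local notation "colArr" => (6 : ℕ)
local notation "rankArr" => (7 : ℕ)
local notation "valArr" => (10 : ℕ)
local notation "succArr" => (11 : ℕ)
local notation "leftArr" => (12 : ℕ)

/-- Follows the best continuations from the source to the last column, and records the ranks of the
positions on the way as the numbers of left sons. -/
def follow : Program :=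
  .seq (.assign resultReg (.read valArr (.const 0)))
    (.seq (.assign pReg (.const 0))
      (.loop (.lt (.read colArr (.reg pReg)) (.reg colReg))
        (.seq (.assign pReg (.read succArr (.reg pReg)))
          (.write leftArr (.read colArr (.reg pReg)) (.read rankArr (.reg pReg))))))

variable {n k : ℕ} {I J M : ℕ → ℕ}

/-- The choices `L 1, …, L i` attain the minima in the columns `0, …, i - 1`. -/
def AttainsUpTo (k : ℕ) (M L : ℕ → ℕ) (i : ℕ) : Prop :=
  ∀ i' < i, L (i' + 1) ≤ M (i' + 1) ∧
    columnCost k M i' (L i') (L (i' + 1)) +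
        columnValue k (fun i => M (i + 1)) (i' + 1) (L (i' + 1)) =
      columnValue k (fun i => M (i + 1)) i' (L i')

/-- Columns are numbered from one, and the choices from zero. -/
theorem AttainsUpTo.isDPChoice {L : ℕ → ℕ} (hM : M 0 = 0) (hL : L 0 = 0)
    (h : AttainsUpTo k M L (k + 1)) :
    IsDPChoice k (fun i => M (i + 1)) (fun i : Fin (k + 1) => L (i + 1)) := by
  refine ⟨fun i => (h i i.2).1, ?_, fun i => ?_⟩
  · have := (h 0 k.succ_pos).2
    simpa [columnCost, columnValue, extraLoad, hM, hL] using this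
  · have h1 := (h (i + 1) (by omega)).2
    have h2 : (i : ℕ) + 1 ≤ k := i.2
    have h3 : (i : ℕ) ≤ k := i.2.le
    have h4 : (i : ℕ) ≠ k := i.2.ne
    simpa [columnCost, columnValue, extraLoad, h2, h3, h4] using h1

theorem halts_follow {s : Store} (hL : IsLayout n k I J M) (hlast : s.reg colReg = k + 1)
    (hI : s.arr colArr = I) (hJ : s.arr rankArr = J) (hleft : s.arr leftArr 0 = 0)
    (hval : ∀ q ≤ n, s.arr valArr q = posValue k I J M q ∧ s.arr succArr q ≤ n + 1 ∧
      I (s.arr succArr q) = I q + 1 ∧ posCost k I J M q (s.arr succArr q) = posValue k I J M q) :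
    Halts follow s ((k + 1) * 13 + 10) fun s' =>
      s'.reg resultReg = dpValue k (fun i => M (i + 1)) ∧ s'.arr leftArr 0 = 0 ∧
        AttainsUpTo k M (s'.arr leftArr) (k + 1) := by
  refine Halts.mono (T := 3 + (2 + ((k + 1) * (8 + 4 + 1) + (4 + 1)))) ?_ (by omega)
    fun _ _ h => h
  have h0 := (hval 0 (Nat.zero_le n)).1
  rw [posValue, hL.col_zero, columnValue] at h0
  refine Halts.seq (P := fun s' => s' = s.setReg resultReg (dpValue k fun i => M (i + 1)))
    (Halts.of_exec_le trivial (by decide) (by simp [Program.exec, RExpr.eval, h0])) ?_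
  rintro s₁ - rfl
  refine Halts.seq (P := fun s' => s' = (s.setReg resultReg
      (dpValue k fun i => M (i + 1))).setReg pReg 0)
    (Halts.of_exec_le trivial (by decide) (by simp [Program.exec, RExpr.eval])) ?_
  rintro s₂ - rfl
  refine (Halts.loop (B := k + 1) (T := 8) (e := .lt (.read colArr (.reg pReg)) (.reg colReg))
    (fun i s' => s'.reg pReg ≤ n ∧ I (s'.reg pReg) = i ∧ s'.arr leftArr i = J (s'.reg pReg) ∧
      s'.arr leftArr 0 = 0 ∧ AttainsUpTo k M (s'.arr leftArr) i) ?_ ?_ ?_).mono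
      (by simp only [RExpr.cost]; omega) ?_
  · refine ⟨by simp, by simp [hL.col_zero], by simp [hL.rank_zero, hleft], by simp [hleft], ?_⟩
    exact fun i' hi' => absurd hi' (Nat.not_lt_zero i')
  · rintro i hi s' ⟨h1, h2, h3, h4, h5⟩ hu
    have hI' : s'.arr colArr = I := (hu.arr _ (by simp [Program.WritesArr])).trans (by simp [hI])
    have hJ' : s'.arr rankArr = J := (hu.arr _ (by simp [Program.WritesArr])).trans (by simp [hJ])
    have hS' : s'.arr succArr = s.arr succArr :=
      (hu.arr _ (by simp [Program.WritesArr])).trans (by simp)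
    have hlast' : s'.reg colReg = k + 1 :=
      (hu.reg _ (by simp [Program.WritesReg])).trans (by simp [hlast])
    refine ⟨by simp [RExpr.eval, hI', hlast', h2, hi], ?_⟩
    refine Halts.of_exec_le ⟨trivial, trivial⟩ (by decide) ?_
    obtain ⟨-, h6, h7, h8⟩ := hval _ h1
    obtain ⟨q, hq⟩ : ∃ q, q = s.arr succArr (s'.reg pReg) := ⟨_, rfl⟩
    rw [← hq] at h6 h7 h8
    rw [h2] at h7
    have hqn : q ≤ n := by
      by_contra hqn
      obtain rfl : q = n + 1 := by omega
      rw [hL.col_sink] at h7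
      omega
    have hexec : Program.exec (.seq (.assign pReg (.read succArr (.reg pReg)))
        (.write leftArr (.read colArr (.reg pReg)) (.read rankArr (.reg pReg)))) s' =
        (s'.setReg pReg q).setArr leftArr (i + 1) (J q) := by
      simp [Program.exec, RExpr.eval, hI', hJ', hS', ← hq, h7]
    rw [hexec]
    refine ⟨by simpa using hqn, by simpa using h7, by simp, by simpa using h4, ?_⟩
    intro i' hi'
    rcases (Nat.lt_succ_iff.1 hi').eq_or_lt with rfl | hi'
    · have h9 := hL.rank_le q h6
      rw [h7] at h9
      rw [posCost, posValue, h2, h7, ← h3] at h8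
      simp only [Store.setArr_arr, Store.setReg_arr, true_and, if_true,
        (Nat.succ_ne_self i').symm, if_false]
      exact ⟨h9, h8⟩
    · have h9 := h5 i' hi'
      have h10 : i' ≠ i + 1 := by omega
      have h11 : i' ≠ i := by omega
      simpa [h10, h11] using h9
  · rintro s' ⟨-, h2, -⟩ hu
    have hI' : s'.arr colArr = I := (hu.arr _ (by simp [Program.WritesArr])).trans (by simp [hI])
    have hlast' : s'.reg colReg = k + 1 :=
      (hu.reg _ (by simp [Program.WritesReg])).trans (by simp [hlast])
    simp [RExpr.eval, hI', hlast', h2]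
  · rintro s' hu ⟨-, -, -, h4, h5⟩
    refine ⟨?_, h4, h5⟩
    rw [hu.reg resultReg (by simp [Program.WritesReg])]
    simp

end Follow

/-! ### The program: the output -/

section Output

local notation "xReg" => (2 : ℕ)
local notation "yReg" => (3 : ℕ)
local notation "outArr" => (1 : ℕ)
local notation "rowArr" => (2 : ℕ)
local notation "posArr" => (5 : ℕ)
local notation "colArr" => (6 : ℕ)
local notation "rankArr" => (7 : ℕ)
local notation "leftArr" => (12 : ℕ)
local notation "loArr" => (13 : ℕ)
local notation "hiArr" => (14 : ℕ)

/-- The left end point, shifted by one, of the interval of a vertex in column `c` with the rank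
`r`, if `l` is the number of left sons of the vertex of the path. -/
def leftEnd (c r l : ℕ) : ℕ := c + if l < r then 1 else 0

/-- The right end point, shifted by one, of the same interval. -/
def rightEnd (c r l : ℕ) : ℕ := leftEnd c r l + if r = 0 then 1 else 0

/-- Computes the end points of the intervals. -/
def endpoints : Program :=
  .forLoop xReg (.reg 0)
    (.seq
      (.write loArr (.reg xReg) (.add (.read colArr (.read posArr (.reg xReg)))
        (.lt (.read leftArr (.read colArr (.read posArr (.reg xReg))))
          (.read rankArr (.read posArr (.reg xReg))))))
      (.write hiArr (.reg xReg) (.add (.read loArr (.reg xReg))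
        (.eq (.read rankArr (.read posArr (.reg xReg))) (.const 0)))))

theorem halts_endpoints {s : Store} {n : ℕ} (c r l : ℕ → ℕ) (hn : s.reg 0 = n)
    (hc : ∀ x < n, s.arr colArr (s.arr posArr x) = c x)
    (hr : ∀ x < n, s.arr rankArr (s.arr posArr x) = r x)
    (hl : ∀ x < n, s.arr leftArr (c x) = l x) :
    Halts endpoints s (n * (24 + 8) + 6) fun s' => ∀ x < n,
      s'.arr loArr x = leftEnd (c x) (r x) (l x) ∧ s'.arr hiArr x = rightEnd (c x) (r x) (l x) := by
  refine Halts.forLoop_reg (fun m s' => ∀ x < m,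
      s'.arr loArr x = leftEnd (c x) (r x) (l x) ∧ s'.arr hiArr x = rightEnd (c x) (r x) (l x))
    (by simp [Program.WritesReg]) (by simp) (by simp [Program.WritesReg]) hn
    (fun _ _ _ h => h) (fun x hx => absurd hx (Nat.not_lt_zero x)) ?_
  intro m hm s' hs' hu hx
  have ha : ∀ a, a = posArr ∨ a = colArr ∨ a = rankArr ∨ a = leftArr → s'.arr a = s.arr a :=
    fun a ha => hu.arr _ (by
      rcases ha with rfl | rfl | rfl | rfl <;> simp [Program.WritesArr, Program.forLoop])
  have h1 : s'.arr colArr (s'.arr posArr m) = c m := by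
    rw [ha colArr (by simp), ha posArr (by simp), hc m hm]
  have h2 : s'.arr rankArr (s'.arr posArr m) = r m := by
    rw [ha rankArr (by simp), ha posArr (by simp), hr m hm]
  have h3 : s'.arr leftArr (c m) = l m := by
    rw [ha leftArr (by simp), hl m hm]
  refine Halts.of_exec_le ⟨trivial, trivial⟩ (by decide) ?_
  intro x hx'
  rcases (Nat.lt_succ_iff.1 hx').eq_or_lt with rfl | hx'
  · simp [Program.exec, RExpr.eval, hx, h1, h2, h3, leftEnd, rightEnd]
  · have h4 := hs' x hx'
    simpa [Program.exec, RExpr.eval, hx, hx'.ne] using h4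

/-- Computes the adjacency matrix of the intersection graph of the intervals. -/
def matrix : Program :=
  .forLoop xReg (.reg 0)
    (.forLoop yReg (.reg 0)
      (.write outArr (.add (.read rowArr (.reg xReg)) (.reg yReg))
        (.eq (.const 0) (.add (.eq (.reg xReg) (.reg yReg))
          (.add (.lt (.read hiArr (.reg xReg)) (.read loArr (.reg yReg)))
            (.lt (.read hiArr (.reg yReg)) (.read loArr (.reg xReg))))))))

/-- The entries of this matrix. -/
def intersectEntry (lo hi : ℕ → ℕ) (x y : ℕ) : ℕ :=
  if x ≠ y ∧ lo y ≤ hi x ∧ lo x ≤ hi y then 1 else 0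

theorem add_eq_add_iff_of_mul {n x y x' y' : ℕ} (hy : y < n) (hy' : y' < n) :
    x * n + y = x' * n + y' ↔ x = x' ∧ y = y' := by
  refine ⟨fun h => ?_, by rintro ⟨rfl, rfl⟩; rfl⟩
  have h1 : y = y' := by
    have := congrArg (· % n) h
    simpa [Nat.add_mod, Nat.mod_eq_of_lt hy, Nat.mod_eq_of_lt hy'] using this
  subst h1
  exact ⟨Nat.eq_of_mul_eq_mul_right (by omega) (Nat.add_right_cancel h), rfl⟩

theorem halts_matrix {s : Store} {n : ℕ} (hn : s.reg 0 = n)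
    (hrow : ∀ x < n, s.arr rowArr x = x * n) :
    Halts matrix s (n * (n * (22 + 8) + 6 + 8) + 6) fun s' => ∀ x < n, ∀ y < n,
      s'.arr outArr (x * n + y) = intersectEntry (s.arr loArr) (s.arr hiArr) x y := by
  refine Halts.forLoop_reg (fun m s' => ∀ x < m, ∀ y < n,
      s'.arr outArr (x * n + y) = intersectEntry (s.arr loArr) (s.arr hiArr) x y)
    (by simp [Program.WritesReg, Program.forLoop]) (by simp)
    (by simp [Program.WritesReg, Program.forLoop]) hn (fun _ _ _ h => h)
    (fun x hx => absurd hx (Nat.not_lt_zero x)) ?_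
  intro m hm s' hs' hu hx
  have h0 : s'.reg 0 = n := (hu.reg 0 (by simp [Program.WritesReg, Program.forLoop])).trans hn
  refine (Halts.forLoop_reg (fun l s'' => ∀ x y, (x < m ∧ y < n) ∨ (x = m ∧ y < l) →
      s''.arr outArr (x * n + y) = intersectEntry (s.arr loArr) (s.arr hiArr) x y)
    (by simp [Program.WritesReg]) (by simp) (by simp [Program.WritesReg]) h0 (fun _ _ _ h => h)
    ?_ ?_).mono le_rfl fun s'' _ h x hx y hy => h x y (by omega)
  · rintro x y (h | h)
    · exact hs' x h.1 y h.2
    · exact absurd h.2 (Nat.not_lt_zero y)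
  · intro l hl s'' hs'' hu' hy
    have ha : ∀ a, a = rowArr ∨ a = loArr ∨ a = hiArr → s''.arr a = s.arr a := fun a ha =>
      (hu'.arr _ (by
        rcases ha with rfl | rfl | rfl <;> simp [Program.WritesArr, Program.forLoop])).trans
        (hu.arr _ (by rcases ha with rfl | rfl | rfl <;> simp [Program.WritesArr, Program.forLoop]))
    have hx' : s''.reg xReg = m :=
      (hu'.reg _ (by simp [Program.WritesReg, Program.forLoop])).trans hx
    refine Halts.of_exec_le trivial (by decide) ?_
    intro x y hxy
    have hyn : y < n := by omega
    have hval : (RExpr.eq (.const 0) (.add (.eq (.reg xReg) (.reg yReg))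
          (.add (.lt (.read hiArr (.reg xReg)) (.read loArr (.reg yReg)))
            (.lt (.read hiArr (.reg yReg)) (.read loArr (.reg xReg)))))).eval s'' =
        intersectEntry (s.arr loArr) (s.arr hiArr) m l := by
      simp only [RExpr.eval, hx', hy, ha loArr (by simp), ha hiArr (by simp), intersectEntry]
      refine if_congr ?_ rfl rfl
      split_ifs <;> simp <;> omega
    have hpos : (RExpr.add (.read rowArr (.reg xReg)) (.reg yReg)).eval s'' = m * n + l := by
      simp only [RExpr.eval, hx', hy, ha rowArr (by simp), hrow m hm]
    rw [Program.exec, hval, hpos, Store.setArr_arr]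
    simp only [true_and, add_eq_add_iff_of_mul hyn hl]
    split_ifs with h
    · rw [h.1, h.2]
    · exact hs'' x y (by omega)

variable {n : ℕ} {G : SimpleGraph (Fin n)} {k : ℕ} {v : Fin (k + 1) → Fin n}

/-- The normal model in which the first `ℓ i` sons of `v i` are left sons. -/
noncomputable def rankModel (hv : IsCentralPath G v) (ℓ : Fin (k + 1) → ℕ) : Fin n → Set ℝ :=
  normalModel hv {x | sonRank hv x ≤ ℓ (hv.index x)}

theorem isNormalModel_rankModel (hG : G.IsTree) (hv : IsCentralPath G v) (ℓ : Fin (k + 1) → ℕ) :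
    IsNormalModel G v (rankModel hv ℓ) := isNormalModel_normalModel hv hG _

theorem numLeftSons_rankModel (hG : G.IsTree) (hv : IsCentralPath G v) {ℓ : Fin (k + 1) → ℕ}
    (hℓ : ∀ i, ℓ i ≤ numSons G v i) : numLeftSons G v (rankModel hv ℓ) = ℓ := by
  funext i
  rw [rankModel, numLeftSons_normalModel hv hG]
  conv_rhs => rw [← ncard_sonRank_le hG hv i (hℓ i)]
  congr 1
  ext x
  simp only [Set.mem_inter_iff, Set.mem_ofPred_eq, and_congr_right_iff]
  intro hx
  rw [((hv.mem_sons hG).1 hx).2]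

theorem rankModel_eq (hv : IsCentralPath G v) (ℓ : Fin (k + 1) → ℕ) (x : Fin n) :
    rankModel hv ℓ x = Set.Icc
      (((leftEnd (hv.index x + 1) (sonRank hv x) (ℓ (hv.index x)) : ℕ) : ℝ) - 1)
      (((rightEnd (hv.index x + 1) (sonRank hv x) (ℓ (hv.index x)) : ℕ) : ℝ) - 1) := by
  rw [rankModel, normalModel]
  by_cases hx : x ∈ Set.range v
  · simp [hx, sonRank_spine, leftEnd, rightEnd]
  · have h : sonRank hv x ≠ 0 := by
      rw [sonRank_eq hv hx]
      exact Nat.succ_ne_zero _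
    by_cases hl : sonRank hv x ≤ ℓ (hv.index x)
    · simp [hx, h, hl, not_lt.2 hl, leftEnd, rightEnd]
    · simp [hx, h, hl, not_le.1 hl, leftEnd, rightEnd]

theorem intersectionGraph_rankModel_adj (hv : IsCentralPath G v) (ℓ : Fin (k + 1) → ℕ)
    {lo hi : ℕ → ℕ}
    (hlo : ∀ x : Fin n, lo x = leftEnd (hv.index x + 1) (sonRank hv x) (ℓ (hv.index x)))
    (hhi : ∀ x : Fin n, hi x = rightEnd (hv.index x + 1) (sonRank hv x) (ℓ (hv.index x)))
    (x y : Fin n) : (intersectionGraph (rankModel hv ℓ)).Adj x y ↔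
      (x : ℕ) ≠ y ∧ lo y ≤ hi x ∧ lo x ≤ hi y := by
  have hle : ∀ x : Fin n, ((lo x : ℕ) : ℝ) - 1 ≤ ((hi x : ℕ) : ℝ) - 1 := fun x => by
    have : lo x ≤ hi x := by
      rw [hlo, hhi, rightEnd]
      exact Nat.le_add_right _ _
    have : ((lo x : ℕ) : ℝ) ≤ hi x := by exact_mod_cast this
    linarith
  change x ≠ y ∧ (rankModel hv ℓ x ∩ rankModel hv ℓ y).Nonempty ↔ _
  rw [rankModel_eq, rankModel_eq, ← hlo, ← hlo, ← hhi, ← hhi,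
    Icc_inter_Icc_nonempty (hle x) (hle y), sub_le_sub_iff_right, sub_le_sub_iff_right,
    Nat.cast_le, Nat.cast_le, Ne, Fin.ext_iff]
  tauto

end Output

/-! ### The whole program -/

section Whole

local notation "resultReg" => (1 : ℕ)
local notation "yReg" => (3 : ℕ)
local notation "curReg" => (4 : ℕ)
local notation "colReg" => (6 : ℕ)
local notation "countReg" => (7 : ℕ)
local notation "outArr" => (1 : ℕ)
local notation "rowArr" => (2 : ℕ)
local notation "degArr" => (3 : ℕ)
local notation "innerDegArr" => (4 : ℕ)
local notation "posArr" => (5 : ℕ)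
local notation "colArr" => (6 : ℕ)
local notation "rankArr" => (7 : ℕ)
local notation "numArr" => (8 : ℕ)
local notation "triArr" => (9 : ℕ)
local notation "valArr" => (10 : ℕ)
local notation "leftArr" => (12 : ℕ)

variable {n : ℕ} {G : SimpleGraph (Fin n)} {k : ℕ} {v : Fin (k + 1) → Fin n}

/-- At most one neighbour of `x` has two neighbours itself. -/
def AtMostOneInner (G : SimpleGraph (Fin n)) (x : Fin n) : Prop :=
  ∀ y z, G.Adj x y → IsInner G y → G.Adj x z → IsInner G z → y = z

open scoped Classical in
theorem one_lt_sum_adj (G : SimpleGraph (Fin n)) (x : Fin n) :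
    1 < ∑ y : Fin n, (if G.Adj x y then 1 else 0) ↔ IsInner G x := by
  rw [Finset.sum_boole, Nat.cast_id, Finset.one_lt_card]
  simp only [Finset.mem_filter, Finset.mem_univ, true_and, IsInner]
  constructor
  · rintro ⟨y, hy, z, hz, h⟩
    exact ⟨y, z, h, hy, hz⟩
  · rintro ⟨y, z, h, hy, hz⟩
    exact ⟨y, hy, z, hz, h⟩

open scoped Classical in
theorem sum_adj_isInner_lt_two (G : SimpleGraph (Fin n)) (x : Fin n) :
    ∑ y : Fin n, (if G.Adj x y ∧ IsInner G y then 1 else 0) < 2 ↔ AtMostOneInner G x := by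
  rw [Finset.sum_boole, Nat.cast_id, Nat.lt_succ_iff, Finset.card_le_one]
  simp only [Finset.mem_filter, Finset.mem_univ, true_and, AtMostOneInner]
  constructor
  · exact fun h y z h1 h2 h3 h4 => h y ⟨h1, h2⟩ z ⟨h3, h4⟩
  · exact fun h y hy z hz => h y z hy.1 hy.2 hz.1 hz.2

/-- Computes the tables and the degrees, and chooses the start of the central path. -/
def prepare : Program := .seq tables (.seq degrees (.seq innerDegrees chooseStart))

theorem halts_prepare (G : SimpleGraph (Fin n)) :
    Halts prepare (inputStore G) (n * (43 * n + 75) + 24) fun s =>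
      (∀ i ≤ n, s.arr rowArr i = i * n ∧ s.arr triArr i = i.choose 2) ∧
      (∀ x : Fin n, 1 < s.arr degArr x ↔ IsInner G x) ∧
      ((s.reg curReg = 0 ∧ ∀ x, ¬ (IsInner G x ∧ AtMostOneInner G x)) ∨
        ∃ u : Fin n, s.reg curReg = u ∧ IsInner G u ∧ AtMostOneInner G u) := by
  classical
  refine Halts.mono (T := (n * (16 + 8) + 6) + ((n * (n * (5 + 5 + 8) + 6 + 8) + 6) +
    ((n * (n * (12 + 5 + 8) + 6 + 8) + 6) + (n * (15 + 8) + 6)))) ?_ (le_of_eq (by ring))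
    fun _ _ h => h
  refine Halts.seq (halts_tables (by simp [inputStore]) (by simp [inputStore])
    (by simp [inputStore])) ?_
  intro s₁ hu₁ hs₁
  have hn₁ : s₁.reg 0 = n :=
    (hu₁.reg _ (by simp [Program.WritesReg, Program.forLoop, tables])).trans (by simp [inputStore])
  have hadj₁ : ∀ x y : Fin n, s₁.arr 0 (s₁.arr rowArr x + y) = if G.Adj x y then 1 else 0 :=
    fun x y => by
      rw [hu₁.arr 0 (by simp [Program.WritesArr, Program.forLoop, tables]), (hs₁ x x.2.le).1]
      exact inputStore_holdsAdjMatrix G x y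
  refine Halts.seq (halts_accumulate (e := adjExpr 2 3)
    (fun i j => s₁.arr 0 (s₁.arr rowArr i + j)) hn₁ ?_ ?_) ?_
  · intro i
    rw [hu₁.arr _ (by simp [Program.WritesArr, Program.forLoop, tables])]
    simp [inputStore]
  · intro i _ j _ s' hu' hx hy
    have h0 := hu'.arr 0 (by simp [Program.WritesArr, Program.forLoop, accumulate])
    have h2 := hu'.arr rowArr (by simp [Program.WritesArr, Program.forLoop, accumulate])
    simp only [adjExpr, RExpr.eval, hx, hy, h0, h2]
  intro s₂ hu₂ hs₂
  have hn₂ : s₂.reg 0 = n :=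
    (hu₂.reg _ (by simp [Program.WritesReg, Program.forLoop, degrees, accumulate])).trans hn₁
  have h0₂ := hu₂.arr 0 (by simp [Program.WritesArr, Program.forLoop, degrees, accumulate])
  have hrow₂ := hu₂.arr rowArr (by simp [Program.WritesArr, Program.forLoop, degrees, accumulate])
  have htri₂ := hu₂.arr triArr (by simp [Program.WritesArr, Program.forLoop, degrees, accumulate])
  have hdeg₂ : ∀ x : Fin n, 1 < s₂.arr degArr x ↔ IsInner G x := fun x => by
    rw [hs₂ x x.2, Finset.sum_range]
    simp only [hadj₁]
    exact one_lt_sum_adj G x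
  refine Halts.seq (halts_accumulate (fun i j => if 1 < s₁.arr 0 (s₁.arr rowArr i + j) +
    (if 1 < s₂.arr degArr j then 1 else 0) then 1 else 0) hn₂ ?_ ?_) ?_
  · intro i
    rw [hu₂.arr _ (by simp [Program.WritesArr, Program.forLoop, degrees, accumulate]),
      hu₁.arr _ (by simp [Program.WritesArr, Program.forLoop, tables])]
    simp [inputStore]
  · intro i _ j _ s' hu' hx hy
    have h0 := hu'.arr 0 (by simp [Program.WritesArr, Program.forLoop, accumulate])
    have h2 := hu'.arr rowArr (by simp [Program.WritesArr, Program.forLoop, accumulate])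
    have h3 := hu'.arr degArr (by simp [Program.WritesArr, Program.forLoop, accumulate])
    simp only [adjExpr, RExpr.eval, hx, hy, h0, h2, h3, h0₂, hrow₂]
  intro s₃ hu₃ hs₃
  have hn₃ : s₃.reg 0 = n :=
    (hu₃.reg _ (by simp [Program.WritesReg, Program.forLoop, innerDegrees, accumulate])).trans hn₂
  have hrow₃ := hu₃.arr rowArr (by
    simp [Program.WritesArr, Program.forLoop, innerDegrees, accumulate])
  have htri₃ := hu₃.arr triArr (by
    simp [Program.WritesArr, Program.forLoop, innerDegrees, accumulate])
  have hdeg₃ := hu₃.arr degArr (by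
    simp [Program.WritesArr, Program.forLoop, innerDegrees, accumulate])
  have hinner₃ : ∀ x : Fin n, s₃.arr innerDegArr x < 2 ↔ AtMostOneInner G x := fun x => by
    rw [hs₃ x x.2, Finset.sum_range, ← sum_adj_isInner_lt_two]
    refine iff_of_eq (congrArg (· < 2) (Finset.sum_congr rfl fun y _ => ?_))
    simp only [hadj₁, hdeg₂]
    by_cases h1 : G.Adj x y <;> by_cases h2 : IsInner G y <;> simp [h1, h2]
  have hcur₃ : s₃.reg curReg = 0 := by
    rw [hu₃.reg _ (by simp [Program.WritesReg, Program.forLoop, innerDegrees, accumulate]),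
      hu₂.reg _ (by simp [Program.WritesReg, Program.forLoop, degrees, accumulate]),
      hu₁.reg _ (by simp [Program.WritesReg, Program.forLoop, tables])]
    simp [inputStore]
  refine (halts_chooseStart hn₃ hcur₃).mono le_rfl fun s₄ hu₄ hs₄ => ?_
  have hrow₄ := hu₄.arr rowArr (by simp [Program.WritesArr, Program.forLoop, chooseStart])
  have htri₄ := hu₄.arr triArr (by simp [Program.WritesArr, Program.forLoop, chooseStart])
  have hdeg₄ := hu₄.arr degArr (by simp [Program.WritesArr, Program.forLoop, chooseStart])
  rw [hrow₄, htri₄, hrow₃, htri₃, hrow₂, htri₂, hdeg₄, hdeg₃]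
  refine ⟨hs₁, hdeg₂, ?_⟩
  rw [hdeg₃] at hs₄
  rcases hs₄ with ⟨h1, h2⟩ | ⟨h1, h2, h3⟩
  · refine Or.inl ⟨h1, fun x hx => h2 x x.2 ⟨(hdeg₂ x).2 hx.1, (hinner₃ x).2 hx.2⟩⟩
  · exact Or.inr ⟨⟨_, h1⟩, rfl, (hdeg₂ ⟨_, h1⟩).1 h2, (hinner₃ ⟨_, h1⟩).1 h3⟩

/-- Constructs the completion once the start of the central path is known. -/
def construct : Program :=
  .seq walk
    (.seq (.write colArr (.add (.reg 0) (.const 1)) (.add (.reg colReg) (.const 1)))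
      (.seq evaluate (.seq follow (.seq endpoints matrix))))

/-- The conclusion describes the output in terms of the choices `ℓ` that the program has found. -/
theorem halts_construct (hG : G.IsTree) (hv : IsCentralPath G v) {s : Store} (hin : WalkInput hv s)
    (htab : ∀ i ≤ n, s.arr rowArr i = i * n ∧ s.arr triArr i = i.choose 2)
    (hcur : s.reg curReg = v 0) (hcol : s.reg colReg = 0) (hcount : s.reg countReg = 0)
    (hzero : ∀ a, 5 ≤ a → a ≠ triArr → ∀ q, s.arr a q = 0) :
    Halts construct s (((k + 1) * (n * 49 + 31) + 5) + (7 + (((n + 1) * ((n + 2) * 70 + 21) + 6) +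
        (((k + 1) * 13 + 10) + ((n * 32 + 6) + (n * (n * 30 + 14) + 6)))))) fun s' =>
      ∃ ℓ : Fin (k + 1) → ℕ, IsDPChoice k (numSons G v) ℓ ∧
        s'.reg resultReg = dpValue k (numSons G v) ∧
        HoldsAdjMatrix (intersectionGraph (rankModel hv ℓ)) (s'.arr outArr) := by
  classical
  refine Halts.seq (halts_walk hG hv hin hcur hcol hcount (hzero _ (by omega) (by omega))
    (hzero _ (by omega) (by omega)) (hzero _ (by omega) (by omega))
    (hzero _ (by omega) (by omega))) ?_
  rintro s₁ hu₁ ⟨hst, hcol₁⟩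
  obtain ⟨hlay, hpos₁⟩ := hst.isLayoutOf hG
  obtain ⟨I, hI⟩ : ∃ I : ℕ → ℕ, I = Function.update (s₁.arr colArr) (n + 1) (k + 2) := ⟨_, rfl⟩
  obtain ⟨J, hJ⟩ : ∃ J, J = s₁.arr rankArr := ⟨_, rfl⟩
  obtain ⟨M, hM⟩ : ∃ M, M = s₁.arr numArr := ⟨_, rfl⟩
  rw [← hI, ← hJ, ← hM] at hlay
  have hL := hlay.isLayout hG
  have hMnum : (fun i => M (i + 1)) = numSons G v := funext hlay.num
  have hw : ∀ a, a < 5 ∨ 9 ≤ a → s₁.arr a = s.arr a := fun a ha => hu₁.arr a (by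
    simp [Program.WritesArr, Program.forLoop, walk, visitSpine, visitNeighbour, visitSon]
    omega)
  have hn₁ : s₁.reg 0 = n := (hu₁.reg _ (by
    simp [Program.WritesReg, Program.forLoop, walk, visitSpine, visitNeighbour, visitSon])).trans
    hin.n_eq
  refine Halts.seq (P := fun s' => s' = s₁.setArr colArr (n + 1) (k + 2)) (Halts.of_exec_le trivial
    (by decide) (by simp [Program.exec, RExpr.eval, hn₁, hcol₁])) ?_
  rintro s₂ - rfl
  have hI₂ : (s₁.setArr colArr (n + 1) (k + 2)).arr colArr = I := by
    simp [hI, Store.setArr]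
  have hs₂ : ∀ a, a ≠ colArr → (s₁.setArr colArr (n + 1) (k + 2)).arr a = s₁.arr a := fun a ha =>
    Function.update_of_ne ha _ _
  generalize hs₂' : s₁.setArr colArr (n + 1) (k + 2) = s₂ at hI₂ hs₂ ⊢
  have hn₂ : s₂.reg 0 = n := by simp [← hs₂', hn₁]
  have hcol₂ : s₂.reg colReg = k + 1 := by simp [← hs₂', hcol₁]
  have hEI : EvalInput n k I J M s₂ := by
    refine ⟨hn₂, hcol₂, hI₂, ?_, ?_, fun i hi => ?_⟩
    · rw [hs₂ _ (by omega), hJ]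
    · rw [hs₂ _ (by omega), hM]
    · rw [hs₂ _ (by omega), hw _ (by omega), (htab i hi).2]
  refine Halts.seq (halts_evaluate hL hEI (by
    rw [hs₂ _ (by omega), hw _ (by omega), hzero _ (by omega) (by omega)])) ?_
  intro s₃ hu₃ hs₃
  have hEI₃ := hEI.of_unchanged hu₃
  have hleft₃ : s₃.arr leftArr = s.arr leftArr := by
    rw [hu₃.arr _ (by simp [Program.WritesArr, Program.forLoop, evaluate, tryContinuation]),
      hs₂ _ (by omega), hw _ (by omega)]
  refine Halts.seq (halts_follow hL hEI₃.last hEI₃.col hEI₃.rank (by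
    rw [hleft₃, hzero _ (by omega) (by omega)]) hs₃) ?_
  rintro s₄ hu₄ ⟨hres₄, hleft₄, hatt⟩
  have hn₄ : s₄.reg 0 = n :=
    (hu₄.reg _ (by simp [Program.WritesReg, follow])).trans hEI₃.n_eq
  have ha₄ : ∀ a, a ≠ leftArr → s₄.arr a = s₃.arr a := fun a ha => hu₄.arr a (by
    simpa [Program.WritesArr, follow] using ha.symm)
  have hpos₄ : ∀ x : Fin n, s₄.arr posArr x = position hv x := fun x => by
    rw [ha₄ _ (by omega),
      hu₃.arr _ (by simp [Program.WritesArr, Program.forLoop, evaluate, tryContinuation]),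
      hs₂ _ (by omega), hpos₁]
  have hrow₄ : ∀ x < n, s₄.arr rowArr x = x * n := fun x hx => by
    rw [ha₄ _ (by omega),
      hu₃.arr _ (by simp [Program.WritesArr, Program.forLoop, evaluate, tryContinuation]),
      hs₂ _ (by omega), hw _ (by omega), (htab x hx.le).1]
  have hchoice := hatt.isDPChoice hL.num_zero hleft₄
  rw [hMnum] at hchoice hres₄
  refine Halts.seq (halts_endpoints (fun x => I (s₄.arr posArr x)) (fun x => J (s₄.arr posArr x))
    (fun x => s₄.arr leftArr (I (s₄.arr posArr x))) hn₄ (fun x _ => ?_) (fun x _ => ?_)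
    fun x _ => rfl) ?_
  · rw [ha₄ _ (by omega), hEI₃.col]
  · rw [ha₄ rankArr (by omega), hEI₃.rank]
  intro s₅ hu₅ hs₅
  have hn₅ : s₅.reg 0 = n :=
    (hu₅.reg _ (by simp [Program.WritesReg, Program.forLoop, endpoints])).trans hn₄
  have hrow₅ : s₅.arr rowArr = s₄.arr rowArr :=
    hu₅.arr _ (by simp [Program.WritesArr, Program.forLoop, endpoints])
  refine (halts_matrix hn₅ (by rwa [hrow₅])).mono le_rfl fun s₆ hu₆ hs₆ => ?_
  refine ⟨_, hchoice, ?_, fun x y => ?_⟩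
  · rw [hu₆.reg _ (by simp [Program.WritesReg, Program.forLoop, matrix]),
      hu₅.reg _ (by simp [Program.WritesReg, Program.forLoop, endpoints]), hres₄]
  · rw [hs₆ x x.2 y y.2]
    refine if_congr (intersectionGraph_rankModel_adj hv _ (fun x => ?_) (fun x => ?_) x y).symm
      rfl rfl
    · rw [(hs₅ x x.2).1, hpos₄, hlay.col, hlay.rank]
    · rw [(hs₅ x x.2).2, hpos₄, hlay.col, hlay.rank]

/-- The algorithm. Register `0` holds `n`, register `1` the result, and registers `2` and `3` are
counters. The walk is at the vertex in register `4`, goes on to the vertex in register `5`, and has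
reached the column in register `6` and the position in register `7`. Registers `8`, `9` and `10`
serve the evaluation of the dynamic program, for the current position, the best cost so far and the
cost to be compared.

Array `0` holds the input and array `1` the output. Array `2` holds the multiples of `n`, array `9`
the triangular numbers, array `3` the degrees, and array `4` the numbers of neighbours of degree at
least two. Array `5` holds the position of each vertex; arrays `6` and `7` hold the column and the
rank of each position, and array `8` the number of sons in each column. Arrays `10` and `11` hold
the value of, and the best continuation from, each position, and array `12` the number of left sons
chosen in each column. Arrays `13` and `14` hold the end points of the intervals. -/
def solve : Program := .seq prepare construct

/-- The factor `1000` is a generous bound for the sum of the coefficients of all time bounds. -/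
theorem halts_solve (hG : IsCaterpillar G) :
    Halts solve (inputStore G) (1000 * n ^ 2) fun s =>
      ∃ (k : ℕ) (v : Fin (k + 1) → Fin n) (hv : IsCentralPath G v) (ℓ : Fin (k + 1) → ℕ),
        IsDPChoice k (numSons G v) ℓ ∧ s.reg resultReg = dpValue k (numSons G v) ∧
        HoldsAdjMatrix (intersectionGraph (rankModel hv ℓ)) (s.arr outArr) := by
  obtain ⟨w⟩ := hG.1.connected.nonempty
  have hn : 0 < n := w.pos
  refine Halts.mono (T := (n * (43 * n + 75) + 24) + ((n * (n * 49 + 31) + 5) +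
    (7 + (((n + 1) * ((n + 2) * 70 + 21) + 6) +
        ((n * 13 + 10) + ((n * 32 + 6) + (n * (n * 30 + 14) + 6))))))) ?_ ?_ fun _ _ h => h
  swap
  · have h1 : n ≤ n * n := Nat.le_mul_self n
    nlinarith
  refine Halts.seq (halts_prepare G) ?_
  rintro s hu ⟨htab, hdeg, hstart⟩
  have hreg : ∀ r, r = 0 ∨ 5 ≤ r → s.reg r = (inputStore G).reg r := fun r hr => hu.reg r (by
    simp [Program.WritesReg, Program.forLoop, prepare, tables, degrees, innerDegrees, accumulate,
      chooseStart]
    omega)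
  have harr : ∀ a, a = 0 ∨ 5 ≤ a ∧ a ≠ triArr → s.arr a = (inputStore G).arr a := fun a ha =>
    hu.arr a (by
      simp [Program.WritesArr, Program.forLoop, prepare, tables, degrees, innerDegrees, accumulate,
        chooseStart]
      omega)
  obtain ⟨u, hu, hu'⟩ : ∃ u : Fin n, s.reg curReg = u ∧
      ((∀ x, ¬ (IsInner G x ∧ AtMostOneInner G x)) ∨ (IsInner G u ∧ AtMostOneInner G u)) := by
    rcases hstart with ⟨h1, h2⟩ | ⟨u, h1, h2⟩
    · exact ⟨⟨0, hn⟩, h1, Or.inl h2⟩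
    · exact ⟨u, h1, Or.inr h2⟩
  obtain ⟨k, v, hv, hv0, hrange⟩ := exists_centralPath_start hG hu'
  have hk : k + 1 ≤ n := by
    simpa using Fintype.card_le_of_injective v hv.injective
  have hadj : ∀ x y : Fin n, s.arr 0 (s.arr rowArr x + y) = (inputStore G).arr 0 (x * n + y) :=
    fun x y => by rw [harr 0 (Or.inl rfl), (htab x x.2.le).1]
  have hin : WalkInput hv s := by
    refine ⟨?_, fun x y h => ?_, fun x y h => ?_, fun x hx => ?_, fun i hi => ?_⟩
    · rw [hreg 0 (Or.inl rfl)]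
      simp [inputStore]
    · rw [hadj, inputStore_holdsAdjMatrix, if_pos h]
    · rw [hadj, inputStore_holdsAdjMatrix, if_neg h]
    · rw [hrange] at hx
      exact not_lt.1 fun h => hx (Or.inr ((hdeg x).1 h))
    · rw [hdeg]
      refine ((hrange (v i)).1 ⟨i, rfl⟩).resolve_left fun h => hi (hv.injective ?_)
      rw [h, hv0]
  refine (halts_construct hG.1 hv hin htab (by rw [hu, hv0]) ?_ ?_ ?_).mono ?_
    fun s' _ ⟨ℓ, h⟩ => ⟨k, v, hv, ℓ, h⟩
  · rw [hreg _ (by omega)]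
    simp [inputStore]
  · rw [hreg _ (by omega)]
    simp [inputStore]
  · intro a ha ha' q
    rw [harr a (Or.inr ⟨ha, ha'⟩)]
    have h : a ≠ 0 := by omega
    simp [inputStore, h]
  · gcongr

end Whole

end CaterpillarPIG

theorem mainTheorem4 :
    -- every central path of every finite caterpillar
    (∀ {V : Type*} [Finite V] (G : SimpleGraph V), G.IsTree →
      ∀ (k : ℕ) (v : Fin (k + 1) → V), CaterpillarPIG.IsCentralPath G v →
        -- every graph in normal form is a proper interval completion
        (∀ (H : SimpleGraph V) (J : V → Set ℝ), CaterpillarPIG.IsNormalModel G v J →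
          CaterpillarPIG.IsIntersectionModel H J → CaterpillarPIG.IsPIGCompletion G H) ∧
        -- some minimum proper interval completion has the normal form
        (∃ (H : SimpleGraph V) (J : V → Set ℝ), CaterpillarPIG.IsMinPIGCompletion G H ∧
          CaterpillarPIG.IsNormalModel G v J ∧ CaterpillarPIG.IsIntersectionModel H J) ∧
        -- the dynamic program computes the proper interval completion number
        (∀ H : SimpleGraph V, CaterpillarPIG.IsMinPIGCompletion G H →
          CaterpillarPIG.fillNumber G H =
            CaterpillarPIG.dpValue k (CaterpillarPIG.numSons G v)) ∧
        -- the choices that attain its minima yield a minimum completion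
        (∃ ℓ : Fin (k + 1) → ℕ,
          CaterpillarPIG.IsDPChoice k (CaterpillarPIG.numSons G v) ℓ) ∧
        (∀ ℓ : Fin (k + 1) → ℕ, CaterpillarPIG.IsDPChoice k (CaterpillarPIG.numSons G v) ℓ →
          (∃ J : V → Set ℝ, CaterpillarPIG.IsNormalModel G v J ∧
            CaterpillarPIG.numLeftSons G v J = ℓ) ∧
          ∀ (H : SimpleGraph V) (J : V → Set ℝ), CaterpillarPIG.IsNormalModel G v J →
            CaterpillarPIG.numLeftSons G v J = ℓ → CaterpillarPIG.IsIntersectionModel H J →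
            CaterpillarPIG.IsMinPIGCompletion G H)) ∧
    -- an algorithm that computes a minimum completion of this form in quadratic time
    (∃ (p : CaterpillarPIG.Program) (C : ℕ),
      ∀ (n : ℕ) (G : SimpleGraph (Fin n)), CaterpillarPIG.IsCaterpillar G →
        ∃ (t : ℕ) (s : CaterpillarPIG.Store),
          CaterpillarPIG.Run p (CaterpillarPIG.inputStore G) t s ∧ t ≤ C * n ^ 2 ∧
          ∃ (k : ℕ) (v : Fin (k + 1) → Fin n) (J : Fin n → Set ℝ) (H : SimpleGraph (Fin n)),
            CaterpillarPIG.IsCentralPath G v ∧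
            CaterpillarPIG.IsNormalModel G v J ∧
            CaterpillarPIG.IsDPChoice k (CaterpillarPIG.numSons G v)
              (CaterpillarPIG.numLeftSons G v J) ∧
            CaterpillarPIG.IsIntersectionModel H J ∧
            CaterpillarPIG.IsMinPIGCompletion G H ∧
            CaterpillarPIG.HoldsAdjMatrix H (s.arr 1) ∧
            s.reg 1 = CaterpillarPIG.fillNumber G H) := by
  open CaterpillarPIG in
  refine ⟨fun {V} _ G hG k v hv => ?_, solve, 1000, fun n G hG => ?_⟩
  · obtain ⟨ℓ, hℓ⟩ := exists_isDPChoice k (numSons G v)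
    obtain ⟨J, hJ, hJℓ⟩ := exists_isNormalModel_numLeftSons hG hv (fun i => hℓ.le i)
    refine ⟨fun H J hJ hH => hJ.isPIGCompletion hG hv hH, ?_,
      fun H hH => hH.fillNumber_eq hG hv, ⟨_, hℓ⟩, fun ℓ hℓ => ?_⟩
    · have hmodel := isIntersectionModel_intersectionGraph J
      rw [← hJℓ] at hℓ
      exact ⟨intersectionGraph J, J, hℓ.isMinPIGCompletion hG hv hJ hmodel, hJ, hmodel⟩
    · refine ⟨exists_isNormalModel_numLeftSons hG hv fun i => hℓ.le i, fun H J hJ hJℓ hH => ?_⟩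
      rw [← hJℓ] at hℓ
      exact hℓ.isMinPIGCompletion hG hv hJ hH
  · obtain ⟨t, s, hrun, ht, k, v, hv, ℓ, hℓ, hres, hout⟩ := halts_solve hG
    have hJ := isNormalModel_rankModel hG.1 hv ℓ
    have hJℓ := numLeftSons_rankModel hG.1 hv fun i => hℓ.le i
    have hmodel := isIntersectionModel_intersectionGraph (rankModel hv ℓ)
    rw [← hJℓ] at hℓ
    have hmin := hℓ.isMinPIGCompletion hG.1 hv hJ hmodel
    exact ⟨t, s, hrun, ht, k, v, rankModel hv ℓ, intersectionGraph (rankModel hv ℓ), hv, hJ, hℓ,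
      hmodel, hmin, hout, hres.trans (hmin.fillNumber_eq hG.1 hv).symm⟩
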